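/- Let $U,V$ be separable real Hilbert spaces, $(\Omega,\mathcal F,P)$ a probability space and $L=(L(t))_{t\ge 0}$ a cylindrical Lévy process in $U$: each $L(t)$ is a linear map from $U$ to real random variables (modulo $P$-null sets), continuous with respect to convergence in probability, and $((L(t)u_1,\dots,L(t)u_n))_{t\ge0}$ is a Lévy process in $\mathbb R^n$ for all $u_1,\dots,u_n\in U$. Let $\mathcal F_t=\sigma(L(s)u: u\in U,\ 0\le s\le t)$, all versions of $L(s)u$ being included. Assume weak second moments, $E|L(1)u|^2<\infty$ for all $u\in U$, and that $L$ is a cylindrical martingale, i.e. $(L(t)u)_{t\ge 0}$ is an $(\mathcal F_t)$-martingale for every $u\in U$. Let $(p,q,\nu)$ be the cylindrical characteristics of $L$: $p:U\to\mathbb R$ is continuous, $q$ is a quadratic form on $U$, $\nu$ is a cylindrical measure on $U$ whose images $\nu\circ\langle\cdot,u\rangle^{-1}$ are, off the origin, Lévy measures on $\mathbb R$, and $$E\,e^{iL(t)u}=\exp\Big(t\Big(ip(u)-\tfrac12 q(u)+\int_U\big(e^{i\langle u,a\rangle}-1-i\langle u,a\rangle 1_{[-1,1]}(\langle u,a\rangle)\big)\,\nu(da)\Big)\Big),\qquad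 t\ge 0,\ u\in U.$$ Assume that $q$ is continuous. Let $\mathcal L_2$ denote the space of Hilbert–Schmidt operators $U\to V$ with the Hilbert–Schmidt norm $\|\cdot\|_{HS}$ (the same notation is used for the norm of Hilbert–Schmidt operators $V\to U$), and write $A^*$ for the adjoint of $A$. Then the following holds. (i) There is a positive operator $Q\in\mathcal L(U,U)$, with positive square root $Q^{1/2}$, such that $q(u)=\langle Qu,u\rangle$ for all $u\in U$. (ii) For every $\varphi\in\mathcal L_2$ there is a unique Borel measure $\nu_\varphi$ on $V$ with $\nu_\varphi(\{0\})=0$ that agrees with $\nu\circ\varphi^{-1}$ on all cylindrical sets not containing $0$, and $$\int_U\|\varphi u\|^2\,\nu(du):=\int_V\|v\|^2\,\nu_\varphi(dv)<\infty .$$ (iii) Let $T\ge 0$ and let $\Psi:[0,T]\times\Omega\to\mathcal L_2$ be predictable with $E\int_0^T\|\Psi(s)\|_{HS}^2ds<\infty$. Then the stochastic integral $\int_0^T\Psi\,dL\in L^2_P(\Omega;V)$ exists, is unique, and satisfies $$E\Big\|\int_0^T\Psi(s)\,dL(s)\Big\|^2=\int_0^T E\Big[\|Q^{1/2}\Psi^*(s)\|_{HS}^2+\int_U\|\Psi(s)u\|^2\,\nu(du)\Big]ds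 .$$ Here the integral is defined as follows. For $s\le t$ and $\varphi\in\mathcal L_2$ let $X_\varphi\in L^2_P(\Omega;V)$ be given by $\langle X_\varphi,v\rangle=(L(t)-L(s))(\varphi^*v)$ a.s. for all $v\in V$; put $J_{s,t}(\sum_i 1_{A_i}\varphi_i)=\sum_i1_{A_i}X_{\varphi_i}$ for finitely many disjoint $A_i\in\mathcal F_s$, and extend $J_{s,t}$ by continuity to $L^2_P(\Omega,\mathcal F_s;\mathcal L_2)$. For a simple process $\Psi=\sum_{k<N}\Phi_k1_{(t_k,t_{k+1}]}$, with $0=t_0<\dots<t_N=T$ and $\Phi_k\in L^2_P(\Omega,\mathcal F_{t_k};\mathcal L_2)$, put $\int_0^T\Psi\,dL=\sum_k J_{t_k,t_{k+1}}(\Phi_k)$; in general it is the $L^2_P(\Omega;V)$-limit of the integrals of simple processes $\Psi_n$ with $E\int_0^T\|\Psi_n(s)-\Psi(s)\|_{HS}^2ds\to0$. (iv) For $\Psi$ as in (iii) and every sequence of simple processes $\Psi_n$ with $E\int_0^T\|\Psi_n(s)-\Psi(s)\|_{HS}^2ds\to0$, $$\int_0^T\!\int_U\|\Psi_n(s)u\|^2\,\nu(du)\,ds\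 \longrightarrow\ \int_0^T\!\int_U\|\Psi(s)u\|^2\,\nu(du)\,ds\quad\text{in }L^1_P .$$ -/

import Mathlib

open MeasureTheory ProbabilityTheory Filter Topology Set
open scoped NNReal ENNReal InnerProductSpace

noncomputable section

namespace CylindricalLevy

/-! ### Hilbert-Schmidt operators -/

section HilbertSchmidtOperators

variable (U V : Type*) [NormedAddCommGroup U] [InnerProductSpace ℝ U] [CompleteSpace U]
  [NormedAddCommGroup V] [InnerProductSpace ℝ V]

/-- The index set of a fixed orthonormal basis of the Hilbert space `U`. -/
def basisIndex : Set U := (exists_hilbertBasis ℝ U).choose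

/-- A fixed orthonormal basis of the Hilbert space `U`. -/
def stdBasis : HilbertBasis (basisIndex U) ℝ U := (exists_hilbertBasis ℝ U).choose_spec.choose

/-- The bounded operators `φ` with `∑ₖ ‖φ eₖ‖² < ∞`, as a linear subspace of all operators. -/
def hilbertSchmidtSubmodule : Submodule ℝ (U →L[ℝ] V) where
  carrier := {φ | Memℓp (fun k => φ (stdBasis U k)) 2}
  zero_mem' := zero_memℓp (E := fun _ : basisIndex U => V) (p := 2)
  add_mem' := fun h₁ h₂ => Memℓp.add h₁ h₂
  smul_mem' := fun c _ h => Memℓp.const_smul h c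

/-- The space `L₂(U, V)` of Hilbert-Schmidt operators. It is not given the operator norm of
`U →L[ℝ] V` but the Hilbert-Schmidt norm, see `HilbertSchmidt.norm_sq`. -/
def HilbertSchmidt : Type _ := ↥(hilbertSchmidtSubmodule U V)

instance : AddCommGroup (HilbertSchmidt U V) :=
  inferInstanceAs (AddCommGroup ↥(hilbertSchmidtSubmodule U V))

instance : Module ℝ (HilbertSchmidt U V) :=
  inferInstanceAs (Module ℝ ↥(hilbertSchmidtSubmodule U V))

variable {U V}

/-- A Hilbert-Schmidt operator as a bounded operator. -/
def HilbertSchmidt.toCLM (φ : HilbertSchmidt U V) : U →L[ℝ] V := φ.1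

variable (U V)

/-- The injective linear map `φ ↦ (φ eₖ)ₖ` from `L₂(U, V)` to `ℓ²(V)`. -/
def HilbertSchmidt.toLp :
    HilbertSchmidt U V →ₗ[ℝ] lp (fun _ : basisIndex U => V) 2 where
  toFun φ := ⟨fun k => φ.toCLM (stdBasis U k), φ.2⟩
  map_add' _ _ := rfl
  map_smul' _ _ := rfl

theorem HilbertSchmidt.toLp_injective : Function.Injective (HilbertSchmidt.toLp U V) := by
  intro φ ψ h
  have h' : ∀ k, φ.toCLM (stdBasis U k) = ψ.toCLM (stdBasis U k) := fun k =>
    congrFun (congrArg Subtype.val h) k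
  apply Subtype.ext
  refine ContinuousLinearMap.ext_on (s := Set.range (stdBasis U)) ?_ ?_
  · exact Submodule.dense_iff_topologicalClosure_eq_top.2 (stdBasis U).dense_span
  · rintro _ ⟨k, rfl⟩
    exact h' k

instance : NormedAddCommGroup (HilbertSchmidt U V) :=
  NormedAddCommGroup.induced _ _ (HilbertSchmidt.toLp U V) (HilbertSchmidt.toLp_injective U V)

instance : NormedSpace ℝ (HilbertSchmidt U V) :=
  NormedSpace.induced ℝ _ _ (HilbertSchmidt.toLp U V)

variable {U V}

theorem HilbertSchmidt.norm_sq (φ : HilbertSchmidt U V) :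
    ‖φ‖ ^ 2 = ∑' k, ‖φ.toCLM (stdBasis U k)‖ ^ 2 := by
  have h := lp.norm_rpow_eq_tsum (p := 2) (by norm_num) (HilbertSchmidt.toLp U V φ)
  have h' : ‖HilbertSchmidt.toLp U V φ‖ ^ 2 =
      ∑' k, ‖(HilbertSchmidt.toLp U V φ : basisIndex U → V) k‖ ^ 2 := by simpa using h
  exact h'

/-- The squared Hilbert-Schmidt norm `∑ₖ ‖A eₖ‖² ∈ [0, ∞]` of a bounded operator. -/
def hsNormSq (A : U →L[ℝ] V) : ℝ≥0∞ := ∑' k, ‖A (stdBasis U k)‖ₑ ^ 2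

end HilbertSchmidtOperators

/-! ### Cylindrical measures -/

section CylindricalMeasures

variable {U : Type*} [NormedAddCommGroup U] [InnerProductSpace ℝ U]

/-- The σ-algebra of the cylindrical sets `{a | (⟪a, u₁⟫, …, ⟪a, uₙ⟫) ∈ B}` with `u₁, …, uₙ` in
the finite set `Γ` and `B` Borel. -/
@[reducible]
def cylSigma (Γ : Finset U) : MeasurableSpace U :=
  ⨆ u ∈ Γ, MeasurableSpace.comap (fun a : U => ⟪a, u⟫_ℝ) (inferInstance : MeasurableSpace ℝ)

variable (U) in
/-- A cylindrical measure on `U`: a `[0, ∞]`-valued function of the cylindrical sets whose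
restriction to the σ-algebra of each finite set `Γ` is a measure. (The values of `toFun` on sets
that are not cylindrical carry no information and are never used.) -/
structure CylindricalMeasure where
  toFun : Set U → ℝ≥0∞
  exists_restriction : ∀ Γ : Finset U, ∃ m : @Measure U (cylSigma Γ),
    ∀ A, MeasurableSet[cylSigma Γ] A → m A = toFun A

/-- The measure that `ν` induces on the σ-algebra of the finite set `Γ`. -/
def CylindricalMeasure.restriction (ν : CylindricalMeasure U) (Γ : Finset U) :
    @Measure U (cylSigma Γ) :=
  (ν.exists_restriction Γ).choose

/-- The image measure of `ν` on `ℝ` under `a ↦ ⟪a, u⟫`. -/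
def CylindricalMeasure.proj (ν : CylindricalMeasure U) (u : U) : Measure ℝ :=
  @Measure.map U ℝ (cylSigma {u}) _ (fun a => ⟪a, u⟫_ℝ) (ν.restriction {u})

variable [CompleteSpace U]
  {V : Type*} [NormedAddCommGroup V] [InnerProductSpace ℝ V] [MeasurableSpace V]

/-- `m` is the extension of the image cylindrical measure of `ν` under `φ` to a Borel measure on
`V`. As always for Lévy measures, this refers to `V ∖ {0}`: the two agree on all cylindrical sets
that do not contain the origin, and `m` has no mass at the origin. -/
structure IsRadonification (ν : CylindricalMeasure U) (φ : HilbertSchmidt U V) (m : Measure V) :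
    Prop where
  zero : m {0} = 0
  eq_on_cylinders : ∀ (Γ : Finset V) (A : Set V), MeasurableSet[cylSigma Γ] A → (0 : V) ∉ A →
    m A = ν.toFun (φ.toCLM ⁻¹' A)

open Classical in
/-- The Borel extension of the image of `ν` under `φ` (`0` if there is none). -/
def radonification (ν : CylindricalMeasure U) (φ : HilbertSchmidt U V) : Measure V :=
  if h : ∃ m : Measure V, IsRadonification ν φ m then h.choose else 0

/-- The integral `∫_U ‖φ u‖² ν(du)`, defined by radonification as `∫_V ‖v‖² (ν ∘ φ⁻¹)(dv)`. -/
def cylIntegral (ν : CylindricalMeasure U) (φ : HilbertSchmidt U V) : ℝ≥0∞ :=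
  ∫⁻ v, ‖v‖ₑ ^ 2 ∂(radonification ν φ)

end CylindricalMeasures

/-! ### Cylindrical Lévy processes -/

section CylindricalProcesses

variable {Ω : Type*} [mΩ : MeasurableSpace Ω] {P : Measure Ω}
  {U : Type*} [NormedAddCommGroup U] [InnerProductSpace ℝ U]

/-- A Lévy process: it starts at `0` almost surely, has independent and stationary increments
and is stochastically continuous. -/
structure IsLevyProcess {E : Type*} [SeminormedAddCommGroup E] [MeasurableSpace E]
    (X : ℝ≥0 → Ω → E) (P : Measure Ω) : Prop where
  zero : ∀ᵐ ω ∂P, X 0 ω = 0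
  indep : HasIndepIncrements X P
  stationary : ∀ s t, s ≤ t → IdentDistrib (X t - X s) (X (t - s)) P P
  continuous : ∀ t, TendstoInMeasure P X (𝓝 t) (X t)

/-- A cylindrical Lévy process in `U`: each `L t` is a linear map from `U` to (classes of) real
random variables, continuous for convergence in probability, and
`((L t u₁, …, L t uₙ) : t ≥ 0)` is a Lévy process in `ℝⁿ` for all `u₁, …, uₙ`. -/
structure IsCylindricalLevy (L : ℝ≥0 → U →ₗ[ℝ] (Ω →ₘ[P] ℝ)) : Prop where
  continuous : ∀ (t : ℝ≥0) (u : ℕ → U) (u₀ : U), Tendsto u atTop (𝓝 u₀) →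
    TendstoInMeasure P (fun n => (L t (u n) : Ω → ℝ)) atTop (L t u₀)
  levy : ∀ (n : ℕ) (u : Fin n → U),
    IsLevyProcess (fun (t : ℝ≥0) (ω : Ω) (i : Fin n) => L t (u i) ω) P

/-- The filtration `ℱ t = σ(L s u : u ∈ U, s ≤ t)`. Since `L s u` is a class of random variables
modulo null sets, all its versions are made measurable. -/
def cylFiltration (L : ℝ≥0 → U →ₗ[ℝ] (Ω →ₘ[P] ℝ)) : Filtration ℝ≥0 mΩ where
  seq t := MeasurableSpace.generateFrom {A | MeasurableSet A ∧ ∃ s ≤ t, ∃ (u : U) (B : Set ℝ),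
    MeasurableSet B ∧ A =ᵐ[P] (L s u : Ω → ℝ) ⁻¹' B}
  mono' := by
    rintro s t hst
    refine MeasurableSpace.generateFrom_mono ?_
    rintro A ⟨hA, r, hr, h⟩
    exact ⟨hA, r, hr.trans hst, h⟩
  le' t := MeasurableSpace.generateFrom_le fun _ hA => hA.1

/-- `(p, q, ν)` are the cylindrical characteristics of `L`: `p` is continuous, the image of `ν`
under each `⟪·, u⟫` is, off the origin, a Lévy measure on `ℝ`, and the characteristic function of
`L t` has the Lévy-Khintchine form (at the multiples of `u` this says that the image of `ν` is the
Lévy measure of `L · u`). -/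
structure IsCharacteristics (L : ℝ≥0 → U →ₗ[ℝ] (Ω →ₘ[P] ℝ)) (p : U → ℝ) (q : QuadraticForm ℝ U)
    (ν : CylindricalMeasure U) : Prop where
  continuous : Continuous p
  levy : ∀ u, ∫⁻ x, ENNReal.ofReal (min 1 (x ^ 2)) ∂(ν.proj u) < ∞
  charFun : ∀ (t : ℝ≥0) (u : U),
    ∫ ω, Complex.exp (Complex.I * (L t u ω : ℝ)) ∂P =
      Complex.exp ((t : ℝ) * (Complex.I * (p u : ℝ) - (1 / 2 : ℂ) * (q u : ℝ) +
        ∫ x : ℝ, (Complex.exp (Complex.I * x) - 1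
          - Complex.I * x * (Set.Icc (-1 : ℝ) 1).indicator (fun _ => (1 : ℂ)) x) ∂(ν.proj u)))

end CylindricalProcesses

/-! ### The stochastic integral -/

section StochasticIntegral

variable {Ω : Type*} [mΩ : MeasurableSpace Ω] {P : Measure Ω}
  {U : Type*} [NormedAddCommGroup U] [InnerProductSpace ℝ U] [CompleteSpace U]
  {V : Type*} [NormedAddCommGroup V] [InnerProductSpace ℝ V] [CompleteSpace V]

/-- `X` is the random variable `X_φ` in `L²_P(Ω; V)` with `⟪X_φ, v⟫ = Y(φ* v)` for all `v`. -/
def IsRadonified (Y : U →ₗ[ℝ] (Ω →ₘ[P] ℝ)) (φ : HilbertSchmidt U V) (X : Lp V 2 P) : Prop :=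
  ∀ v : V, (fun ω => ⟪X ω, v⟫_ℝ) =ᵐ[P] Y (ContinuousLinearMap.adjoint φ.toCLM v)

/-- For a simple random operator `Φ = ∑ᵢ 1_{Aᵢ} φᵢ`, `X` is `J(Φ) = ∑ᵢ 1_{Aᵢ} X_{φᵢ}`. -/
def IsSimpleIncrement (Y : U →ₗ[ℝ] (Ω →ₘ[P] ℝ)) (Φ : Ω → HilbertSchmidt U V) (X : Lp V 2 P) :
    Prop :=
  ∃ x : HilbertSchmidt U V → Lp V 2 P, (∀ φ ∈ Set.range Φ, IsRadonified Y φ (x φ)) ∧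
    ∀ᵐ ω ∂P, X ω = x (Φ ω) ω

/-- `X` is `J(Φ)` for a square integrable `ℱ s`-measurable random operator `Φ`, where `J` is
extended by continuity from the `ℱ s`-measurable simple ones. -/
def IsIncrement (ℱ : Filtration ℝ≥0 mΩ) (s : ℝ≥0) (Y : U →ₗ[ℝ] (Ω →ₘ[P] ℝ))
    (Φ : Ω → HilbertSchmidt U V) (X : Lp V 2 P) : Prop :=
  ∃ (Φ' : ℕ → Ω → HilbertSchmidt U V) (X' : ℕ → Lp V 2 P),
    (∀ n, (Set.range (Φ' n)).Finite ∧ StronglyMeasurable[ℱ s] (Φ' n) ∧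
      IsSimpleIncrement Y (Φ' n) (X' n)) ∧
    Tendsto (fun n => eLpNorm (Φ' n - Φ) 2 P) atTop (𝓝 0) ∧
    Tendsto X' atTop (𝓝 X)

/-- A simple process `∑ₖ Φₖ 1_{(tₖ, tₖ₊₁]}` on `[0, T]` with `0 = t₀ < ⋯ < t_N = T` and with
`Φₖ` square integrable and `ℱ (tₖ)`-measurable. -/
structure SimpleProcess (ℱ : Filtration ℝ≥0 mΩ) (P : Measure Ω) (T : ℝ≥0)
    (H : Type*) [NormedAddCommGroup H] where
  N : ℕ
  time : Fin (N + 1) → ℝ≥0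
  strictMono_time : StrictMono time
  time_zero : time 0 = 0
  time_last : time (Fin.last N) = T
  Φ : Fin N → Ω → H
  measurable_Φ : ∀ k, StronglyMeasurable[ℱ (time k.castSucc)] (Φ k)
  memLp_Φ : ∀ k, MemLp (Φ k) 2 P

/-- The value of a simple process at the time `s`. -/
def SimpleProcess.eval {ℱ : Filtration ℝ≥0 mΩ} {T : ℝ≥0} {H : Type*} [NormedAddCommGroup H]
    (S : SimpleProcess ℱ P T H) (s : ℝ≥0) (ω : Ω) : H :=
  ∑ k, (Set.Ioc (S.time k.castSucc) (S.time k.succ)).indicator (fun _ => S.Φ k ω) s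

/-- Lebesgue measure on the time interval `[0, T]`. -/
def timeMeasure (T : ℝ≥0) : Measure ℝ≥0 :=
  (volume.restrict (Set.Icc (0 : ℝ) T)).map Real.toNNReal

/-- The squared norm `E ∫₀ᵀ ‖Ψ(s)‖² ds`. -/
def processNormSq {H : Type*} [NormedAddCommGroup H] (P : Measure Ω) (T : ℝ≥0)
    (Ψ : ℝ≥0 → Ω → H) : ℝ≥0∞ :=
  ∫⁻ ω, ∫⁻ s, ‖Ψ s ω‖ₑ ^ 2 ∂(timeMeasure T) ∂P

/-- `X` is the stochastic integral `∑ₖ J(Φₖ)` of the simple process `S`, where `J` belongs to the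
increment `L (tₖ₊₁) - L (tₖ)`. -/
def IsSimpleIntegral (L : ℝ≥0 → U →ₗ[ℝ] (Ω →ₘ[P] ℝ)) {T : ℝ≥0}
    (S : SimpleProcess (cylFiltration L) P T (HilbertSchmidt U V)) (X : Lp V 2 P) : Prop :=
  ∃ x : Fin S.N → Lp V 2 P,
    (∀ k, IsIncrement (cylFiltration L) (S.time k.castSucc)
      (L (S.time k.succ) - L (S.time k.castSucc)) (S.Φ k) (x k)) ∧
    X = ∑ k, x k

/-- `X` is the stochastic integral `∫₀ᵀ Ψ dL`, the extension by continuity of the integral of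
simple processes. -/
def IsStochasticIntegral (L : ℝ≥0 → U →ₗ[ℝ] (Ω →ₘ[P] ℝ)) (T : ℝ≥0)
    (Ψ : ℝ≥0 → Ω → HilbertSchmidt U V) (X : Lp V 2 P) : Prop :=
  ∃ (S : ℕ → SimpleProcess (cylFiltration L) P T (HilbertSchmidt U V)) (X' : ℕ → Lp V 2 P),
    (∀ n, IsSimpleIntegral L (S n) (X' n)) ∧
    Tendsto (fun n => processNormSq P T (fun s ω => (S n).eval s ω - Ψ s ω)) atTop (𝓝 0) ∧
    Tendsto X' atTop (𝓝 X)

end StochasticIntegral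

end CylindricalLevy

end

open CylindricalLevy

/-!
# The isometry for stochastic integrals with respect to a cylindrical Lévy process

*Second moments.* On each line `ℝ u`, the characteristic function of `L t u` is known in modulus:
`|E exp (i x L t u)|² = exp (-t (x² q u + ∫ 2 (1 - cos (x y)) dν_u))`. Comparing its behaviour at
`x = 0` with the second moment of `L t u` gives `E |L t u|² = t (q u + ∫ ⟪a, u⟫² ν(da))`
(`IsCharacteristics.integral_sq`), where Fatou's lemma shows that the last integral is finite; the
behaviour at infinity gives `0 ≤ q`. So `q` comes from a positive operator, whose square root is
given by the binomial series (`exists_isPositive_sqrt`).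

*Radonification.* `u ↦ L 1 u` is a bounded operator from `U` to `L²(P)` by the closed graph theorem,
so the second moments of `ν` are bounded by a multiple of `‖u‖²` and are summable along `φ* e₁`,
`φ* e₂`, … for a Hilbert-Schmidt operator `φ`. Since `ν ∘ φ⁻¹` may be infinite, it is weighted by
`min 1 ⟪·, v⟫²`. The weighted cylindrical measure is finite; by Kolmogorov's theorem
(`exists_isProjectiveLimit`) it lives on sequences of coordinates, and it is carried by the square
summable ones because of the second moments. Dividing the sum of these extensions, `v` running
through a basis, by the total weight yields the extension of `ν ∘ φ⁻¹` (`exists_isRadonification`),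
and the same weights yield uniqueness. By Parseval's identity,
`∫ ‖φ u‖² ν(du) = ∑ₖ ∫ ⟪a, φ* eₖ⟫² ν(da)`.

*The isometry.* Let `D φ = X_φ` be the radonification of `L 1`, a bounded operator from the
Hilbert-Schmidt operators to `L²(P; V)` with `‖D φ‖² = ‖Q^(1/2) φ*‖² + ∫ ‖φ u‖² ν(du)`
(`IsCharacteristics.enorm_radonify_levyL2_sq`). Increments of `L` are orthogonal to the past by the
martingale property, and their squares are independent of the past, so the integrals of elementary
processes `1_{(s,t]} 1_A φ` have the same inner products as the functions `1_{(s,t]} 1_A D φ`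
(`IsCharacteristics.inner_levyIncrement`). The closed linear relation generated by the elementary
processes and their integrals (`integralGraph`) contains every stochastic integral, so the
isometry, uniqueness and, by completeness, existence all follow from the identity
`‖x.1‖ = ‖D x.2‖` on this relation (`IsCharacteristics.norm_eq_of_mem_integralGraph`), once simple
processes are known to be dense (`exists_simpleProcess_tendsto`).

*The jump term.* `∫ ‖φ u‖² ν(du)` is the difference of two bounded quadratic functions of `φ`.
Hence it has a quadratic modulus of continuity, and the Cauchy-Schwarz inequality turns convergence
of the integrands in `L²` into convergence in `L¹` (`tendsto_eLpNorm_lintegral_sub`).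
-/

namespace CylindricalLevy

/-! ### Positive operators on real Hilbert spaces -/

section Operators

/-- The coefficients of the power series `1 - √(1 - x) = ∑ₙ cₙ xⁿ⁺¹`. -/
noncomputable def sqrtCoeff (n : ℕ) : ℝ := catalan n / (2 * 4 ^ n)

theorem sqrtCoeff_nonneg (n : ℕ) : 0 ≤ sqrtCoeff n := by unfold sqrtCoeff; positivity

/-- The partial sums telescope. -/
theorem sum_range_sqrtCoeff (N : ℕ) :
    ∑ n ∈ Finset.range N, sqrtCoeff n = 1 - (N.centralBinom : ℝ) / 4 ^ N := by
  induction N with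
  | zero => simp
  | succ N ih =>
    rw [Finset.sum_range_succ, ih, sqrtCoeff]
    have h1 : ((N : ℝ) + 1) * catalan N = N.centralBinom := by
      exact_mod_cast succ_mul_catalan_eq_centralBinom N
    have h2 : ((N : ℝ) + 1) * (N + 1).centralBinom = 2 * (2 * N + 1) * N.centralBinom := by
      exact_mod_cast Nat.succ_mul_centralBinom_succ N
    have h3 : ((N + 1).centralBinom : ℝ) = 2 * (2 * N + 1) * catalan N := by
      rw [← h1] at h2
      have : (N : ℝ) + 1 ≠ 0 := by positivity
      apply mul_left_cancel₀ this
      rw [h2]; ring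
    rw [h3, ← h1, pow_succ]
    field_simp
    ring

theorem summable_sqrtCoeff : Summable sqrtCoeff := by
  refine summable_of_sum_range_le (c := 1) sqrtCoeff_nonneg fun N => ?_
  rw [sum_range_sqrtCoeff]
  have : (0 : ℝ) ≤ (N.centralBinom : ℝ) / 4 ^ N := by positivity
  linarith

theorem tsum_sqrtCoeff_le : ∑' n, sqrtCoeff n ≤ 1 := by
  refine Real.tsum_le_of_sum_range_le sqrtCoeff_nonneg fun N => ?_
  rw [sum_range_sqrtCoeff]
  have : (0 : ℝ) ≤ (N.centralBinom : ℝ) / 4 ^ N := by positivity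
  linarith

/-- The recursion of the Catalan numbers: with `F = ∑ₙ cₙ xⁿ⁺¹` it says that `F² = 2 F - x`. -/
theorem sum_antidiagonal_sqrtCoeff (n : ℕ) :
    ∑ kl ∈ Finset.HasAntidiagonal.antidiagonal n, sqrtCoeff kl.1 * sqrtCoeff kl.2 =
      2 * sqrtCoeff (n + 1) := by
  have h : ∀ kl ∈ Finset.HasAntidiagonal.antidiagonal n, sqrtCoeff kl.1 * sqrtCoeff kl.2 =
      (catalan kl.1 * catalan kl.2 : ℕ) / (4 * 4 ^ n : ℝ) := by
    intro kl hkl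
    rw [Finset.HasAntidiagonal.mem_antidiagonal] at hkl
    rw [sqrtCoeff, sqrtCoeff, ← hkl, pow_add]
    push_cast
    field_simp
    ring
  rw [Finset.sum_congr rfl h, ← Finset.sum_div, sqrtCoeff, catalan_succ', pow_succ]
  push_cast
  field_simp

variable {U : Type*} [NormedAddCommGroup U] [InnerProductSpace ℝ U]

theorem norm_pow_succ_le_one {x : U →L[ℝ] U} (hx : ‖x‖ ≤ 1) (n : ℕ) : ‖x ^ (n + 1)‖ ≤ 1 :=
  (norm_pow_le' x n.succ_pos).trans (pow_le_one₀ (norm_nonneg _) hx)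

theorem norm_sqrtCoeff_smul_pow_le {x : U →L[ℝ] U} (hx : ‖x‖ ≤ 1) (n : ℕ) :
    ‖sqrtCoeff n • x ^ (n + 1)‖ ≤ sqrtCoeff n := by
  rw [norm_smul, Real.norm_of_nonneg (sqrtCoeff_nonneg n)]
  exact mul_le_of_le_one_right (sqrtCoeff_nonneg n) (norm_pow_succ_le_one hx n)

variable [CompleteSpace U]

/-- The square root of `1 - x` for a self-adjoint contraction `x`, by the binomial series. -/
theorem exists_isPositive_sq_eq_one_sub {x : U →L[ℝ] U} (hx : ‖x‖ ≤ 1) (hsa : IsSelfAdjoint x) :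
    ∃ S : U →L[ℝ] U, S.IsPositive ∧ S * S = 1 - x := by
  set a : ℕ → U →L[ℝ] U := fun n => sqrtCoeff n • x ^ (n + 1) with ha
  have hsn : Summable fun n => ‖a n‖ :=
    Summable.of_nonneg_of_le (fun _ => norm_nonneg _) (norm_sqrtCoeff_smul_pow_le hx)
      summable_sqrtCoeff
  have hs : Summable a := hsn.of_norm
  set F := ∑' n, a n with hF
  -- `F` is going to be `1 - √(1 - x)`
  have hFF : F * F = F + F - x := by
    rw [hF, tsum_mul_tsum_eq_tsum_sum_antidiagonal_of_summable_norm hsn hsn]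
    have h : ∀ n, ∑ kl ∈ Finset.HasAntidiagonal.antidiagonal n, a kl.1 * a kl.2 =
        (2 : ℝ) • a (n + 1) := by
      intro n
      have : ∀ kl ∈ Finset.HasAntidiagonal.antidiagonal n, a kl.1 * a kl.2 =
          (sqrtCoeff kl.1 * sqrtCoeff kl.2) • x ^ (n + 2) := by
        intro kl hkl
        rw [Finset.HasAntidiagonal.mem_antidiagonal] at hkl
        simp only [ha, smul_mul_smul_comm, ← pow_add]
        congr 2
        omega
      rw [Finset.sum_congr rfl this, ← Finset.sum_smul, sum_antidiagonal_sqrtCoeff, ha, smul_smul]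
    simp_rw [h]
    have h0 : a 0 = (1 / 2 : ℝ) • x := by simp [ha, sqrtCoeff]
    rw [Summable.tsum_const_smul _ ((summable_nat_add_iff 1).2 hs), hs.tsum_eq_zero_add, h0]
    module
  have hFsa : IsSelfAdjoint F := by
    rw [IsSelfAdjoint, hF]
    have : HasSum a (star F) := by
      have h := hs.hasSum.star
      have : (fun n => star (a n)) = a := by
        funext n
        have h1 : IsSelfAdjoint (a n) := (IsSelfAdjoint.all (sqrtCoeff n)).smul (hsa.pow (n + 1))
        exact h1
      rwa [this] at h
    exact this.unique hs.hasSum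
  have hFn : ‖F‖ ≤ 1 :=
    (tsum_of_norm_bounded summable_sqrtCoeff.hasSum (norm_sqrtCoeff_smul_pow_le hx)).trans
      tsum_sqrtCoeff_le
  refine ⟨1 - F, ?_, ?_⟩
  · rw [ContinuousLinearMap.isPositive_iff']
    refine ⟨(IsSelfAdjoint.one _).sub hFsa, fun u => ?_⟩
    have h1 : ⟪F u, u⟫_ℝ ≤ ‖u‖ * ‖u‖ := by
      refine (real_inner_le_norm _ _).trans ?_
      gcongr
      simpa using F.le_of_opNorm_le hFn u
    simp only [sub_apply, one_apply_eq_self, inner_sub_left,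
      real_inner_self_eq_norm_mul_norm]
    linarith
  · have : (1 - F) * (1 - F) = 1 - F - F + F * F := by noncomm_ring
    rw [this, hFF]
    abel

/-- A positive operator `Q` on a real Hilbert space has a positive square root. The functional
calculus of complex C⋆-algebras does not apply over `ℝ`; instead `Q = ‖Q‖ (1 - x)`, where `x` is
a contraction because its Rayleigh quotients lie in `[0, 1]`. -/
theorem exists_isPositive_sqrt {Q : U →L[ℝ] U} (hQ : Q.IsPositive) :
    ∃ R : U →L[ℝ] U, R.IsPositive ∧ R ∘L R = Q := by
  by_cases hQ0 : Q = 0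
  · exact ⟨0, by simp, by simp [hQ0]⟩
  have hn : 0 < ‖Q‖ := norm_pos_iff.2 hQ0
  set x : U →L[ℝ] U := 1 - ‖Q‖⁻¹ • Q with hx
  have hsa : IsSelfAdjoint x :=
    (IsSelfAdjoint.one _).sub ((IsSelfAdjoint.all _).smul hQ.isSelfAdjoint)
  have hval : ∀ u, ⟪x u, u⟫_ℝ = ‖u‖ ^ 2 - ‖Q‖⁻¹ * ⟪Q u, u⟫_ℝ := by
    intro u
    simp [hx, inner_sub_left, inner_smul_left]
  have hx1 : ‖x‖ ≤ 1 := by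
    rw [x.norm_eq_iSup_rayleighQuotient hsa.isSymmetric]
    refine ciSup_le fun u => ?_
    rw [ContinuousLinearMap.rayleighQuotient, ContinuousLinearMap.reApplyInnerSelf_apply]
    simp only [RCLike.re_to_real, hval]
    have h0 : 0 ≤ ⟪Q u, u⟫_ℝ := hQ.inner_nonneg_left u
    have h1 : ⟪Q u, u⟫_ℝ ≤ ‖Q‖ * ‖u‖ ^ 2 := by
      refine (real_inner_le_norm _ _).trans ?_
      rw [sq, ← mul_assoc]
      gcongr
      exact Q.le_opNorm u
    have h2 : ‖Q‖⁻¹ * ⟪Q u, u⟫_ℝ ≤ ‖u‖ ^ 2 := by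
      rw [inv_mul_le_iff₀ hn]; exact h1
    have h3 : 0 ≤ ‖Q‖⁻¹ * ⟪Q u, u⟫_ℝ := by positivity
    rw [abs_of_nonneg (by apply div_nonneg <;> nlinarith [sq_nonneg ‖u‖])]
    exact div_le_one_of_le₀ (by linarith) (by positivity)
  obtain ⟨S, hS, hSS⟩ := exists_isPositive_sq_eq_one_sub hx1 hsa
  refine ⟨Real.sqrt ‖Q‖ • S, hS.smul_of_nonneg (Real.sqrt_nonneg _), ?_⟩
  change (Real.sqrt ‖Q‖ • S) * (Real.sqrt ‖Q‖ • S) = Q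
  rw [smul_mul_smul_comm, hSS, Real.mul_self_sqrt hn.le, hx, sub_sub_cancel, smul_smul,
    mul_inv_cancel₀ hn.ne', one_smul]

/-- A continuous quadratic form on a normed space is bounded: by homogeneity, a bound on a small
ball suffices. -/
theorem exists_abs_quadraticForm_le {E : Type*} [NormedAddCommGroup E] [NormedSpace ℝ E]
    (q : QuadraticForm ℝ E) (hq : Continuous q) : ∃ C, 0 ≤ C ∧ ∀ u, |q u| ≤ C * ‖u‖ ^ 2 := by
  have h0 : ∀ᶠ u in 𝓝 (0 : E), |q u| < 1 := by
    have : Tendsto (fun u => |q u|) (𝓝 0) (𝓝 |q 0|) := (continuous_abs.comp hq).tendsto 0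
    rw [map_zero, abs_zero] at this
    exact this.eventually_lt_const one_pos
  obtain ⟨δ, hδ, hball⟩ := Metric.eventually_nhds_iff.1 h0
  refine ⟨(2 / δ) ^ 2, by positivity, fun u => ?_⟩
  by_cases hu : u = 0
  · simp [hu]
  have hu' : 0 < ‖u‖ := norm_pos_iff.2 hu
  set c : ℝ := δ / (2 * ‖u‖) with hc
  have hc0 : 0 < c := by positivity
  have h1 : |q (c • u)| < 1 := by
    apply hball
    rw [dist_zero_right, norm_smul, Real.norm_of_nonneg hc0.le, hc]
    field_simp
    linarith
  rw [QuadraticMap.map_smul, smul_eq_mul, abs_mul, abs_of_nonneg (by positivity)] at h1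
  have h2 : |q u| < 1 / (c * c) := by rw [lt_div_iff₀ (by positivity)]; linarith
  refine h2.le.trans (le_of_eq ?_)
  rw [hc]
  field_simp

/-- A nonnegative continuous quadratic form on a Hilbert space comes from a positive operator. -/
theorem exists_isPositive_quadraticForm (q : QuadraticForm ℝ U) (hq : Continuous q)
    (hq0 : ∀ u, 0 ≤ q u) : ∃ Q : U →L[ℝ] U, Q.IsPositive ∧ ∀ u, q u = ⟪Q u, u⟫_ℝ := by
  obtain ⟨C, hC0, hC⟩ := exists_abs_quadraticForm_le q hq
  have hself : ∀ u, q.polarBilin u u = 2 * q u := fun u => by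
    rw [QuadraticMap.polarBilin_apply_apply, QuadraticMap.polar_self]; simp
  -- the Cauchy-Schwarz inequality turns the bound on `q` into one on the bilinear form
  have hcs : ∀ u v, ‖q.polarBilin u v‖ ≤ (2 * C) * ‖u‖ * ‖v‖ := by
    intro u v
    have h := LinearMap.BilinForm.apply_sq_le_of_symm q.polarBilin (fun x => by
      rw [hself]; have := hq0 x; positivity)
      ⟨fun x y => QuadraticMap.polar_comm q x y⟩ u v
    rw [hself, hself] at h
    refine abs_le_of_sq_le_sq (h.trans ?_) (by positivity)
    have h1 := (le_abs_self _).trans (hC u)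
    have h2 := (le_abs_self _).trans (hC v)
    calc 2 * q u * (2 * q v) ≤ 2 * (C * ‖u‖ ^ 2) * (2 * (C * ‖v‖ ^ 2)) := by
          have := hq0 u; have := hq0 v
          gcongr
      _ = _ := by ring
  set B : U →L[ℝ] U →L[ℝ] ℝ := LinearMap.mkContinuous₂ q.polarBilin (2 * C) hcs with hB
  have hBa : ∀ u v, B u v = QuadraticMap.polar q u v := fun u v => rfl
  set Q0 : U →L[ℝ] U := InnerProductSpace.continuousLinearMapOfBilin (𝕜 := ℝ) B
  have hQ0 : ∀ u v, ⟪Q0 u, v⟫_ℝ = QuadraticMap.polar q u v := fun u v => by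
    rw [← hBa]; exact InnerProductSpace.continuousLinearMapOfBilin_apply B u v
  have hval : ∀ u, ⟪((1 / 2 : ℝ) • Q0) u, u⟫_ℝ = q u := fun u => by
    rw [smul_apply, real_inner_smul_left, hQ0, QuadraticMap.polar_self]
    simp
  refine ⟨(1 / 2 : ℝ) • Q0, ?_, fun u => (hval u).symm⟩
  rw [ContinuousLinearMap.isPositive_iff]
  refine ⟨fun u v => ?_, fun u => (hq0 u).trans_eq (hval u).symm⟩
  change ⟪((1 / 2 : ℝ) • Q0) u, v⟫_ℝ = ⟪u, ((1 / 2 : ℝ) • Q0) v⟫_ℝ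
  rw [smul_apply, smul_apply, real_inner_smul_left,
    real_inner_smul_right, hQ0, real_inner_comm, hQ0, QuadraticMap.polar_comm]

theorem countable_of_hilbertBasis {E ι : Type*} [NormedAddCommGroup E] [InnerProductSpace ℝ E]
    [TopologicalSpace.SeparableSpace E] (e : HilbertBasis ι ℝ E) : Countable ι := by
  -- two different basis vectors have distance `√2`
  refine Pairwise.countable_of_isOpen_disjoint (s := fun i => Metric.ball (e i) (1 / 2))
    (fun i j hij => ?_) (fun i => Metric.isOpen_ball)
    (fun i => Metric.nonempty_ball.2 (by norm_num))
  refine Metric.ball_disjoint_ball ?_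
  rw [dist_eq_norm]
  have h : ‖e i - e j‖ ^ 2 = 2 := by
    rw [@norm_sub_sq_real, e.orthonormal.1, e.orthonormal.1, e.orthonormal.2 hij]
    norm_num
  nlinarith [norm_nonneg (e i - e j)]

theorem countable_basisIndex (E : Type*) [NormedAddCommGroup E] [InnerProductSpace ℝ E]
    [CompleteSpace E] [TopologicalSpace.SeparableSpace E] : Countable (basisIndex E) :=
  countable_of_hilbertBasis (stdBasis E)

end Operators

/-! ### Projective limits of finite measures on countable products of lines -/

section Kolmogorov

open scoped BoundedContinuousFunction

variable {ι : Type*}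

open Classical in
/-- A vector indexed by the finite set `I`, extended by zero. -/
noncomputable def extendByZero (I : Finset ι) (x : I → ℝ) (i : ι) : ℝ :=
  if h : i ∈ I then x ⟨i, h⟩ else 0

theorem measurable_extendByZero (I : Finset ι) : Measurable (extendByZero I) := by
  refine measurable_pi_lambda _ fun i => ?_
  by_cases h : i ∈ I
  · simpa [extendByZero, h] using measurable_pi_apply (⟨i, h⟩ : I)
  · simp [extendByZero, h]

theorem restrict_extendByZero {I J : Finset ι} (hIJ : I ⊆ J) (x : J → ℝ) :
    I.restrict (extendByZero J x) = Finset.restrict₂ (π := fun _ : ι => ℝ) hIJ x := by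
  funext i
  simp [extendByZero, Finset.restrict₂, hIJ i.2]

/-- Kolmogorov's extension theorem for finite measures on a countable power of `ℝ`: the extensions
by zero of the given measures are tight, and by Prokhorov's theorem they have a cluster point. -/
theorem exists_isProjectiveLimit [Countable ι] (μ : ∀ I : Finset ι, Measure (I → ℝ))
    [∀ I, IsFiniteMeasure (μ I)] (hμ : IsProjectiveMeasureFamily (α := fun _ : ι => ℝ) μ) :
    ∃ m : Measure (ι → ℝ), IsFiniteMeasure m ∧ IsProjectiveLimit (α := fun _ : ι => ℝ) m μ := by
  classical
  have : Encodable ι := Encodable.ofCountable ι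
  set m : Finset ι → FiniteMeasure (ι → ℝ) := fun I =>
    ⟨(μ I).map (extendByZero I), Measure.isFiniteMeasure_map _ _⟩ with hm
  -- Compact boxes carrying all but an arbitrarily small part of the mass. The sides contain `0`
  -- because the coordinates outside `I` have been set to `0`.
  have hbox : ∀ n : ℕ, ∃ K : Set (ι → ℝ), IsCompact K ∧
      ∀ I, m I Kᶜ ≤ (1 / ((n : ℝ≥0) + 1)) := by
    intro n
    set ε : ℝ := 1 / ((n : ℝ) + 1) with hε
    have hε0 : 0 < ε := by positivity
    obtain ⟨δ, hδ0, c, hδc, hcε⟩ := posSumOfEncodable hε0 ι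
    have hK : ∀ i : ι, ∃ K : Set ℝ, IsCompact K ∧
        ((μ {i}).map (fun x => x ⟨i, by simp⟩)) Kᶜ ≤ ENNReal.ofReal (δ i) := by
      intro i
      have h := isTightMeasureSet_singleton (μ := (μ {i}).map (fun x => x ⟨i, by simp⟩))
      rw [isTightMeasureSet_iff_exists_isCompact_measure_compl_le] at h
      obtain ⟨K, hK, hKm⟩ := h (ENNReal.ofReal (δ i)) (by simpa using hδ0 i)
      exact ⟨K, hK, hKm _ rfl⟩
    choose K hK hKm using hK
    refine ⟨Set.univ.pi fun i => K i ∪ {0},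
      isCompact_univ_pi fun i => (hK i).union isCompact_singleton, fun I => ?_⟩
    have hKmeas : ∀ i, MeasurableSet (K i) := fun i => (hK i).measurableSet
    rw [← ENNReal.coe_le_coe, FiniteMeasure.ennreal_coeFn_eq_coeFn_toMeasure]
    change (μ I).map (extendByZero I) _ ≤ _
    rw [Measure.map_apply (measurable_extendByZero I)
      (MeasurableSet.univ_pi fun i => (hKmeas i).union (measurableSet_singleton 0)).compl]
    have hsub : extendByZero I ⁻¹' (Set.univ.pi fun i => K i ∪ {0})ᶜ ⊆
        ⋃ i : I, (fun x : I → ℝ => x i) ⁻¹' (K i)ᶜ := by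
      intro x hx
      simp only [mem_preimage, mem_compl_iff, Set.mem_pi, mem_univ, true_imp_iff, not_forall] at hx
      obtain ⟨i, hi⟩ := hx
      by_cases h : i ∈ I
      · refine mem_iUnion.2 ⟨⟨i, h⟩, fun hxi => hi (Or.inl ?_)⟩
        simpa [extendByZero, h] using hxi
      · exact absurd (Or.inr (by simp [extendByZero, h])) hi
    have hmarg : ∀ i : I, μ I ((fun x : I → ℝ => x i) ⁻¹' (K i)ᶜ) ≤ ENNReal.ofReal (δ i) := by
      intro i
      refine le_trans (le_of_eq ?_) (hKm i)
      have hsub' : ({i.1} : Finset ι) ⊆ I := by simp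
      rw [hμ I {i.1} hsub', Measure.map_map (measurable_pi_apply _)
        (Finset.measurable_restrict₂ (X := fun _ : ι => ℝ) _), Measure.map_apply
        ((measurable_pi_apply _).comp (Finset.measurable_restrict₂ (X := fun _ : ι => ℝ) _))
          (hKmeas i).compl]
      rfl
    calc μ I (extendByZero I ⁻¹' (Set.univ.pi fun i => K i ∪ {0})ᶜ)
        ≤ ∑ i : I, μ I ((fun x : I → ℝ => x i) ⁻¹' (K i)ᶜ) :=
          (measure_mono hsub).trans (measure_iUnion_fintype_le _ _)
      _ ≤ ∑ i : I, ENNReal.ofReal (δ i) := Finset.sum_le_sum fun i _ => hmarg i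
      _ = ENNReal.ofReal (∑ i ∈ I, δ i) := by
          rw [ENNReal.ofReal_sum_of_nonneg fun i _ => (hδ0 i).le]
          exact Finset.sum_coe_sort I fun i => ENNReal.ofReal (δ i)
      _ ≤ ENNReal.ofReal ε := ENNReal.ofReal_le_ofReal
          ((sum_le_hasSum I (fun i _ => (hδ0 i).le) hδc).trans hcε)
      _ = _ := by
          rw [hε, ENNReal.ofReal, Real.toNNReal_div (by positivity), Real.toNNReal_one,
            Real.toNNReal_add (by positivity) zero_le_one, Real.toNNReal_one,
            Real.toNNReal_natCast]
  choose K hK hKm using hbox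
  have hmass : ∀ I, (m I).mass = (m ∅).mass := by
    intro I
    rw [← ENNReal.coe_inj, FiniteMeasure.ennreal_mass, FiniteMeasure.ennreal_mass]
    change (μ I).map (extendByZero I) univ = (μ ∅).map (extendByZero ∅) univ
    rw [Measure.map_apply (measurable_extendByZero I) .univ,
      Measure.map_apply (measurable_extendByZero ∅) .univ]
    exact hμ.measure_univ_eq I ∅
  have hcomp := isCompact_setOfPred_finiteMeasure_mass_eq_compl_isCompact_le (m ∅).mass
    (tendsto_one_div_add_atTop_nhds_zero_nat (𝕜 := ℝ≥0)) hK (Or.inl inferInstance)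
  -- any cluster point is the limit along an ultrafilter
  set 𝒰 : Ultrafilter (Finset ι) := Ultrafilter.of atTop
  obtain ⟨m', -, hm'⟩ := hcomp.ultrafilter_le_nhds' (𝒰.map m)
    (Filter.mem_map.2 (Filter.univ_mem' fun I => ⟨hmass I, fun n => hKm n I⟩))
  have ht : Tendsto m 𝒰 (𝓝 m') := hm'
  rw [FiniteMeasure.tendsto_iff_forall_integral_tendsto] at ht
  refine ⟨m', inferInstance, fun I => ?_⟩
  have hres : Continuous (I.restrict (π := fun _ : ι => ℝ) : (ι → ℝ) → (I → ℝ)) :=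
    continuous_pi fun i => continuous_apply i.1
  have : IsFiniteMeasure ((m' : Measure (ι → ℝ)).map I.restrict) :=
    Measure.isFiniteMeasure_map _ _
  refine ext_of_forall_integral_eq_of_IsFiniteMeasure fun f => ?_
  rw [integral_map hres.measurable.aemeasurable f.continuous.aestronglyMeasurable]
  refine tendsto_nhds_unique (ht (f.compContinuous ⟨_, hres⟩)) (tendsto_const_nhds.congr' ?_)
  -- as soon as `I ⊆ J`, the image of `m J` on `I → ℝ` is `μ I` itself
  have hev : ∀ᶠ J in (𝒰 : Filter (Finset ι)), I ⊆ J :=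
    Ultrafilter.of_le atTop (eventually_ge_atTop I)
  filter_upwards [hev] with J hJ
  change _ = ∫ x, f (I.restrict x) ∂((μ J).map (extendByZero J))
  rw [integral_map (f := fun x : ι → ℝ => f (I.restrict x)) (measurable_extendByZero J).aemeasurable
    (f.continuous.comp hres).aestronglyMeasurable, hμ J I hJ,
    integral_map (Finset.measurable_restrict₂ (X := fun _ : ι => ℝ) _).aemeasurable
      f.continuous.aestronglyMeasurable]
  simp_rw [restrict_extendByZero hJ]

end Kolmogorov

/-! ### Finite-dimensional images of a cylindrical measure -/

section Law

variable {U : Type*} [NormedAddCommGroup U] [InnerProductSpace ℝ U]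
  {κ κ' : Type*}

/-- The vector `(⟪a, u₁⟫, …, ⟪a, uₙ⟫)`. -/
def coords (u : κ → U) (a : U) (i : κ) : ℝ := ⟪a, u i⟫_ℝ

theorem continuous_coords (u : κ → U) : Continuous (coords u) :=
  continuous_pi fun _ => continuous_id.inner continuous_const

theorem coords_zero (u : κ → U) : coords u 0 = 0 := funext fun _ => inner_zero_left _

theorem measurable_comp_some : Measurable fun (x : Option κ → ℝ) (i : κ) => x (some i) :=
  measurable_pi_lambda _ fun i => measurable_pi_apply (some i)

variable [Fintype κ] [Fintype κ']

open Classical in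
theorem measurable_coords_cylSigma (u : κ → U) :
    @Measurable U (κ → ℝ) (cylSigma (Finset.univ.image u)) _ (coords u) := by
  refine @measurable_pi_lambda _ _ _ (cylSigma (Finset.univ.image u)) _ _ fun i => ?_
  rw [measurable_iff_comap_le]
  exact le_iSup₂ (f := fun v (_ : v ∈ Finset.univ.image u) =>
    MeasurableSpace.comap (fun a : U => ⟪a, v⟫_ℝ) (inferInstance : MeasurableSpace ℝ)) (u i)
    (Finset.mem_image_of_mem u (Finset.mem_univ i))

theorem exists_coords_preimage_eq {Γ : Finset U} {A : Set U} (hA : MeasurableSet[cylSigma Γ] A) :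
    ∃ S : Set (Γ → ℝ), MeasurableSet S ∧ coords (fun i : Γ => (i : U)) ⁻¹' S = A := by
  have h : cylSigma Γ = MeasurableSpace.comap (coords fun i : Γ => (i : U)) MeasurableSpace.pi := by
    rw [cylSigma, MeasurableSpace.pi, MeasurableSpace.comap_iSup, iSup_subtype]
    simp_rw [MeasurableSpace.comap_comp]
    rfl
  rw [h] at hA
  exact hA

theorem CylindricalMeasure.restriction_apply (ν : CylindricalMeasure U) {Γ : Finset U} {A : Set U}
    (hA : MeasurableSet[cylSigma Γ] A) : ν.restriction Γ A = ν.toFun A :=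
  (ν.exists_restriction Γ).choose_spec A hA

open Classical in
/-- The image of the cylindrical measure `ν` under `a ↦ (⟪a, u₁⟫, …, ⟪a, uₙ⟫)`. -/
noncomputable def CylindricalMeasure.law (ν : CylindricalMeasure U) (u : κ → U) :
    Measure (κ → ℝ) :=
  @Measure.map U (κ → ℝ) (cylSigma (Finset.univ.image u)) _ (coords u)
    (ν.restriction (Finset.univ.image u))

theorem CylindricalMeasure.law_apply (ν : CylindricalMeasure U) (u : κ → U) {S : Set (κ → ℝ)}
    (hS : MeasurableSet S) : ν.law u S = ν.toFun (coords u ⁻¹' S) := by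
  classical
  rw [CylindricalMeasure.law, @Measure.map_apply _ _ (cylSigma (Finset.univ.image u)) _ _ _
    (measurable_coords_cylSigma u) _ hS]
  exact ν.restriction_apply (measurable_coords_cylSigma u hS)

theorem CylindricalMeasure.proj_apply (ν : CylindricalMeasure U) (u : U) {S : Set ℝ}
    (hS : MeasurableSet S) : ν.proj u S = ν.toFun ((fun a => ⟪a, u⟫_ℝ) ⁻¹' S) := by
  have hm : @Measurable U ℝ (cylSigma {u}) _ (fun a => ⟪a, u⟫_ℝ) := by
    rw [measurable_iff_comap_le]
    exact le_iSup₂ (f := fun v (_ : v ∈ ({u} : Finset U)) =>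
      MeasurableSpace.comap (fun a : U => ⟪a, v⟫_ℝ) (inferInstance : MeasurableSpace ℝ)) u
      (Finset.mem_singleton_self u)
  rw [CylindricalMeasure.proj, @Measure.map_apply _ _ (cylSigma {u}) _ _ _ hm _ hS]
  exact ν.restriction_apply (hm hS)

theorem CylindricalMeasure.map_law_congr {E : Type*} [MeasurableSpace E]
    (ν : CylindricalMeasure U) {u : κ → U} {u' : κ' → U} {F : (κ → ℝ) → E} {F' : (κ' → ℝ) → E}
    (hF : Measurable F) (hF' : Measurable F') (h : ∀ a, F (coords u a) = F' (coords u' a)) :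
    (ν.law u).map F = (ν.law u').map F' := by
  ext S hS
  rw [Measure.map_apply hF hS, Measure.map_apply hF' hS, ν.law_apply u (hF hS),
    ν.law_apply u' (hF' hS)]
  congr 1
  ext a
  simp [h]

/-- The finite-dimensional images are consistent: an integral depends only on the integrand as a
function on `U`. -/
theorem CylindricalMeasure.lintegral_law_congr (ν : CylindricalMeasure U) {u : κ → U}
    {u' : κ' → U} {F : (κ → ℝ) → ℝ≥0∞} {F' : (κ' → ℝ) → ℝ≥0∞} (hF : Measurable F)
    (hF' : Measurable F') (h : ∀ a, F (coords u a) = F' (coords u' a)) :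
    ∫⁻ x, F x ∂(ν.law u) = ∫⁻ x, F' x ∂(ν.law u') := by
  have := ν.map_law_congr hF hF' h
  rw [← lintegral_map (f := fun y => y) measurable_id hF, this,
    lintegral_map (f := fun y => y) measurable_id hF']

theorem CylindricalMeasure.map_proj_eq (ν : CylindricalMeasure U) (u : κ → U) (i : κ) :
    (ν.law u).map (fun x => x i) = ν.proj (u i) := by
  ext S hS
  rw [Measure.map_apply (measurable_pi_apply i) hS, ν.law_apply u (measurable_pi_apply i hS),
    ν.proj_apply _ hS]
  rfl

theorem CylindricalMeasure.proj_smul (ν : CylindricalMeasure U) (c : ℝ) (u : U) :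
    ν.proj (c • u) = (ν.proj u).map (fun x => c * x) := by
  ext S hS
  have hc : Measurable fun x : ℝ => c * x := measurable_const_mul c
  rw [Measure.map_apply hc hS, ν.proj_apply _ hS, ν.proj_apply _ (hc hS)]
  simp_rw [real_inner_smul_right]
  rfl

/-- The second moment `∫ ⟪a, u⟫² ν(da)`. -/
noncomputable def CylindricalMeasure.secondMoment (ν : CylindricalMeasure U) (u : U) : ℝ≥0∞ :=
  ∫⁻ x, ‖x‖ₑ ^ 2 ∂(ν.proj u)

theorem CylindricalMeasure.lintegral_law_sq (ν : CylindricalMeasure U) (u : κ → U) (i : κ) :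
    ∫⁻ x, ‖x i‖ₑ ^ 2 ∂(ν.law u) = ν.secondMoment (u i) := by
  rw [CylindricalMeasure.secondMoment, ← ν.map_proj_eq u i,
    lintegral_map (by fun_prop) (measurable_pi_apply i)]

/-- The weight `min 1 x²`, which makes Lévy measures finite and only vanishes at the origin. -/
noncomputable def weight (x : ℝ) : ℝ≥0∞ := min 1 (‖x‖ₑ ^ 2)

theorem measurable_weight : Measurable weight := by unfold weight; fun_prop

theorem weight_zero : weight 0 = 0 := by simp [weight]

theorem weight_ne_zero {x : ℝ} (hx : x ≠ 0) : weight x ≠ 0 := by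
  simp [weight, hx]

theorem weight_le_one (x : ℝ) : weight x ≤ 1 := min_le_left _ _

theorem weight_ne_top (x : ℝ) : weight x ≠ ∞ :=
  ne_top_of_le_ne_top ENNReal.one_ne_top (weight_le_one x)

theorem weight_le_sq (x : ℝ) : weight x ≤ ‖x‖ₑ ^ 2 := min_le_right _ _

/-- The finite measure with density `min 1 ⟪a, w⟫²` with respect to the image of `ν` under
`a ↦ (⟪a, u₁⟫, …, ⟪a, uₙ⟫)`. -/
noncomputable def CylindricalMeasure.weightedLaw (ν : CylindricalMeasure U) (w : U) (u : κ → U) :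
    Measure (κ → ℝ) :=
  ((ν.law fun o : Option κ => o.elim w u).withDensity fun x => weight (x none)).map
    fun x i => x (some i)

theorem CylindricalMeasure.lintegral_weightedLaw (ν : CylindricalMeasure U) (w : U) (u : κ → U)
    {F : (κ → ℝ) → ℝ≥0∞} (hF : Measurable F) :
    ∫⁻ x, F x ∂(ν.weightedLaw w u) =
      ∫⁻ x, weight (x none) * F (fun i => x (some i)) ∂(ν.law fun o : Option κ => o.elim w u) := by
  rw [CylindricalMeasure.weightedLaw, lintegral_map hF measurable_comp_some]
  exact lintegral_withDensity_eq_lintegral_mul _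
    (measurable_weight.comp (measurable_pi_apply none)) (hF.comp measurable_comp_some)

theorem CylindricalMeasure.lintegral_weightedLaw_congr (ν : CylindricalMeasure U) {w : U}
    {u : κ → U} {u' : κ' → U} {F : (κ → ℝ) → ℝ≥0∞} {F' : (κ' → ℝ) → ℝ≥0∞} (hF : Measurable F)
    (hF' : Measurable F') (h : ∀ a, F (coords u a) = F' (coords u' a)) :
    ∫⁻ x, F x ∂(ν.weightedLaw w u) = ∫⁻ x, F' x ∂(ν.weightedLaw w u') := by
  rw [ν.lintegral_weightedLaw w u hF, ν.lintegral_weightedLaw w u' hF']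
  refine ν.lintegral_law_congr
    ((measurable_weight.comp (measurable_pi_apply none)).mul (hF.comp measurable_comp_some))
    ((measurable_weight.comp (measurable_pi_apply none)).mul (hF'.comp measurable_comp_some))
    fun a => ?_
  exact congrArg (weight ⟪a, w⟫_ℝ * ·) (h a)

theorem CylindricalMeasure.map_weightedLaw_congr {E : Type*} [MeasurableSpace E]
    (ν : CylindricalMeasure U) {w : U} {u : κ → U} {u' : κ' → U} {F : (κ → ℝ) → E}
    {F' : (κ' → ℝ) → E} (hF : Measurable F) (hF' : Measurable F')
    (h : ∀ a, F (coords u a) = F' (coords u' a)) :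
    (ν.weightedLaw w u).map F = (ν.weightedLaw w u').map F' := by
  ext S hS
  rw [← lintegral_indicator_one hS, ← lintegral_indicator_one hS,
    lintegral_map (measurable_one.indicator hS) hF, lintegral_map (measurable_one.indicator hS) hF']
  refine ν.lintegral_weightedLaw_congr ((measurable_one.indicator hS).comp hF)
    ((measurable_one.indicator hS).comp hF') fun a => ?_
  rw [h a]

theorem CylindricalMeasure.lintegral_weightedLaw_le (ν : CylindricalMeasure U) (w : U) (u : κ → U)
    {F : (κ → ℝ) → ℝ≥0∞} (hF : Measurable F) :
    ∫⁻ x, F x ∂(ν.weightedLaw w u) ≤ ∫⁻ x, F x ∂(ν.law u) := by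
  rw [ν.lintegral_weightedLaw w u hF]
  refine (lintegral_mono fun x => mul_le_of_le_one_left zero_le (weight_le_one _)).trans
    (le_of_eq ?_)
  exact ν.lintegral_law_congr (hF.comp measurable_comp_some) hF fun a => rfl

theorem CylindricalMeasure.weightedLaw_univ_le (ν : CylindricalMeasure U) (w : U) (u : κ → U) :
    ν.weightedLaw w u univ ≤ ν.secondMoment w := by
  rw [← lintegral_one, ν.lintegral_weightedLaw w u measurable_const]
  refine (lintegral_mono fun x => (mul_one _).trans_le (weight_le_sq _)).trans (le_of_eq ?_)
  exact ν.lintegral_law_sq _ none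

/-- The Cauchy-Schwarz inequality for `∫ |x| (min 1 y²)`, where `y` is the coordinate of the
weight. -/
theorem CylindricalMeasure.lintegral_weightedLaw_enorm_le (ν : CylindricalMeasure U) (w u : U) :
    ∫⁻ x, ‖x ()‖ₑ ∂(ν.weightedLaw w fun _ : Unit => u) ≤
      (ν.secondMoment w) ^ (1 / 2 : ℝ) * (ν.secondMoment u) ^ (1 / 2 : ℝ) := by
  rw [ν.lintegral_weightedLaw w _ (by fun_prop)]
  have h := ENNReal.lintegral_mul_le_Lp_mul_Lq
    (ν.law fun o : Option Unit => o.elim w fun _ => u) Real.HolderConjugate.two_two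
    (f := fun x => weight (x none)) (g := fun x => ‖x (some ())‖ₑ)
    (measurable_weight.comp (measurable_pi_apply none)).aemeasurable
    (measurable_pi_apply (some ())).enorm.aemeasurable
  refine h.trans ?_
  simp only [ENNReal.rpow_ofNat]
  gcongr
  · refine (lintegral_mono fun x => ?_).trans (le_of_eq (ν.lintegral_law_sq _ none))
    calc weight (x none) ^ 2 ≤ weight (x none) := by
          rw [sq]; exact mul_le_of_le_one_left zero_le (weight_le_one _)
      _ ≤ _ := weight_le_sq _
  · exact le_of_eq (ν.lintegral_law_sq (fun o : Option Unit => o.elim w fun _ => u) (some ()))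

end Law

/-! ### Borel extensions of cylindrical measures -/

section WeightedExtension

variable {U : Type*} [NormedAddCommGroup U] [InnerProductSpace ℝ U]
  {V : Type*} [NormedAddCommGroup V] [InnerProductSpace ℝ V]

theorem enorm_sq_eq_tsum {ι : Type*} (e : HilbertBasis ι ℝ V) (v : V) :
    ‖v‖ₑ ^ 2 = ∑' i, ‖⟪v, e i⟫_ℝ‖ₑ ^ 2 := by
  have h := e.hasSum_inner_mul_inner v v
  have h' : HasSum (fun i => ‖⟪v, e i⟫_ℝ‖ ^ 2) (‖v‖ ^ 2) := by
    rw [real_inner_self_eq_norm_sq] at h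
    refine h.congr_fun fun i => ?_
    rw [real_inner_comm v (e i), Real.norm_eq_abs, sq_abs, sq]
  rw [← ofReal_norm, ← ENNReal.ofReal_pow (norm_nonneg _), ← h'.tsum_eq,
    ENNReal.ofReal_tsum_of_nonneg (fun i => by positivity) h'.summable]
  simp_rw [ENNReal.ofReal_pow (norm_nonneg _), ofReal_norm]

variable [MeasurableSpace V] [BorelSpace V]

theorem measurable_inner_right (v : V) : Measurable fun x : V => ⟪x, v⟫_ℝ :=
  (continuous_id.inner continuous_const).measurable

variable [CompleteSpace V] [TopologicalSpace.SeparableSpace V]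

theorem isFiniteMeasure_weightedLaw {ν : CylindricalMeasure U} {w : U}
    (hw : ν.secondMoment w ≠ ∞) {κ : Type*} [Fintype κ] (u : κ → U) :
    IsFiniteMeasure (ν.weightedLaw w u) :=
  ⟨(ν.weightedLaw_univ_le w u).trans_lt hw.lt_top⟩

/-- A finite Borel measure on a separable Hilbert space is determined by its images under the
functionals `⟪·, v⟫`. -/
theorem ext_of_map_inner {m m' : Measure V} [IsFiniteMeasure m] [IsFiniteMeasure m']
    (h : ∀ v, m.map (fun x => ⟪x, v⟫_ℝ) = m'.map fun x => ⟪x, v⟫_ℝ) : m = m' := by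
  have : SecondCountableTopology V := UniformSpace.secondCountable_of_separable V
  refine Measure.ext_of_charFun (funext fun v => ?_)
  have key : ∀ ρ : Measure V, charFun ρ v =
      ∫ y : ℝ, Complex.exp (y * Complex.I) ∂(ρ.map fun x => ⟪x, v⟫_ℝ) := by
    intro ρ
    rw [charFun_apply, integral_map (measurable_inner_right v).aemeasurable]
    exact (by fun_prop : Continuous fun y : ℝ => Complex.exp (y * Complex.I)).aestronglyMeasurable
  rw [key, key, h v]

variable {ι : Type*} [Countable ι] (e : HilbertBasis ι ℝ V) (A : V →L[ℝ] U)
  {ν : CylindricalMeasure U}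

/-- Kolmogorov's theorem gives a measure on sequences of coordinates; it is concentrated on the
square summable ones because the second moments are summable. -/
theorem exists_measure_map_coords_eq {w : U} (hw : ν.secondMoment w ≠ ∞)
    (hsum : ∑' i, ν.secondMoment (A (e i)) ≠ ∞) :
    ∃ ρ : Measure V, IsFiniteMeasure ρ ∧ ∀ I : Finset ι,
      ρ.map (coords fun i : I => e i) = ν.weightedLaw w fun i : I => A (e i) := by
  have : SecondCountableTopology V := UniformSpace.secondCountable_of_separable V
  have hfin : ∀ I : Finset ι, IsFiniteMeasure (ν.weightedLaw w fun i : I => A (e i)) :=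
    fun I => isFiniteMeasure_weightedLaw hw _
  obtain ⟨m, hmfin, hm⟩ := exists_isProjectiveLimit
    (fun I : Finset ι => ν.weightedLaw w fun i : I => A (e i)) (by
      intro I J hJI
      have h := ν.map_weightedLaw_congr (w := w) (u := fun i : J => A (e i))
        (u' := fun i : I => A (e i)) (F := fun x => x)
        (F' := Finset.restrict₂ (π := fun _ : ι => ℝ) hJI) measurable_id
        (Finset.measurable_restrict₂ (X := fun _ : ι => ℝ) _) fun a => rfl
      rw [← h]
      exact Measure.map_id.symm)
  set T : V → ι → ℝ := fun v i => ⟪v, e i⟫_ℝ with hT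
  have hTc : Continuous T := continuous_pi fun i => continuous_id.inner continuous_const
  have hTinj : Function.Injective T := by
    intro v v' h
    apply e.repr.injective
    ext i
    rw [e.repr_apply_apply, e.repr_apply_apply, real_inner_comm, real_inner_comm v']
    exact congrFun h i
  -- Lusin-Souslin: the coordinates embed `V` measurably into `ι → ℝ`
  have hTe : MeasurableEmbedding T := hTc.measurableEmbedding hTinj
  have hcoord : ∀ i, ∫⁻ x, ‖x i‖ₑ ^ 2 ∂m ≤ ν.secondMoment (A (e i)) := by
    intro i
    have h1 : m.map (({i} : Finset ι).restrict (π := fun _ : ι => ℝ)) = _ := hm {i}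
    have h2 : ∫⁻ x, ‖x i‖ₑ ^ 2 ∂m = ∫⁻ y : ({i} : Finset ι) → ℝ, ‖y ⟨i, by simp⟩‖ₑ ^ 2
        ∂(m.map (({i} : Finset ι).restrict (π := fun _ : ι => ℝ))) := by
      rw [lintegral_map (((measurable_pi_apply _).enorm).pow_const 2)
        (Finset.measurable_restrict (X := fun _ : ι => ℝ) _)]
      rfl
    rw [h2, h1]
    refine (ν.lintegral_weightedLaw_le w _ (((measurable_pi_apply _).enorm).pow_const 2)).trans
      (le_of_eq ?_)
    exact ν.lintegral_law_sq (fun j : ({i} : Finset ι) => A (e j)) ⟨i, by simp⟩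
  have hl2 : ∀ᵐ x ∂m, ∑' i, ‖x i‖ₑ ^ 2 < ∞ := by
    refine ae_lt_top' (AEMeasurable.tsum fun i =>
      (((measurable_pi_apply i).enorm).pow_const 2).aemeasurable) ?_
    rw [lintegral_tsum fun i => (((measurable_pi_apply i).enorm).pow_const 2).aemeasurable]
    exact ne_top_of_le_ne_top hsum (ENNReal.tsum_le_tsum hcoord)
  have hrange : ∀ᵐ x ∂m, x ∈ range T := by
    filter_upwards [hl2] with x hx
    have hmem : Memℓp (E := fun _ : ι => ℝ) x 2 := by
      refine memℓp_gen ?_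
      have h1 : Summable fun i => (‖x i‖ₑ ^ 2).toReal := ENNReal.summable_toReal hx.ne
      refine h1.congr fun i => ?_
      simp [ENNReal.toReal_pow]
    refine ⟨e.repr.symm ⟨x, hmem⟩, funext fun i => ?_⟩
    rw [hT]
    simp only
    rw [real_inner_comm, ← e.repr_apply_apply, LinearIsometryEquiv.apply_symm_apply]
  have hmap : (m.comap T).map T = m := by
    rw [hTe.map_comap, Measure.restrict_eq_self_of_ae_mem hrange]
  refine ⟨m.comap T, ⟨?_⟩, fun I => ?_⟩
  · rw [← preimage_univ (f := T), ← hTe.map_apply, hmap]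
    exact measure_lt_top _ _
  · refine Eq.trans ?_ (hm I)
    conv_rhs => rw [← hmap]
    rw [Measure.map_map (Finset.measurable_restrict (X := fun _ : ι => ℝ) _) hTc.measurable]
    rfl

theorem norm_exp_mul_I_sub_exp_mul_I_le (x y : ℝ) :
    ‖Complex.exp (x * Complex.I) - Complex.exp (y * Complex.I)‖ ≤ ‖x - y‖ := by
  have h : Complex.exp (x * Complex.I) - Complex.exp (y * Complex.I) =
      Complex.exp (y * Complex.I) * (Complex.exp (Complex.I * (x - y : ℝ)) - 1) := by
    rw [mul_sub, ← Complex.exp_add, mul_one]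
    congr 2
    push_cast
    ring
  rw [h, norm_mul, Complex.norm_exp_ofReal_mul_I, one_mul]
  exact Real.norm_exp_I_mul_ofReal_sub_one_le

/-- The characteristic functional of the weighted cylindrical measure. -/
noncomputable def weightedCharFun (ν : CylindricalMeasure U) (w u : U) : ℂ :=
  ∫ x : Unit → ℝ, Complex.exp (x () * Complex.I) ∂(ν.weightedLaw w fun _ => u)

theorem integral_weightedLaw_congr {κ κ' : Type*} [Fintype κ] [Fintype κ'] {w : U}
    {u : κ → U} {u' : κ' → U} {F : (κ → ℝ) → ℂ} {F' : (κ' → ℝ) → ℂ} (hF : Measurable F)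
    (hF' : Measurable F') (h : ∀ a, F (coords u a) = F' (coords u' a)) :
    ∫ x, F x ∂(ν.weightedLaw w u) = ∫ x, F' x ∂(ν.weightedLaw w u') := by
  have := ν.map_weightedLaw_congr (w := w) hF hF' h
  rw [← integral_map (f := fun y => y) hF.aemeasurable aestronglyMeasurable_id, this,
    integral_map (f := fun y => y) hF'.aemeasurable aestronglyMeasurable_id]

theorem enorm_weightedCharFun_sub_le {w : U} (hw : ν.secondMoment w ≠ ∞) (u u' : U) :
    ‖weightedCharFun ν w u - weightedCharFun ν w u'‖ₑ ≤
      (ν.secondMoment w) ^ (1 / 2 : ℝ) * (ν.secondMoment (u - u')) ^ (1 / 2 : ℝ) := by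
  have hfin : ∀ v : Fin 2 → U, IsFiniteMeasure (ν.weightedLaw w v) :=
    fun v => isFiniteMeasure_weightedLaw hw _
  have hc : ∀ i : Fin 2, Continuous fun x : Fin 2 → ℝ => Complex.exp (x i * Complex.I) :=
    fun i => by fun_prop
  have hc' : Continuous fun x : Unit → ℝ => Complex.exp (x () * Complex.I) := by fun_prop
  have h1 : weightedCharFun ν w u =
      ∫ x : Fin 2 → ℝ, Complex.exp (x 0 * Complex.I) ∂(ν.weightedLaw w ![u, u']) :=
    integral_weightedLaw_congr hc'.measurable (hc 0).measurable fun a => rfl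
  have h2 : weightedCharFun ν w u' =
      ∫ x : Fin 2 → ℝ, Complex.exp (x 1 * Complex.I) ∂(ν.weightedLaw w ![u, u']) :=
    integral_weightedLaw_congr hc'.measurable (hc 1).measurable fun a => rfl
  have hi : ∀ i : Fin 2, Integrable (fun x : Fin 2 → ℝ => Complex.exp (x i * Complex.I))
      (ν.weightedLaw w ![u, u']) := fun i =>
    Integrable.of_bound (hc i).aestronglyMeasurable 1
      (.of_forall fun x => (Complex.norm_exp_ofReal_mul_I _).le)
  rw [h1, h2, ← integral_sub (hi 0) (hi 1)]
  calc _ ≤ ∫⁻ x : Fin 2 → ℝ, ‖Complex.exp (x 0 * Complex.I) - Complex.exp (x 1 * Complex.I)‖ₑ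
          ∂(ν.weightedLaw w ![u, u']) := enorm_integral_le_lintegral_enorm _
    _ ≤ ∫⁻ x : Fin 2 → ℝ, ‖x 0 - x 1‖ₑ ∂(ν.weightedLaw w ![u, u']) :=
        lintegral_mono fun x => by
          rw [← ofReal_norm, ← ofReal_norm]
          exact ENNReal.ofReal_le_ofReal (norm_exp_mul_I_sub_exp_mul_I_le _ _)
    _ = ∫⁻ x, ‖x ()‖ₑ ∂(ν.weightedLaw w fun _ : Unit => u - u') :=
        ν.lintegral_weightedLaw_congr (by fun_prop) (by fun_prop) fun a => by
          simp [coords, inner_sub_right]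
    _ ≤ _ := ν.lintegral_weightedLaw_enorm_le w _

/-- The weighted cylindrical measures on `V` extend to Borel measures. On vectors with finitely
many coordinates this is Kolmogorov's theorem; the general case follows since both characteristic
functionals are continuous. -/
theorem exists_measure_map_inner_eq {w : U} (hw : ν.secondMoment w ≠ ∞)
    (hsum : ∑' i, ν.secondMoment (A (e i)) ≠ ∞) {C : ℝ≥0∞} (hC : C ≠ ∞)
    (hbound : ∀ u, ν.secondMoment u ≤ C * ‖u‖ₑ ^ 2) :
    ∃ ρ : Measure V, IsFiniteMeasure ρ ∧ ∀ v, ρ.map (fun x => ⟪x, v⟫_ℝ) =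
      (ν.weightedLaw w fun _ : Unit => A v).map fun x => x () := by
  classical
  obtain ⟨ρ, hρ, hmap⟩ := exists_measure_map_coords_eq e A hw hsum
  refine ⟨ρ, hρ, ?_⟩
  have hexp : Continuous fun y : ℝ => Complex.exp (y * Complex.I) := by fun_prop
  -- partial sums of the expansion of `v`
  set pr : V → Finset ι → V := fun v I => ∑ i ∈ I, ⟪e i, v⟫_ℝ • e i with hpr
  have hprt : ∀ v, Tendsto (pr v) atTop (𝓝 v) := fun v => by
    have h : HasSum _ v := e.hasSum_repr v
    simp_rw [e.repr_apply_apply] at h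
    exact h
  have hfinite : ∀ v I, ∫ x, Complex.exp ((⟪x, pr v I⟫_ℝ : ℝ) * Complex.I) ∂ρ =
      weightedCharFun ν w (A (pr v I)) := by
    intro v I
    set F : (I → ℝ) → ℂ := fun y => Complex.exp ((∑ i : I, ⟪e i, v⟫_ℝ * y i : ℝ) * Complex.I)
    have hF : Continuous F := by fun_prop
    have h1 : ∫ x, Complex.exp ((⟪x, pr v I⟫_ℝ : ℝ) * Complex.I) ∂ρ =
        ∫ y, F y ∂(ρ.map (coords fun i : I => e i)) := by
      rw [integral_map (continuous_coords _).measurable.aemeasurable hF.aestronglyMeasurable]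
      refine integral_congr_ae (.of_forall fun x => ?_)
      simp only [F, hpr, coords, inner_sum, real_inner_smul_right]
      rw [Finset.sum_coe_sort I fun i => ⟪e i, v⟫_ℝ * ⟪x, e i⟫_ℝ]
    rw [h1, hmap]
    refine integral_weightedLaw_congr hF.measurable (by fun_prop) fun a => ?_
    simp only [F, hpr, coords, map_sum, map_smul, inner_sum, real_inner_smul_right]
    rw [Finset.sum_coe_sort I fun i => ⟪e i, v⟫_ℝ * ⟪a, A (e i)⟫_ℝ]
  -- both sides are continuous in `v`
  have hchar : ∀ v, ∫ x, Complex.exp ((⟪x, v⟫_ℝ : ℝ) * Complex.I) ∂ρ =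
      weightedCharFun ν w (A v) := by
    intro v
    have hl : Tendsto (fun I => ∫ x, Complex.exp ((⟪x, pr v I⟫_ℝ : ℝ) * Complex.I) ∂ρ) atTop
        (𝓝 (∫ x, Complex.exp ((⟪x, v⟫_ℝ : ℝ) * Complex.I) ∂ρ)) := by
      refine tendsto_integral_filter_of_dominated_convergence (fun _ => 1) ?_ ?_
        (integrable_const _) ?_
      · exact .of_forall fun I => (hexp.measurable.comp
          (measurable_inner_right (pr v I))).aestronglyMeasurable
      · exact .of_forall fun I => .of_forall fun x => (Complex.norm_exp_ofReal_mul_I _).le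
      · refine .of_forall fun x => (hexp.tendsto _).comp ?_
        exact tendsto_const_nhds.inner (hprt v)
    have hr : Tendsto (fun I => weightedCharFun ν w (A (pr v I))) atTop
        (𝓝 (weightedCharFun ν w (A v))) := by
      rw [tendsto_iff_edist_tendsto_0]
      have hsm : Tendsto (fun I => ν.secondMoment (A (pr v I) - A v)) atTop (𝓝 0) := by
        have h0 : Tendsto (fun I => C * ‖A (pr v I) - A v‖ₑ ^ 2) atTop (𝓝 (C * 0 ^ 2)) := by
          refine ENNReal.Tendsto.const_mul (ENNReal.Tendsto.pow ?_) (Or.inr hC)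
          have h := ((A.continuous.tendsto v).comp (hprt v))
          rw [tendsto_iff_edist_tendsto_0] at h
          simpa [edist_eq_enorm_sub] using h
        simp only [ne_eq, OfNat.ofNat_ne_zero, not_false_eq_true, zero_pow, mul_zero] at h0
        exact tendsto_of_tendsto_of_tendsto_of_le_of_le tendsto_const_nhds h0 (fun _ => zero_le)
          fun I => hbound _
      have h1 : Tendsto (fun I => (ν.secondMoment w) ^ (1 / 2 : ℝ) *
          (ν.secondMoment (A (pr v I) - A v)) ^ (1 / 2 : ℝ)) atTop (𝓝 0) := by
        have h2 := ENNReal.Tendsto.const_mul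
          ((ENNReal.continuous_rpow_const (y := (1 / 2 : ℝ))).tendsto 0 |>.comp hsm)
          (Or.inr (ENNReal.rpow_ne_top_of_nonneg (by norm_num : (0 : ℝ) ≤ 1 / 2) hw))
        simpa using h2
      refine tendsto_of_tendsto_of_tendsto_of_le_of_le tendsto_const_nhds h1 (fun _ => zero_le)
        fun I => ?_
      simp only [edist_eq_enorm_sub]
      exact enorm_weightedCharFun_sub_le hw _ _
    exact tendsto_nhds_unique (hl.congr fun I => hfinite v I) hr
  intro v
  have hf1 := isFiniteMeasure_weightedLaw hw fun _ : Unit => A v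
  have : IsFiniteMeasure ((ν.weightedLaw w fun _ : Unit => A v).map fun x => x ()) :=
    Measure.isFiniteMeasure_map _ _
  have : IsFiniteMeasure (ρ.map fun x => ⟪x, v⟫_ℝ) := Measure.isFiniteMeasure_map _ _
  refine Measure.ext_of_charFun (funext fun t => ?_)
  have hc2 : Continuous fun y : ℝ => Complex.exp (t * y * Complex.I) := by fun_prop
  rw [charFun_apply_real, charFun_apply_real,
    integral_map (measurable_inner_right v).aemeasurable hc2.aestronglyMeasurable,
    integral_map (measurable_pi_apply ()).aemeasurable hc2.aestronglyMeasurable]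
  have h := hchar (t • v)
  simp only [real_inner_smul_right] at h
  push_cast at h
  rw [h]
  refine integral_weightedLaw_congr (by fun_prop) (by fun_prop) fun a => ?_
  simp [coords, real_inner_smul_right]

end WeightedExtension

/-! ### Radonification by Hilbert-Schmidt operators -/

section Radonification

variable {U : Type*} [NormedAddCommGroup U] [InnerProductSpace ℝ U] [CompleteSpace U]
  {V : Type*} [NormedAddCommGroup V] [InnerProductSpace ℝ V] [CompleteSpace V]

open ContinuousLinearMap (adjoint)

theorem preimage_coords_eq (φ : HilbertSchmidt U V) {κ : Type*} (v : κ → V) (S : Set (κ → ℝ)) :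
    φ.toCLM ⁻¹' (coords v ⁻¹' S) = coords (fun i => adjoint φ.toCLM (v i)) ⁻¹' S := by
  ext a
  simp only [mem_preimage]
  congr! 1
  funext i
  exact (ContinuousLinearMap.adjoint_inner_right φ.toCLM a (v i)).symm

variable [MeasurableSpace V] {ν : CylindricalMeasure U} {φ : HilbertSchmidt U V} {m : Measure V}

/-- Integrals of cylindrical functions vanishing at the origin with respect to the extension. -/
theorem IsRadonification.lintegral_coords [BorelSpace V] (hm : IsRadonification ν φ m)
    {κ : Type*} [Fintype κ] (v : κ → V) (hv : Measurable (coords v)) {F : (κ → ℝ) → ℝ≥0∞}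
    (hF : Measurable F) (hF0 : F 0 = 0) :
    ∫⁻ x, F (coords v x) ∂m = ∫⁻ y, F y ∂(ν.law fun i => adjoint φ.toCLM (v i)) := by
  classical
  have key : (m.map (coords v)).restrict {0}ᶜ =
      (ν.law fun i => adjoint φ.toCLM (v i)).restrict {0}ᶜ := by
    ext S hS
    have hS' : MeasurableSet (S ∩ {0}ᶜ) := hS.inter (measurableSet_singleton 0).compl
    rw [Measure.restrict_apply hS, Measure.restrict_apply hS, Measure.map_apply hv hS',
      ν.law_apply _ hS', ← preimage_coords_eq]
    refine hm.eq_on_cylinders (Finset.univ.image v) _ (measurable_coords_cylSigma v hS') ?_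
    simp [coords_zero]
  have hset : ∀ μ : Measure (κ → ℝ), ∫⁻ y, F y ∂μ = ∫⁻ y, F y ∂(μ.restrict {0}ᶜ) := by
    intro μ
    rw [← lintegral_indicator (measurableSet_singleton 0).compl]
    refine lintegral_congr fun y => ?_
    by_cases hy : y = 0
    · simp [hy, hF0]
    · simp [hy]
  rw [← lintegral_map hF hv, hset, key, ← hset]

theorem lintegral_withDensity_eq {E : Type*} [MeasurableSpace E] {μ : Measure E}
    {f g : E → ℝ≥0∞} (hf : Measurable f) (hg : Measurable g) :
    ∫⁻ x, g x ∂(μ.withDensity f) = ∫⁻ x, f x * g x ∂μ :=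
  lintegral_withDensity_eq_lintegral_mul _ hf hg

/-- To compare the integrals of cylindrical functions that vanish at the origin, it suffices to
consider functions that vanish wherever some fixed coordinate does. -/
theorem lintegral_eq_of_forall_weight [BorelSpace V] {κ : Type*} [Fintype κ] (v : κ → V)
    {F : (κ → ℝ) → ℝ≥0∞} (hF : Measurable F) (hF0 : F 0 = 0)
    (h : ∀ (i : κ) (G : (κ → ℝ) → ℝ≥0∞), Measurable G → (∀ y, y i = 0 → G y = 0) →
      ∫⁻ x, G (coords v x) ∂m = ∫⁻ y, G y ∂(ν.law fun i => adjoint φ.toCLM (v i))) :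
    ∫⁻ x, F (coords v x) ∂m = ∫⁻ y, F y ∂(ν.law fun i => adjoint φ.toCLM (v i)) := by
  classical
  have hv : Measurable (coords v) := (continuous_coords v).measurable
  set A : Finset κ → Set (κ → ℝ) := fun s => {y | ∃ i ∈ s, y i ≠ 0} with hA
  have hms : ∀ s : Finset κ, MeasurableSet (A s) := by
    intro s
    have : A s = ⋃ i ∈ s, (fun y : κ → ℝ => y i) ⁻¹' {0}ᶜ := by
      ext y; simp [hA]
    rw [this]
    exact Finset.measurableSet_biUnion s fun i _ =>
      measurable_pi_apply i (measurableSet_singleton 0).compl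
  -- split according to the first coordinate that does not vanish
  have hind : ∀ s : Finset κ, ∫⁻ x, (A s).indicator F (coords v x) ∂m =
      ∫⁻ y, (A s).indicator F y ∂(ν.law fun i => adjoint φ.toCLM (v i)) := by
    intro s
    induction s using Finset.induction_on with
    | empty => simp [hA]
    | insert i s his ih =>
      set B : Set (κ → ℝ) := {y | y i ≠ 0} ∩ (A s)ᶜ with hB
      have hm2 : MeasurableSet B :=
        (measurable_pi_apply i (measurableSet_singleton 0).compl).inter (hms s).compl
      have hsplit : ∀ y, (A (insert i s)).indicator F y =
          (A s).indicator F y + B.indicator F y := by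
        intro y
        have hdisj : Disjoint (A s) B := disjoint_compl_right.mono_right inter_subset_right
        have hunion : A (insert i s) = A s ∪ B := by
          ext z
          simp only [hA, hB, Finset.exists_mem_insert, mem_union, mem_inter_iff, mem_compl_iff,
            mem_ofPred_eq]
          by_cases h : ∃ x ∈ s, z x ≠ 0
          · exact ⟨fun _ => Or.inl h, fun _ => Or.inr h⟩
          · exact ⟨fun h' => Or.inr ⟨h'.resolve_right h, h⟩, fun h' => Or.inl (h'.resolve_left h).1⟩
        rw [hunion, indicator_union_of_disjoint hdisj]
      simp_rw [hsplit]
      rw [lintegral_add_left (f := fun x => (A s).indicator F (coords v x))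
          ((hF.indicator (hms s)).comp hv), lintegral_add_left (hF.indicator (hms s)), ih,
        h i _ (hF.indicator hm2)]
      intro y hy
      exact indicator_of_notMem (fun h => h.1 hy) F
  have huniv : (A Finset.univ).indicator F = F := by
    refine indicator_eq_self.2 fun y hy => ?_
    by_contra h0
    refine hy ?_
    rw [show y = 0 from funext fun i => by_contra fun hi => h0 ⟨i, Finset.mem_univ i, hi⟩, hF0]
  have := hind Finset.univ
  rwa [huniv] at this

end Radonification

section TotalWeight

variable {V : Type*} [NormedAddCommGroup V] [InnerProductSpace ℝ V]
  {ι : Type*} (e : HilbertBasis ι ℝ V)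

/-- The sum of the weights of all coordinates of `x`. -/
noncomputable def totalWeight (x : V) : ℝ≥0∞ := ∑' i, weight ⟪x, e i⟫_ℝ

theorem totalWeight_ne_top (x : V) : totalWeight e x ≠ ∞ := by
  refine ne_top_of_le_ne_top (b := ‖x‖ₑ ^ 2) (by finiteness) ?_
  rw [enorm_sq_eq_tsum e]
  exact ENNReal.tsum_le_tsum fun i => weight_le_sq _

theorem totalWeight_ne_zero {x : V} (hx : x ≠ 0) : totalWeight e x ≠ 0 := by
  intro h
  apply hx
  rw [totalWeight, ENNReal.tsum_eq_zero] at h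
  apply e.repr.injective
  ext i
  rw [e.repr_apply_apply, real_inner_comm, map_zero]
  by_contra h0
  exact weight_ne_zero h0 (h i)

variable [MeasurableSpace V] [BorelSpace V]

theorem measurable_weight_inner (v : V) : Measurable fun x : V => weight ⟪x, v⟫_ℝ :=
  measurable_weight.comp (measurable_inner_right v)

theorem measurable_totalWeight [Countable ι] : Measurable (totalWeight e) :=
  Measurable.tsum fun i => measurable_weight_inner (e i)

end TotalWeight

section ImagesOfWeighted

variable {U : Type*} [NormedAddCommGroup U] [InnerProductSpace ℝ U]
  {V : Type*} [NormedAddCommGroup V] [InnerProductSpace ℝ V] [MeasurableSpace V] [BorelSpace V]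
  {ν : CylindricalMeasure U} {A : V →L[ℝ] U} {w : U} {ρ : Measure V}

/-- By the Cramér-Wold device, the one-dimensional images of `ρ` determine the images under
several functionals. -/
theorem map_coords_eq_weightedLaw (hw : ν.secondMoment w ≠ ∞) [IsFiniteMeasure ρ]
    (hρ : ∀ v, ρ.map (fun x => ⟪x, v⟫_ℝ) =
      (ν.weightedLaw w fun _ : Unit => A v).map fun x => x ())
    {κ : Type*} [Fintype κ] (z : κ → V) :
    ρ.map (coords z) = ν.weightedLaw w fun i => A (z i) := by
  have hcz : Measurable (coords z) := (continuous_coords z).measurable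
  have : IsFiniteMeasure (ρ.map (coords z)) := Measure.isFiniteMeasure_map _ _
  have : IsFiniteMeasure (ν.weightedLaw w fun i => A (z i)) :=
    ⟨(ν.weightedLaw_univ_le w _).trans_lt hw.lt_top⟩
  refine Measure.ext_of_charFunDual (funext fun ℓ => ?_)
  rw [charFunDual_eq_charFun_map_one, charFunDual_eq_charFun_map_one]
  congr 1
  classical
  -- the functional `ℓ` on `κ → ℝ` comes from the vector `z' = ∑ᵢ ℓᵢ zᵢ`
  have hℓ : ∀ y : κ → ℝ, ℓ y = ∑ i, ℓ (Pi.single i 1) * y i := by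
    intro y
    conv_lhs => rw [← Finset.univ_sum_single y, map_sum]
    refine Finset.sum_congr rfl fun i _ => ?_
    have : Pi.single i (y i) = y i • (Pi.single i (1 : ℝ) : κ → ℝ) := by
      rw [← Pi.single_smul', smul_eq_mul, mul_one]
    rw [this, map_smul, smul_eq_mul, mul_comm]
  set z' : V := ∑ i, ℓ (Pi.single i 1) • z i
  rw [Measure.map_map ℓ.continuous.measurable hcz]
  have h1 : (fun x => ⟪x, z'⟫_ℝ) = ℓ ∘ coords z := by
    funext x
    rw [Function.comp_apply, hℓ]
    simp only [z', inner_sum, real_inner_smul_right, coords]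
  rw [← h1, hρ z']
  refine ν.map_weightedLaw_congr (measurable_pi_apply ()) ℓ.continuous.measurable fun a => ?_
  rw [hℓ]
  simp only [z', coords, map_sum, map_smul, inner_sum, real_inner_smul_right]

theorem lintegral_coords_eq_of_map_inner (hw : ν.secondMoment w ≠ ∞) [IsFiniteMeasure ρ]
    (hρ : ∀ v, ρ.map (fun x => ⟪x, v⟫_ℝ) =
      (ν.weightedLaw w fun _ : Unit => A v).map fun x => x ())
    {κ : Type*} [Fintype κ] (z : κ → V) {F : (κ → ℝ) → ℝ≥0∞} (hF : Measurable F) :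
    ∫⁻ x, F (coords z x) ∂ρ = ∫⁻ y, weight (y none) * F (fun i => y (some i))
      ∂(ν.law fun o : Option κ => o.elim w fun i => A (z i)) := by
  rw [← ν.lintegral_weightedLaw _ _ hF, ← map_coords_eq_weightedLaw hw hρ z,
    lintegral_map hF (continuous_coords z).measurable]

end ImagesOfWeighted

section Radonification

variable {U : Type*} [NormedAddCommGroup U] [InnerProductSpace ℝ U] [CompleteSpace U]
  {V : Type*} [NormedAddCommGroup V] [InnerProductSpace ℝ V] [CompleteSpace V]
  [MeasurableSpace V] [BorelSpace V] [TopologicalSpace.SeparableSpace V]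
  {ν : CylindricalMeasure U} {φ : HilbertSchmidt U V} {m : Measure V}

open ContinuousLinearMap (adjoint)

/-- There is at most one extension: weighting by `min 1 ⟪·, eₖ⟫²` makes it finite, and a finite
measure is determined by its one-dimensional images. -/
theorem IsRadonification.unique {m' : Measure V} (hm : IsRadonification ν φ m)
    (hm' : IsRadonification ν φ m')
    (hfin : ∀ v, ν.secondMoment (adjoint φ.toCLM v) ≠ ∞) : m = m' := by
  have := countable_basisIndex V
  set e := stdBasis V
  have hc : ∀ v : Fin 2 → V, Measurable (coords v) := fun v => (continuous_coords v).measurable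
  -- the weighted measures agree
  have hw : ∀ v, m.withDensity (fun x => weight ⟪x, v⟫_ℝ) =
      m'.withDensity fun x => weight ⟪x, v⟫_ℝ := by
    intro v
    have hval : ∀ {m : Measure V}, IsRadonification ν φ m → ∀ z (S : Set ℝ), MeasurableSet S →
        (m.withDensity fun x => weight ⟪x, v⟫_ℝ).map (fun x => ⟪x, z⟫_ℝ) S =
          ∫⁻ y, weight (y 0) * S.indicator 1 (y 1)
            ∂(ν.law fun i => adjoint φ.toCLM (![v, z] i)) := by
      intro m hm z S hS
      have hS1 : Measurable (S.indicator (1 : ℝ → ℝ≥0∞)) := measurable_one.indicator hS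
      rw [← lintegral_indicator_one hS, lintegral_map hS1 (measurable_inner_right z),
        lintegral_withDensity_eq (g := fun x => S.indicator 1 ⟪x, z⟫_ℝ) (measurable_weight_inner v)
          (hS1.comp (measurable_inner_right z))]
      exact hm.lintegral_coords ![v, z] (hc _)
          (F := fun y => weight (y 0) * S.indicator 1 (y 1))
          ((measurable_weight.comp (measurable_pi_apply 0)).mul
            (hS1.comp (measurable_pi_apply 1))) (by simp [weight_zero])
    have hfinite : ∀ {m : Measure V}, IsRadonification ν φ m →
        IsFiniteMeasure (m.withDensity fun x => weight ⟪x, v⟫_ℝ) := by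
      intro m hm
      refine isFiniteMeasure_withDensity (ne_top_of_le_ne_top (hfin v) ?_)
      have h := hm.lintegral_coords (fun _ : Unit => v) (continuous_coords _).measurable
        (F := fun y => weight (y ())) (measurable_weight.comp (measurable_pi_apply ()))
        weight_zero
      refine (le_of_eq h).trans ((lintegral_mono fun y => weight_le_sq _).trans (le_of_eq ?_))
      exact ν.lintegral_law_sq _ ()
    have := hfinite hm
    have := hfinite hm'
    refine ext_of_map_inner fun z => ?_
    ext S hS
    rw [hval hm z S hS, hval hm' z S hS]
  -- off the origin the total weight is positive and can be divided out
  have hset : ∀ {m : Measure V}, IsRadonification ν φ m → ∀ S : Set V, MeasurableSet S →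
      m S = ∑' i, ∫⁻ x, S.indicator 1 x / totalWeight e x
        ∂(m.withDensity fun x => weight ⟪x, e i⟫_ℝ) := by
    intro m hm S hS
    have hS1 : Measurable (S.indicator (1 : V → ℝ≥0∞)) := measurable_one.indicator hS
    have hmeas : Measurable fun x => S.indicator 1 x / totalWeight e x :=
      hS1.div (measurable_totalWeight e)
    have h1 : ∀ i, ∫⁻ x, S.indicator 1 x / totalWeight e x
        ∂(m.withDensity fun x => weight ⟪x, e i⟫_ℝ) =
          ∫⁻ x, weight ⟪x, e i⟫_ℝ * (S.indicator 1 x / totalWeight e x) ∂m := fun i =>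
      lintegral_withDensity_eq (measurable_weight_inner _) hmeas
    simp_rw [h1]
    rw [← lintegral_tsum (f := fun i x => weight ⟪x, e i⟫_ℝ * (S.indicator 1 x / totalWeight e x))
      fun i => ((measurable_weight_inner _).mul hmeas).aemeasurable, ← lintegral_indicator_one hS]
    refine lintegral_congr_ae ?_
    have hne : ∀ᵐ x ∂m, x ≠ 0 := by
      rw [ae_iff]
      simpa using hm.zero
    filter_upwards [hne] with x hx
    rw [ENNReal.tsum_mul_right]
    exact (ENNReal.mul_div_cancel (totalWeight_ne_zero e hx) (totalWeight_ne_top e x)).symm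
  ext S hS
  rw [hset hm S hS, hset hm' S hS]
  simp_rw [hw]

/-- Existence of the extension: glue the Borel extensions `ρᵢ` of the weighted cylindrical
measures by dividing `∑ᵢ ρᵢ` by the total weight. -/
theorem exists_isRadonification
    (hsum : ∑' i, ν.secondMoment (adjoint φ.toCLM (stdBasis V i)) ≠ ∞) {C : ℝ≥0∞} (hC : C ≠ ∞)
    (hbound : ∀ u, ν.secondMoment u ≤ C * ‖u‖ₑ ^ 2) :
    ∃ m : Measure V, IsRadonification ν φ m := by
  have := countable_basisIndex V
  set e := stdBasis V
  set A := adjoint φ.toCLM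
  have hfin : ∀ u, ν.secondMoment u ≠ ∞ := fun u =>
    ne_top_of_le_ne_top (by finiteness) (hbound u)
  have hρ' := fun v => exists_measure_map_inner_eq e A (hfin (A v)) hsum hC hbound
  choose ρ hρfin hρ using hρ'
  have hlint : ∀ (v : V) (κ : Type) [Fintype κ] (z : κ → V) {F : (κ → ℝ) → ℝ≥0∞},
      Measurable F → ∫⁻ x, F (coords z x) ∂(ρ v) =
        ∫⁻ y, weight (y none) * F (fun i => y (some i))
          ∂(ν.law fun o : Option κ => o.elim (A v) fun i => A (z i)) := by
    intro v κ _ z F hF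
    have := hρfin v
    exact lintegral_coords_eq_of_map_inner (hfin (A v)) (hρ v) z hF
  -- `ρ v` is the extension weighted by `min 1 ⟪·, v⟫²`; two weights can be applied in any order
  have hswap : ∀ v v', (ρ v).withDensity (fun x => weight ⟪x, v'⟫_ℝ) =
      (ρ v').withDensity fun x => weight ⟪x, v⟫_ℝ := by
    intro v v'
    have hfin' : ∀ v v', IsFiniteMeasure ((ρ v).withDensity fun x => weight ⟪x, v'⟫_ℝ) := by
      intro v v'
      have := hρfin v
      refine isFiniteMeasure_withDensity (ne_top_of_le_ne_top (measure_ne_top (ρ v) univ) ?_)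
      rw [← lintegral_one]
      exact lintegral_mono fun x => weight_le_one _
    have := hfin' v v'
    have := hfin' v' v
    refine ext_of_map_inner fun z => ?_
    have hval : ∀ v v' (S : Set ℝ), MeasurableSet S →
        ((ρ v).withDensity fun x => weight ⟪x, v'⟫_ℝ).map (fun x => ⟪x, z⟫_ℝ) S =
          ∫⁻ y, weight (y none) * (weight (y (some 0)) * S.indicator 1 (y (some 1)))
            ∂(ν.law fun o : Option (Fin 2) => o.elim (A v) fun i => A (![v', z] i)) := by
      intro v v' S hS
      have hS1 : Measurable (S.indicator (1 : ℝ → ℝ≥0∞)) := measurable_one.indicator hS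
      rw [← lintegral_indicator_one hS, lintegral_map hS1 (measurable_inner_right z),
        lintegral_withDensity_eq (g := fun x => S.indicator 1 ⟪x, z⟫_ℝ) (measurable_weight_inner v')
          (hS1.comp (measurable_inner_right z))]
      exact hlint v (Fin 2) ![v', z] (F := fun y => weight (y 0) * S.indicator 1 (y 1))
          ((measurable_weight.comp (measurable_pi_apply 0)).mul
            (hS1.comp (measurable_pi_apply 1)))
    ext S hS
    have hS1 : Measurable (S.indicator (1 : ℝ → ℝ≥0∞)) := measurable_one.indicator hS
    have hmeas : Measurable fun y : Option (Fin 2) → ℝ =>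
        weight (y none) * (weight (y (some 0)) * S.indicator 1 (y (some 1))) :=
      (measurable_weight.comp (measurable_pi_apply _)).mul
        ((measurable_weight.comp (measurable_pi_apply _)).mul (hS1.comp (measurable_pi_apply _)))
    rw [hval v v' S hS, hval v' v S hS]
    exact ν.lintegral_law_congr hmeas hmeas fun a => mul_left_comm _ _ _
  -- `ρ v` has no mass where its weight vanishes
  have hρ0 : ∀ v, ∀ᵐ x ∂(ρ v), x ≠ 0 := by
    intro v
    have hS1 : Measurable (({0} : Set ℝ).indicator (1 : ℝ → ℝ≥0∞)) :=
      measurable_one.indicator (measurableSet_singleton 0)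
    have h0 : ∫⁻ x, ({0} : Set ℝ).indicator (1 : ℝ → ℝ≥0∞) ⟪x, v⟫_ℝ ∂(ρ v) = 0 := by
      refine (hlint v Unit (fun _ => v) (hS1.comp (measurable_pi_apply ()))).trans ?_
      rw [ν.lintegral_law_congr (u' := fun o : Option Unit => o.elim (A v) fun _ => A v)
        (F' := fun _ => 0) ?_ measurable_const, lintegral_zero]
      · intro a
        by_cases h : coords (fun o : Option Unit => o.elim (A v) fun _ => A v) a none = 0
        · rw [h, weight_zero, zero_mul]
        · exact mul_eq_zero_of_right _ (indicator_of_notMem (s := {0}) h _)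
      · exact (measurable_weight.comp (measurable_pi_apply _)).mul
          (hS1.comp (measurable_pi_apply _))
    rw [lintegral_eq_zero_iff
      (f := fun x => ({0} : Set ℝ).indicator (1 : ℝ → ℝ≥0∞) ⟪x, v⟫_ℝ)
      (hS1.comp (measurable_inner_right v))] at h0
    filter_upwards [h0] with x hx h
    simp [h] at hx
  set m := (Measure.sum fun i => ρ (e i)).withDensity fun x => (totalWeight e x)⁻¹ with hm
  -- weighting `m` by `min 1 ⟪·, v⟫²` gives back `ρ v`, also for `v` that are not basis vectors
  have hmw : ∀ (v : V) {F : V → ℝ≥0∞}, Measurable F →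
      ∫⁻ x, weight ⟪x, v⟫_ℝ * F x ∂m = ∫⁻ x, F x ∂(ρ v) := by
    intro v F hF
    have htw : Measurable fun x => (totalWeight e x)⁻¹ := (measurable_totalWeight e).inv
    have htF : Measurable fun x => (totalWeight e x)⁻¹ * F x := htw.mul hF
    have hwF : Measurable fun x => weight ⟪x, v⟫_ℝ * F x := (measurable_weight_inner v).mul hF
    have hstep : ∀ i, ∫⁻ x, (totalWeight e x)⁻¹ * (weight ⟪x, v⟫_ℝ * F x) ∂(ρ (e i)) =
        ∫⁻ x, weight ⟪x, e i⟫_ℝ * ((totalWeight e x)⁻¹ * F x) ∂(ρ v) := by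
      intro i
      rw [← lintegral_withDensity_eq (measurable_weight_inner (e i)) htF, hswap v (e i),
        lintegral_withDensity_eq (measurable_weight_inner v) htF]
      exact lintegral_congr fun x => mul_left_comm _ _ _
    rw [hm, lintegral_withDensity_eq htw hwF,
      lintegral_sum_measure]
    simp_rw [hstep]
    rw [← lintegral_tsum (f := fun i x => weight ⟪x, e i⟫_ℝ * ((totalWeight e x)⁻¹ * F x))
      fun i => ((measurable_weight_inner _).mul (htw.mul hF)).aemeasurable]
    refine lintegral_congr_ae ?_
    filter_upwards [hρ0 v] with x hx
    rw [ENNReal.tsum_mul_right, ← mul_assoc]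
    change totalWeight e x * _ * _ = _
    rw [ENNReal.mul_inv_cancel (totalWeight_ne_zero e hx) (totalWeight_ne_top e x), one_mul]
  refine ⟨m, ?_, ?_⟩
  · refine withDensity_absolutelyContinuous _ _ ?_
    rw [Measure.sum_apply _ (measurableSet_singleton 0), ENNReal.tsum_eq_zero]
    intro i
    simpa [ae_iff] using hρ0 (e i)
  · intro Γ S' hS' h0
    obtain ⟨S, hS, rfl⟩ := exists_coords_preimage_eq hS'
    set z : Γ → V := fun i => i
    have hz : Measurable (coords z) := (continuous_coords z).measurable
    have hS1 : Measurable (S.indicator (1 : (Γ → ℝ) → ℝ≥0∞)) := measurable_one.indicator hS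
    have h0S : (0 : Γ → ℝ) ∉ S := by rwa [mem_preimage, coords_zero] at h0
    rw [preimage_coords_eq, ← ν.law_apply _ hS, ← lintegral_indicator_one hS,
      ← lintegral_indicator_one (hz hS)]
    refine lintegral_eq_of_forall_weight z hS1 (indicator_of_notMem h0S _) fun i G hG hG0 => ?_
    have hwi : Measurable fun y : Γ → ℝ => weight (y i) :=
      measurable_weight.comp (measurable_pi_apply i)
    have hmul : ∀ y : Γ → ℝ, weight (y i) * (G y / weight (y i)) = G y := by
      intro y
      by_cases hy : y i = 0
      · simp [hG0 y hy]
      · exact ENNReal.mul_div_cancel (weight_ne_zero hy) (weight_ne_top _)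
    have := hρfin (z i)
    calc ∫⁻ x, G (coords z x) ∂m
        = ∫⁻ x, weight ⟪x, z i⟫_ℝ * (G (coords z x) / weight (coords z x i)) ∂m :=
          lintegral_congr fun x => (hmul (coords z x)).symm
      _ = ∫⁻ x, G (coords z x) / weight (coords z x i) ∂(ρ (z i)) :=
          hmw (z i) ((hG.div hwi).comp hz)
      _ = ∫⁻ y, weight (y none) * (G (fun j => y (some j)) / weight (y (some i)))
            ∂(ν.law fun o : Option Γ => o.elim (A (z i)) fun j => A (z j)) :=
          lintegral_coords_eq_of_map_inner (hfin _) (hρ (z i)) z (hG.div hwi)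
      _ = ∫⁻ y, G y ∂(ν.law fun j => A (z j)) := by
          refine ν.lintegral_law_congr ?_ hG fun a => hmul (coords (fun j => A (z j)) a)
          exact (measurable_weight.comp (measurable_pi_apply _)).mul
            ((hG.div hwi).comp measurable_comp_some)

theorem isRadonification_radonification {V : Type*} [NormedAddCommGroup V]
    [InnerProductSpace ℝ V] [MeasurableSpace V] {φ : HilbertSchmidt U V}
    (h : ∃ m : Measure V, IsRadonification ν φ m) :
    IsRadonification ν φ (radonification ν φ) := by
  rw [radonification, dif_pos h]
  exact h.choose_spec

/-- Parseval's identity for the integral of `‖φ u‖²`. -/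
theorem cylIntegral_eq_tsum (h : ∃ m : Measure V, IsRadonification ν φ m) :
    cylIntegral ν φ = ∑' k, ν.secondMoment (adjoint φ.toCLM (stdBasis V k)) := by
  have := countable_basisIndex V
  have hm := isRadonification_radonification h
  rw [cylIntegral]
  simp_rw [enorm_sq_eq_tsum (stdBasis V)]
  rw [lintegral_tsum fun k => ((measurable_inner_right _).enorm.pow_const 2).aemeasurable]
  refine tsum_congr fun k => ?_
  refine (hm.lintegral_coords (fun _ : Unit => stdBasis V k) (continuous_coords _).measurable
    (F := fun y => ‖y ()‖ₑ ^ 2) (by fun_prop) (by simp)).trans ?_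
  exact ν.lintegral_law_sq _ ()

end Radonification

/-! ### Second moments from characteristic functions -/

section SecondMoments

theorem two_mul_one_sub_cos_div_le (x y : ℝ) : 2 * (1 - Real.cos (x * y)) / x ^ 2 ≤ y ^ 2 := by
  rcases eq_or_ne x 0 with rfl | hx
  · simpa using sq_nonneg y
  · rw [div_le_iff₀ (by positivity)]
    nlinarith [Real.one_sub_sq_div_two_le_cos (x := x * y)]

theorem two_mul_one_sub_cos_div_nonneg (x y : ℝ) : 0 ≤ 2 * (1 - Real.cos (x * y)) / x ^ 2 :=
  div_nonneg (by linarith [Real.cos_le_one (x * y)]) (sq_nonneg x)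

/-- By the half-angle formula, the quotient is the square of a difference quotient of the sine. -/
theorem tendsto_two_mul_one_sub_cos_div (y : ℝ) :
    Tendsto (fun x : ℝ => 2 * (1 - Real.cos (x * y)) / x ^ 2) (𝓝[≠] 0) (𝓝 (y ^ 2)) := by
  have hd : HasDerivAt (fun x : ℝ => 2 * Real.sin (x * (y / 2))) y 0 := by
    have h := (((hasDerivAt_id (0 : ℝ)).mul_const (y / 2)).sin).const_mul 2
    simpa [mul_div_cancel₀] using h
  have h := (hasDerivAt_iff_tendsto_slope.1 hd).pow 2
  refine h.congr fun x => ?_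
  rw [slope_def_field, sub_zero, zero_mul, Real.sin_zero, mul_zero, sub_zero, div_pow]
  congr 1
  have : Real.cos (x * y) = 1 - 2 * Real.sin (x * (y / 2)) ^ 2 := by
    rw [show x * y = 2 * (x * (y / 2)) by ring, Real.cos_two_mul, Real.cos_sq']
    ring
  rw [this]
  ring

theorem ofReal_sq_eq_enorm_sq (y : ℝ) : ENNReal.ofReal (y ^ 2) = ‖y‖ₑ ^ 2 := by
  rw [← sq_abs, ENNReal.ofReal_pow (abs_nonneg y), ← Real.enorm_eq_ofReal_abs]

variable (ρ : Measure ℝ)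

/-- No finiteness of the second moment is needed: Fatou's lemma gives one inequality, and the
integrands are bounded by their limit. -/
theorem tendsto_lintegral_two_mul_one_sub_cos_div :
    Tendsto (fun x : ℝ => ∫⁻ y, ENNReal.ofReal (2 * (1 - Real.cos (x * y)) / x ^ 2) ∂ρ) (𝓝[≠] 0)
      (𝓝 (∫⁻ y, ‖y‖ₑ ^ 2 ∂ρ)) := by
  refine tendsto_of_le_liminf_of_limsup_le ?_ ?_
  · refine le_trans (lintegral_mono fun y => ?_) (lintegral_liminf_le fun x => by fun_prop)
    rw [← ofReal_sq_eq_enorm_sq]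
    exact ((ENNReal.tendsto_ofReal (tendsto_two_mul_one_sub_cos_div y)).liminf_eq).ge
  · refine limsup_le_of_le (h := Eventually.of_forall fun x => lintegral_mono fun y => ?_)
    rw [← ofReal_sq_eq_enorm_sq]
    exact ENNReal.ofReal_le_ofReal (two_mul_one_sub_cos_div_le x y)

variable {ρ}

theorem integrable_min_one_sq (hρ : ∫⁻ x, ENNReal.ofReal (min 1 (x ^ 2)) ∂ρ < ∞) :
    Integrable (fun x : ℝ => min 1 (x ^ 2)) ρ := by
  refine ⟨by fun_prop, ?_⟩
  rwa [hasFiniteIntegral_iff_ofReal]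
  exact ae_of_all _ fun x => le_min zero_le_one (sq_nonneg x)

theorem integrable_two_mul_one_sub_cos (hρ : ∫⁻ x, ENNReal.ofReal (min 1 (x ^ 2)) ∂ρ < ∞)
    (x : ℝ) : Integrable (fun y : ℝ => 2 * (1 - Real.cos (x * y))) ρ := by
  refine ((integrable_min_one_sq hρ).const_mul (4 + x ^ 2)).mono' (by fun_prop)
    (ae_of_all _ fun y => ?_)
  have h1 := Real.cos_le_one (x * y)
  have h2 := Real.neg_one_le_cos (x * y)
  have h3 := Real.one_sub_sq_div_two_le_cos (x := x * y)
  rw [Real.norm_of_nonneg (by linarith)]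
  rcases min_choice 1 (y ^ 2) with h | h <;> rw [h] <;> nlinarith [sq_nonneg x, sq_nonneg y]

theorem ofReal_integral_two_mul_one_sub_cos_div
    (hρ : ∫⁻ x, ENNReal.ofReal (min 1 (x ^ 2)) ∂ρ < ∞) (x : ℝ) :
    ENNReal.ofReal ((∫ y, 2 * (1 - Real.cos (x * y)) ∂ρ) / x ^ 2) =
      ∫⁻ y, ENNReal.ofReal (2 * (1 - Real.cos (x * y)) / x ^ 2) ∂ρ := by
  rw [← integral_div, ofReal_integral_eq_lintegral_ofReal
    ((integrable_two_mul_one_sub_cos hρ x).div_const _)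
    (ae_of_all _ fun y => two_mul_one_sub_cos_div_nonneg x y)]

theorem integral_two_mul_one_sub_cos_div_nonneg (x : ℝ) :
    0 ≤ (∫ y, 2 * (1 - Real.cos (x * y)) ∂ρ) / x ^ 2 := by
  rw [← integral_div]
  exact integral_nonneg fun y => two_mul_one_sub_cos_div_nonneg x y

/-- A Lévy measure has a finite second moment as soon as the quotients converge. -/
theorem lintegral_enorm_sq_eq_of_tendsto (hρ : ∫⁻ x, ENNReal.ofReal (min 1 (x ^ 2)) ∂ρ < ∞)
    {c : ℝ} (h : Tendsto (fun x : ℝ => (∫ y, 2 * (1 - Real.cos (x * y)) ∂ρ) / x ^ 2) (𝓝[≠] 0)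
      (𝓝 c)) : ∫⁻ y, ‖y‖ₑ ^ 2 ∂ρ = ENNReal.ofReal c := by
  refine tendsto_nhds_unique (tendsto_lintegral_two_mul_one_sub_cos_div ρ) ?_
  simpa only [ofReal_integral_two_mul_one_sub_cos_div hρ] using ENNReal.tendsto_ofReal h

theorem tendsto_integral_two_mul_one_sub_cos_div
    (hρ : ∫⁻ x, ENNReal.ofReal (min 1 (x ^ 2)) ∂ρ < ∞) (hB : ∫⁻ y, ‖y‖ₑ ^ 2 ∂ρ ≠ ∞) :
    Tendsto (fun x : ℝ => (∫ y, 2 * (1 - Real.cos (x * y)) ∂ρ) / x ^ 2) (𝓝[≠] 0)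
      (𝓝 (∫⁻ y, ‖y‖ₑ ^ 2 ∂ρ).toReal) := by
  have h := (ENNReal.tendsto_toReal hB).comp (tendsto_lintegral_two_mul_one_sub_cos_div ρ)
  refine h.congr fun x => ?_
  rw [Function.comp_apply, ← ofReal_integral_two_mul_one_sub_cos_div hρ,
    ENNReal.toReal_ofReal (integral_two_mul_one_sub_cos_div_nonneg x)]

/-- At infinity the jump part is of smaller order than `x²`; this isolates the Gaussian part. -/
theorem tendsto_integral_two_mul_one_sub_cos_div_atTop (hB : ∫⁻ y, ‖y‖ₑ ^ 2 ∂ρ ≠ ∞) :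
    Tendsto (fun x : ℝ => (∫ y, 2 * (1 - Real.cos (x * y)) ∂ρ) / x ^ 2) atTop (𝓝 0) := by
  simp_rw [← integral_div]
  rw [← integral_zero ℝ ℝ (μ := ρ)]
  refine tendsto_integral_filter_of_dominated_convergence (fun y => y ^ 2)
    (Eventually.of_forall fun x => by fun_prop)
    (Eventually.of_forall fun x => ae_of_all _ fun y => ?_) ⟨by fun_prop, ?_⟩
    (ae_of_all _ fun y => ?_)
  · rw [Real.norm_of_nonneg (two_mul_one_sub_cos_div_nonneg x y)]
    exact two_mul_one_sub_cos_div_le x y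
  · rw [hasFiniteIntegral_iff_ofReal (ae_of_all _ fun y => sq_nonneg y)]
    simp_rw [ofReal_sq_eq_enorm_sq]
    exact hB.lt_top
  · refine squeeze_zero (fun x => two_mul_one_sub_cos_div_nonneg x y) (g := fun x => 4 / x ^ 2)
      (fun x => ?_) ?_
    · gcongr
      linarith [Real.neg_one_le_cos (x * y)]
    · exact Tendsto.const_div_atTop (tendsto_pow_atTop two_ne_zero) 4

variable {Ω : Type*} [MeasurableSpace Ω] {P : Measure Ω} [IsProbabilityMeasure P]

/-- The variance is read off from the modulus of the characteristic function. -/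
theorem tendsto_neg_log_norm_charFun_div {X : Ω → ℝ} (hX : MemLp X 2 P) (h0 : P[X] = 0) :
    Tendsto (fun x : ℝ => -Real.log (‖charFun (P.map X) x‖ ^ 2) / x ^ 2) (𝓝[≠] 0)
      (𝓝 (P[X ^ 2])) := by
  have hXm : AEMeasurable X P := hX.aestronglyMeasurable.aemeasurable
  have hint : MemLp id 2 (P.map X) := (memLp_map_measure_iff aestronglyMeasurable_id hXm).2 hX
  have : IsProbabilityMeasure (P.map X) := Measure.isProbabilityMeasure_map hXm
  set σ : ℝ := P[X ^ 2] with hσ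
  set r : ℝ → ℂ := fun x => charFun (P.map X) x - (1 - σ * x ^ 2 / 2 : ℝ) with hr
  have hro : r =o[𝓝 0] fun x : ℝ => x ^ 2 := by
    have h := taylor_isLittleO_univ (x₀ := 0) (contDiff_charFun hint)
    simp_rw [taylorWithinEval_charFun_two_zero hXm hint, h0] at h
    refine (h.congr (fun x => ?_) fun x => ?_)
    · simp only [hr]
      push_cast
      ring
    · simp
  have hx2 : Tendsto (fun x : ℝ => x ^ 2) (𝓝 0) (𝓝 0) := by
    simpa using (continuous_pow 2).tendsto (0 : ℝ)
  have hr0 : Tendsto r (𝓝 0) (𝓝 0) := hro.trans_tendsto hx2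
  -- the squared modulus is `1 - σ x² + o(x²)`
  have hz : (fun x : ℝ => ‖charFun (P.map X) x‖ ^ 2 - 1 + σ * x ^ 2) =o[𝓝 0]
      fun x : ℝ => x ^ 2 := by
    have hexp : ∀ x : ℝ, ‖charFun (P.map X) x‖ ^ 2 - 1 + σ * x ^ 2 =
        (σ ^ 2 / 4 * x ^ 2) * x ^ 2 + ((2 - σ * x ^ 2) * (r x).re + ‖r x‖ * ‖r x‖) := by
      intro x
      have h1 : charFun (P.map X) x = (1 - σ * x ^ 2 / 2 : ℝ) + r x := by simp [hr]
      rw [h1, ← sq ‖r x‖, ← Complex.normSq_eq_norm_sq, ← Complex.normSq_eq_norm_sq,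
        Complex.normSq_apply, Complex.normSq_apply]
      simp only [Complex.add_re, Complex.add_im, Complex.ofReal_re, Complex.ofReal_im]
      ring
    simp_rw [hexp]
    have hre : (fun x => (r x).re) =o[𝓝 0] fun x : ℝ => x ^ 2 :=
      (Asymptotics.isBigO_of_le _ fun x => Complex.abs_re_le_norm (r x)).trans_isLittleO hro
    refine Asymptotics.IsLittleO.add ?_ (Asymptotics.IsLittleO.add ?_ ?_)
    · have h1 : (fun x : ℝ => σ ^ 2 / 4 * x ^ 2) =o[𝓝 0] fun _ => (1 : ℝ) := by
        rw [Asymptotics.isLittleO_one_iff]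
        simpa using hx2.const_mul (σ ^ 2 / 4)
      simpa using h1.mul_isBigO (Asymptotics.isBigO_refl (fun x : ℝ => x ^ 2) (𝓝 0))
    · have h1 : (fun x : ℝ => 2 - σ * x ^ 2) =O[𝓝 0] fun _ => (1 : ℝ) :=
        (by fun_prop : Continuous fun x : ℝ => 2 - σ * x ^ 2).continuousAt.isBigO_one ℝ
      simpa using h1.mul_isLittleO hre
    · have h1 : (fun x : ℝ => ‖r x‖) =o[𝓝 0] fun _ => (1 : ℝ) := by
        rw [Asymptotics.isLittleO_one_iff]
        simpa using hr0.norm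
      simpa using h1.mul_isBigO hro.norm_left.isBigO
  have hzO : (fun x : ℝ => ‖charFun (P.map X) x‖ ^ 2 - 1) =O[𝓝 0] fun x : ℝ => x ^ 2 := by
    have h := hz.isBigO.sub (Asymptotics.isBigO_const_mul_self σ (fun x : ℝ => x ^ 2) (𝓝 0))
    simpa using h
  have hz1 : Tendsto (fun x : ℝ => ‖charFun (P.map X) x‖ ^ 2) (𝓝 0) (𝓝 1) := by
    have := (hzO.trans_tendsto hx2).add_const 1
    simpa using this
  -- compose with the linear approximation of the logarithm at `1`
  have hlog : (fun z : ℝ => Real.log z - (z - 1)) =o[𝓝 1] fun z => z - 1 := by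
    have h := (Real.hasDerivAt_log one_ne_zero).isLittleO
    simpa using h
  have hl := (hlog.comp_tendsto hz1).trans_isBigO hzO
  have hsum := (hl.add hz).tendsto_div_nhds_zero.mono_left (nhdsWithin_le_nhds (s := {0}ᶜ))
  have := hsum.const_sub σ
  rw [sub_zero] at this
  refine this.congr' ?_
  filter_upwards [self_mem_nhdsWithin] with x hx
  have hx : x ≠ 0 := hx
  simp only [Function.comp_apply]
  field_simp
  ring

end SecondMoments

/-! ### Second moments of a cylindrical Lévy process -/

section CylindricalLevyProcess

variable {Ω : Type*} [mΩ : MeasurableSpace Ω] {P : Measure Ω}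
  {U : Type*} [NormedAddCommGroup U] [InnerProductSpace ℝ U]
  {L : ℝ≥0 → U →ₗ[ℝ] (Ω →ₘ[P] ℝ)}

theorem coeFn_map_smul (Y : U →ₗ[ℝ] (Ω →ₘ[P] ℝ)) (c : ℝ) (u : U) :
    (Y (c • u) : Ω → ℝ) =ᵐ[P] fun ω => c * Y u ω := by
  rw [map_smul]
  exact AEEqFun.coeFn_smul c (Y u)

theorem IsCylindricalLevy.zero_ae (hL : IsCylindricalLevy L) (u : U) :
    (L 0 u : Ω → ℝ) =ᵐ[P] 0 := by
  filter_upwards [(hL.levy 1 fun _ => u).zero] with ω hω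
  exact congrFun hω 0

theorem IsCylindricalLevy.identDistrib (hL : IsCylindricalLevy L) {s t : ℝ≥0} (hst : s ≤ t)
    (u : U) : IdentDistrib (fun ω => L t u ω - L s u ω) (L (t - s) u) P P :=
  ((hL.levy 1 fun _ => u).stationary s t hst).comp (measurable_pi_apply (0 : Fin 1))

theorem IsCylindricalLevy.memLp (hL : IsCylindricalLevy L) (hmom : ∀ u, MemLp (L 1 u) 2 P)
    (hmart : ∀ u, Martingale (fun t ω => L t u ω) (cylFiltration L) P) (t : ℝ≥0) (u : U) :
    MemLp (L t u) 2 P := by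
  -- integer times by stationarity, the others by conditioning on a later integer time
  have hnat : ∀ n : ℕ, MemLp (L n u) 2 P := by
    intro n
    induction n with
    | zero =>
      rw [Nat.cast_zero]
      exact (memLp_congr_ae (hL.zero_ae u)).2 MemLp.zero'
    | succ n ih =>
      have h := (hL.identDistrib (show (n : ℝ≥0) ≤ (n + 1 : ℕ) by simp) u).memLp_iff (p := 2)
      have h1 : ((n + 1 : ℕ) : ℝ≥0) - n = 1 := by simp
      rw [h1] at h
      have h2 := (h.2 (hmom u)).add ih
      refine (memLp_congr_ae (ae_of_all _ fun ω => ?_)).1 h2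
      simp
  obtain ⟨n, hn⟩ := exists_nat_ge t
  exact (memLp_congr_ae ((hmart u).condExp_ae_eq hn)).1 ((hnat n).condExp one_le_two)

variable {p : U → ℝ} {q : QuadraticForm ℝ U} {ν : CylindricalMeasure U}

/-- The integrand of the Lévy-Khintchine formula is integrable, so its integral is not a junk
value. -/
theorem integrable_levyKhintchine {ρ : Measure ℝ}
    (hρ : ∫⁻ x, ENNReal.ofReal (min 1 (x ^ 2)) ∂ρ < ∞) :
    Integrable (fun x : ℝ => Complex.exp (Complex.I * x) - 1
      - Complex.I * x * (Set.Icc (-1 : ℝ) 1).indicator (fun _ => (1 : ℂ)) x) ρ := by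
  have hm : Measurable ((Set.Icc (-1 : ℝ) 1).indicator (fun _ => (1 : ℂ))) :=
    measurable_const.indicator measurableSet_Icc
  refine ((integrable_min_one_sq hρ).const_mul 2).mono'
    (by fun_prop) (ae_of_all _ fun x => ?_)
  by_cases hx : x ∈ Set.Icc (-1 : ℝ) 1
  · have hx1 : |x| ≤ 1 := abs_le.2 hx
    have hx2 : x ^ 2 ≤ 1 := by rwa [sq_le_one_iff_abs_le_one]
    have h1 : ‖Complex.I * x‖ = |x| := by simp
    rw [indicator_of_mem hx, mul_one, min_eq_right hx2]
    refine (Complex.norm_exp_sub_one_sub_id_le (h1.trans_le hx1)).trans ?_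
    rw [h1, sq_abs]
    nlinarith [sq_nonneg x]
  · have hx2 : 1 ≤ x ^ 2 := by
      rw [one_le_sq_iff_one_le_abs]
      by_contra! h
      exact hx (abs_le.1 h.le)
    rw [indicator_of_notMem hx, mul_zero, sub_zero, min_eq_left hx2, mul_comm]
    refine (norm_sub_le _ _).trans ?_
    rw [Complex.norm_exp_ofReal_mul_I, norm_one]
    norm_num

/-- The modulus of the characteristic function of `L t u` is free of the drift and of the truncation
term. -/
theorem IsCharacteristics.norm_charFun_sq (h : IsCharacteristics L p q ν) (t : ℝ≥0) (u : U)
    (x : ℝ) : ‖MeasureTheory.charFun (P.map (L t u)) x‖ ^ 2 =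
      Real.exp (-(t * (x ^ 2 * q u + ∫ y, 2 * (1 - Real.cos (x * y)) ∂(ν.proj u)))) := by
  have hmeas : AEMeasurable (L t u) P := (L t u).aemeasurable
  have h1 : MeasureTheory.charFun (P.map (L t u)) x =
      ∫ ω, Complex.exp (Complex.I * (L t (x • u) ω : ℝ)) ∂P := by
    rw [charFun_apply_real, integral_map hmeas (by fun_prop)]
    refine integral_congr_ae ?_
    filter_upwards [coeFn_map_smul (L t) x u] with ω hω
    rw [hω]
    push_cast
    ring_nf
  have hint := integrable_levyKhintchine (h.levy (x • u))
  have h2 : (∫ y : ℝ, (Complex.exp (Complex.I * y) - 1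
      - Complex.I * y * (Set.Icc (-1 : ℝ) 1).indicator (fun _ => (1 : ℂ)) y)
        ∂(ν.proj (x • u))).re = ∫ y, (Real.cos (x * y) - 1) ∂(ν.proj u) := by
    refine (integral_re hint).symm.trans ?_
    rw [ν.proj_smul, integral_map (by fun_prop)]
    · refine integral_congr_ae (ae_of_all _ fun y => ?_)
      have hind : ∃ b : ℝ, (Set.Icc (-1 : ℝ) 1).indicator (fun _ => (1 : ℂ)) (x * y) = b := by
        by_cases hy : x * y ∈ Set.Icc (-1 : ℝ) 1
        · exact ⟨1, by rw [indicator_of_mem hy, Complex.ofReal_one]⟩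
        · exact ⟨0, by rw [indicator_of_notMem hy, Complex.ofReal_zero]⟩
      obtain ⟨b, hb⟩ := hind
      have e1 : (Complex.exp (Complex.I * (x * y : ℝ))).re = Real.cos (x * y) := by
        rw [mul_comm, Complex.exp_ofReal_mul_I_re]
      have e2 : (Complex.I * (x * y : ℝ) * (b : ℂ)).re = 0 := by
        rw [mul_assoc, ← Complex.ofReal_mul, mul_comm, Complex.re_ofReal_mul, Complex.I_re,
          mul_zero]
      simp only [hb, RCLike.re_eq_complex_re]
      rw [Complex.sub_re, Complex.sub_re, e1, e2, Complex.one_re, sub_zero]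
    · rw [← ν.proj_smul]
      exact hint.re.aestronglyMeasurable
  rw [h1, h.charFun, Complex.norm_exp, ← Real.exp_nat_mul]
  congr 1
  have h3 : ∫ y, 2 * (1 - Real.cos (x * y)) ∂(ν.proj u) =
      -2 * ∫ y, (Real.cos (x * y) - 1) ∂(ν.proj u) := by
    rw [← integral_const_mul]
    congr 1
    funext y
    ring
  have hq : q (x • u) = x ^ 2 * q u := by rw [QuadraticMap.map_smul, smul_eq_mul, sq]
  rw [Complex.re_ofReal_mul, Complex.add_re, h2, h3, hq]
  have h4 : (Complex.I * (p (x • u) : ℂ) - 1 / 2 * ((x ^ 2 * q u : ℝ) : ℂ)).re =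
      -(1 / 2) * (x ^ 2 * q u) := by
    have : (1 / 2 : ℂ) = ((1 / 2 : ℝ) : ℂ) := by norm_num
    have h0 : (Complex.I * (p (x • u) : ℂ)).re = 0 := by
      rw [mul_comm, Complex.re_ofReal_mul, Complex.I_re, mul_zero]
    rw [Complex.sub_re, this, Complex.re_ofReal_mul, Complex.ofReal_re, h0]
    ring
  rw [h4]
  push_cast
  ring

variable [IsProbabilityMeasure P]

theorem IsCylindricalLevy.integral_eq_zero (hL : IsCylindricalLevy L)
    (hmart : ∀ u, Martingale (fun t ω => L t u ω) (cylFiltration L) P) (t : ℝ≥0) (u : U) :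
    ∫ ω, L t u ω ∂P = 0 := by
  have h := (hmart u).setIntegral_eq (zero_le : (0 : ℝ≥0) ≤ t) MeasurableSet.univ
  rw [setIntegral_univ, setIntegral_univ] at h
  rw [← h, integral_congr_ae (hL.zero_ae u)]
  simp

/-- The variance of `L 1 u`: the sum of a Gaussian and of a jump part. -/
noncomputable def unitVariance (q : QuadraticForm ℝ U) (ν : CylindricalMeasure U) (u : U) : ℝ :=
  q u + (ν.secondMoment u).toReal

/-- The second moment of `L t u` in terms of the characteristics, before it is known that the second
moment of the Lévy measure is finite. -/
theorem IsCharacteristics.tendsto_second_moment (h : IsCharacteristics L p q ν)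
    (hL : IsCylindricalLevy L) (hmom : ∀ u, MemLp (L 1 u) 2 P)
    (hmart : ∀ u, Martingale (fun t ω => L t u ω) (cylFiltration L) P) (t : ℝ≥0) (u : U) :
    Tendsto (fun x : ℝ => t * (q u + (∫ y, 2 * (1 - Real.cos (x * y)) ∂(ν.proj u)) / x ^ 2))
      (𝓝[≠] 0) (𝓝 (∫ ω, L t u ω ^ 2 ∂P)) := by
  refine (tendsto_neg_log_norm_charFun_div (hL.memLp hmom hmart t u)
    (hL.integral_eq_zero hmart t u)).congr' ?_
  filter_upwards [self_mem_nhdsWithin] with x hx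
  have hx : x ≠ 0 := hx
  rw [h.norm_charFun_sq, Real.log_exp]
  field_simp

/-- Square integrability of `L 1 u` is inherited by its Lévy measure. -/
theorem IsCharacteristics.secondMoment_ne_top (h : IsCharacteristics L p q ν)
    (hL : IsCylindricalLevy L) (hmom : ∀ u, MemLp (L 1 u) 2 P)
    (hmart : ∀ u, Martingale (fun t ω => L t u ω) (cylFiltration L) P) (u : U) :
    ν.secondMoment u ≠ ∞ := by
  have h1 := (h.tendsto_second_moment hL hmom hmart 1 u).sub_const (q u)
  simp only [NNReal.coe_one, one_mul, add_sub_cancel_left] at h1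
  rw [CylindricalMeasure.secondMoment, lintegral_enorm_sq_eq_of_tendsto (h.levy u) h1]
  exact ENNReal.ofReal_ne_top

/-- `E |L t u|² = t (q u + ∫ ⟪a, u⟫² ν(da))`. -/
theorem IsCharacteristics.integral_sq (h : IsCharacteristics L p q ν)
    (hL : IsCylindricalLevy L) (hmom : ∀ u, MemLp (L 1 u) 2 P)
    (hmart : ∀ u, Martingale (fun t ω => L t u ω) (cylFiltration L) P) (t : ℝ≥0) (u : U) :
    ∫ ω, L t u ω ^ 2 ∂P = t * unitVariance q ν u :=
  tendsto_nhds_unique (h.tendsto_second_moment hL hmom hmart t u)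
    (((tendsto_integral_two_mul_one_sub_cos_div (h.levy u)
      (h.secondMoment_ne_top hL hmom hmart u)).const_add (q u)).const_mul (t : ℝ))

/-- The Gaussian part is nonnegative: it is the limit of `-x⁻² log |φ(x)|²` at infinity. -/
theorem IsCharacteristics.quadraticForm_nonneg (h : IsCharacteristics L p q ν)
    (hL : IsCylindricalLevy L) (hmom : ∀ u, MemLp (L 1 u) 2 P)
    (hmart : ∀ u, Martingale (fun t ω => L t u ω) (cylFiltration L) P) (u : U) : 0 ≤ q u := by
  have hlim := (tendsto_integral_two_mul_one_sub_cos_div_atTop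
    (h.secondMoment_ne_top hL hmom hmart u)).const_add (q u)
  rw [add_zero] at hlim
  refine ge_of_tendsto hlim ?_
  filter_upwards [eventually_gt_atTop 0] with x hx
  have hprob : IsProbabilityMeasure (P.map (L 1 u)) :=
    Measure.isProbabilityMeasure_map (L 1 u).aemeasurable
  have h1 : ‖MeasureTheory.charFun (P.map (L 1 u)) x‖ ^ 2 ≤ 1 :=
    pow_le_one₀ (norm_nonneg _) (norm_charFun_le_one x)
  rw [h.norm_charFun_sq, NNReal.coe_one, one_mul, Real.exp_le_one_iff, neg_nonpos] at h1
  have h2 := div_nonneg h1 (sq_nonneg x)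
  rwa [add_div, mul_div_cancel_left₀ _ (by positivity)] at h2

theorem IsCharacteristics.integral_sub_sq (h : IsCharacteristics L p q ν)
    (hL : IsCylindricalLevy L) (hmom : ∀ u, MemLp (L 1 u) 2 P)
    (hmart : ∀ u, Martingale (fun t ω => L t u ω) (cylFiltration L) P) {s t : ℝ≥0} (hst : s ≤ t)
    (u : U) : ∫ ω, (L t u ω - L s u ω) ^ 2 ∂P = (t - s) * unitVariance q ν u := by
  have h1 := ((hL.identDistrib hst u).comp (u := fun x : ℝ => x ^ 2) (by fun_prop)).integral_eq
  have h2 := h.integral_sq hL hmom hmart (t - s) u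
  rw [NNReal.coe_sub hst] at h2
  exact h1.trans h2

end CylindricalLevyProcess

/-! ### Increments are independent of the past -/

section Independence

variable {Ω : Type*} [mΩ : MeasurableSpace Ω] {P : Measure Ω}

/-- If a process has independent increments and starts at `0`, its increments after time `s` are
independent of its values at finitely many times up to `s`. -/
theorem indepFun_finset_sub_of_hasIndepIncrements {E : Type*} [AddCommGroup E] [MeasurableSpace E]
    [MeasurableAdd₂ E] [MeasurableSub₂ E] {X : ℝ≥0 → Ω → E} (hX : HasIndepIncrements X P)
    (hmeas : ∀ t, AEMeasurable (X t) P) (hzero : ∀ᵐ ω ∂P, X 0 ω = 0) {s t : ℝ≥0} (hst : s ≤ t)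
    (I : Finset ℝ≥0) (hI : ∀ r ∈ I, r ≤ s) :
    IndepFun (fun ω (r : I) => X r ω) (fun ω => X t ω - X s ω) P := by
  classical
  -- the times in increasing order, from `0` to `s`, followed by `t`
  set J : Finset ℝ≥0 := insert 0 (insert s I) with hJ
  have hJs : ∀ r ∈ J, r ≤ s := by
    intro r hr
    simp only [hJ, Finset.mem_insert] at hr
    rcases hr with rfl | rfl | hr
    exacts [zero_le, le_rfl, hI r hr]
  have hcard : 0 < J.card := Finset.card_pos.2 ⟨0, Finset.mem_insert_self _ _⟩
  obtain ⟨m, hm⟩ : ∃ m, J.card = m + 1 := ⟨J.card - 1, by omega⟩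
  set o : Fin (m + 1) ↪o ℝ≥0 := J.orderEmbOfFin hm with ho
  have hoJ : ∀ i, o i ∈ J := fun i => Finset.orderEmbOfFin_mem J hm i
  have hsurj : ∀ r ∈ J, ∃ i, o i = r := by
    intro r hr
    have : r ∈ Set.range o := by rw [ho, Finset.range_orderEmbOfFin]; exact hr
    exact this
  have ho0 : o 0 = 0 := by
    obtain ⟨i, hi⟩ := hsurj 0 (Finset.mem_insert_self _ _)
    exact le_antisymm (hi ▸ o.monotone (Fin.zero_le i)) zero_le
  have hos : o (Fin.last m) = s := by
    obtain ⟨i, hi⟩ := hsurj s (by simp [hJ])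
    exact le_antisymm (hJs _ (hoJ _)) (hi ▸ o.monotone (Fin.le_last i))
  set τ : Fin (m + 2) → ℝ≥0 := Fin.snoc o t with hτ
  have hτmono : Monotone τ := by
    rw [Fin.monotone_iff_le_succ]
    intro i
    induction i using Fin.lastCases with
    | last =>
      rw [Fin.succ_last, hτ, Fin.snoc_last, Fin.snoc_castSucc]
      exact (hos.trans_le hst)
    | cast i =>
      rw [hτ, Fin.snoc_castSucc, Fin.succ_castSucc, Fin.snoc_castSucc]
      exact o.monotone (Fin.castSucc_le_succ i)
  have hind := hX (m + 1) τ hτmono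
  have hind2 := hind.indepFun_finset₀ (Finset.univ.erase (Fin.last m)) {Fin.last m}
    (by simp) fun i => (hmeas _).sub (hmeas _)
  -- the value at the `j`-th time is the sum of the previous increments
  have hsum : ∀ᵐ ω ∂P, ∀ j : Fin (m + 1), X (o j) ω =
      ∑ i ∈ Finset.univ.filter (fun i : Fin (m + 1) => i.castSucc < j.castSucc),
        (X (τ i.succ) ω - X (τ i.castSucc) ω) := by
    filter_upwards [hzero] with ω hω j
    induction j using Fin.induction with
    | zero =>
      rw [ho0, hω, Finset.filter_false_of_mem, Finset.sum_empty]
      intro i _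
      simp
    | succ j ih =>
      have h1 : Finset.univ.filter (fun i : Fin (m + 1) => i.castSucc < j.succ.castSucc) =
          insert j.castSucc (Finset.univ.filter fun i : Fin (m + 1) =>
            i.castSucc < j.castSucc.castSucc) := by
        ext i
        simp only [Finset.mem_filter, Finset.mem_univ, true_and, Finset.mem_insert, Fin.ext_iff,
          Fin.lt_def, Fin.val_castSucc, Fin.val_succ]
        omega
      rw [h1, Finset.sum_insert (by simp), ← ih, Fin.succ_castSucc, hτ, Fin.snoc_castSucc,
        Fin.snoc_castSucc, sub_add_cancel]
  choose! idx hidx using hsurj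
  have hIJ : ∀ r ∈ I, r ∈ J := fun r hr => Finset.mem_insert_of_mem (Finset.mem_insert_of_mem hr)
  set Φ : ((Finset.univ.erase (Fin.last m) : Finset (Fin (m + 1))) → E) → I → E :=
    fun y r => ∑ i ∈ Finset.univ.filter
      (fun i : (Finset.univ.erase (Fin.last m) : Finset (Fin (m + 1))) =>
        (i : Fin (m + 1)).castSucc < (idx r).castSucc), y i with hΦ
  have hΦm : Measurable Φ := measurable_pi_lambda _ fun r =>
    Finset.measurable_sum _ fun i _ => measurable_pi_apply i
  have hfin := hind2.comp hΦm
    (measurable_pi_apply (⟨Fin.last m, Finset.mem_singleton_self _⟩ : ({Fin.last m} : Finset _)))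
  refine hfin.congr ?_ (ae_of_all _ fun ω => ?_)
  · filter_upwards [hsum] with ω hω
    funext r
    rw [← hidx r (hIJ r r.2), hω]
    simp only [hΦ, Function.comp_apply]
    refine Finset.sum_bij (fun i _ => (i : Fin (m + 1))) ?_ ?_ ?_ ?_
    · intro i hi
      simpa [hidx r (hIJ r r.2)] using hi
    · intro i _ j _ hij
      exact Subtype.ext hij
    · intro i hi
      simp only [Finset.mem_filter, Finset.mem_univ, true_and] at hi
      refine ⟨⟨i, Finset.mem_erase.2 ⟨?_, Finset.mem_univ _⟩⟩, by simpa using hi, rfl⟩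
      rintro rfl
      exact absurd hi (not_lt.2 (Fin.castSucc_le_castSucc_iff.2 (Fin.le_last _)))
    · intro i _
      rfl
  · simp only [Function.comp_apply]
    rw [Fin.succ_last, hτ, Fin.snoc_last, Fin.snoc_castSucc, hos]

variable {U : Type*} [NormedAddCommGroup U] [InnerProductSpace ℝ U]
  {L : ℝ≥0 → U →ₗ[ℝ] (Ω →ₘ[P] ℝ)}

theorem IsCylindricalLevy.hasIndepIncrements (hL : IsCylindricalLevy L) {κ : Type*} [Fintype κ]
    (u : κ → U) : HasIndepIncrements (fun (t : ℝ≥0) (ω : Ω) (i : κ) => L t (u i) ω) P := by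
  let e := Fintype.equivFin κ
  have h := (hL.levy _ (u ∘ e.symm)).indep.map'
    (f := AddMonoidHom.mk' (fun (y : Fin (Fintype.card κ) → ℝ) (i : κ) => y (e i))
      fun _ _ => rfl) (measurable_pi_lambda _ fun i => measurable_pi_apply _)
  simpa using h

/-- The increments after time `s` are independent of the whole family `L r w`, `r ≤ s`. -/
theorem IsCylindricalLevy.indepFun_process (hL : IsCylindricalLevy L) {s t : ℝ≥0} (hst : s ≤ t)
    (u : U) : IndepFun (fun ω (i : Set.Iic s × U) => L i.1 i.2 ω)
      (fun ω => L t u ω - L s u ω) P := by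
  classical
  -- independence of a single random variable forces `P` to be a probability measure
  have hL' := (hL.levy 0 Fin.elim0).indep 0 (fun _ => 0) monotone_const
  have := hL'.isProbabilityMeasure
  refine IndepFun.process_indepFun₀ (fun i => (L i.1 i.2).aemeasurable)
    ((L t u).aemeasurable.sub (L s u).aemeasurable) fun I => ?_
  -- the Lévy process formed by `u` and by the vectors that occur in `I`
  set v : Option I → U := fun o => o.elim u fun i => (i : Set.Iic s × U).2 with hv
  have h := indepFun_finset_sub_of_hasIndepIncrements (hL.hasIndepIncrements v)
    (fun t => (measurable_pi_lambda _ fun i => (L t (v i)).measurable).aemeasurable)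
    (by
      filter_upwards [ae_all_iff.2 fun i => hL.zero_ae (v i)] with ω hω
      exact funext hω) hst (I.image fun i => (i.1 : ℝ≥0)) (by
      intro r hr
      obtain ⟨i, _, rfl⟩ := Finset.mem_image.1 hr
      exact i.1.2)
  exact h.comp
    (φ := fun y (i : I) => y ⟨((i : Set.Iic s × U).1 : ℝ≥0),
      Finset.mem_image_of_mem (fun i : Set.Iic s × U => (i.1 : ℝ≥0)) i.2⟩ (some i))
    (ψ := fun y : Option I → ℝ => y none)
    (measurable_pi_lambda _ fun i => (measurable_pi_apply (some i)).comp (measurable_pi_apply _))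
    (measurable_pi_apply (X := fun _ : Option I => ℝ) none)

/-- Up to null sets, the events of the filtration are events of the process. -/
theorem exists_ae_eq_of_measurableSet_cylFiltration {s : ℝ≥0} {A : Set Ω}
    (hA : MeasurableSet[cylFiltration L s] A) :
    ∃ S : Set (Set.Iic s × U → ℝ), MeasurableSet S ∧
      A =ᵐ[P] (fun ω (i : Set.Iic s × U) => L i.1 i.2 ω) ⁻¹' S := by
  have hle : cylFiltration L s ≤ eventuallyMeasurableSpace
      (MeasurableSpace.comap (fun ω (i : Set.Iic s × U) => L i.1 i.2 ω) inferInstance) (ae P) := by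
    refine MeasurableSpace.generateFrom_le ?_
    rintro B ⟨_, r, hr, u, C, hC, hBC⟩
    refine ⟨_, ⟨(fun y => y (⟨r, hr⟩, u)) ⁻¹' C, measurable_pi_apply _ hC, rfl⟩, hBC⟩
  obtain ⟨_, ⟨S, hS, rfl⟩, h⟩ := hle A hA
  exact ⟨S, hS, h⟩

theorem IsCylindricalLevy.indep_cylFiltration (hL : IsCylindricalLevy L) {s t : ℝ≥0}
    (hst : s ≤ t) (u : U) :
    Indep (MeasurableSpace.comap (fun ω => L t u ω - L s u ω) inferInstance)
      (cylFiltration L s) P := by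
  rw [Indep_iff]
  rintro _ A ⟨B, hB, rfl⟩ hA
  obtain ⟨S, hS, hAS⟩ := exists_ae_eq_of_measurableSet_cylFiltration hA
  have h := (hL.indepFun_process hst u).measure_inter_preimage_eq_mul S B hS hB
  rw [measure_congr hAS, measure_congr ((ae_eq_refl _).inter hAS), inter_comm, h, mul_comm]

variable [IsProbabilityMeasure P] {p : U → ℝ} {q : QuadraticForm ℝ U} {ν : CylindricalMeasure U}

theorem IsCharacteristics.setIntegral_sub_sq (h : IsCharacteristics L p q ν)
    (hL : IsCylindricalLevy L) (hmom : ∀ u, MemLp (L 1 u) 2 P)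
    (hmart : ∀ u, Martingale (fun t ω => L t u ω) (cylFiltration L) P) {s t : ℝ≥0} (hst : s ≤ t)
    {A : Set Ω} (hA : MeasurableSet[cylFiltration L s] A) (u : U) :
    ∫ ω in A, (L t u ω - L s u ω) ^ 2 ∂P = P.real A * ((t - s) * unitVariance q ν u) := by
  have hm : Measurable fun ω => L t u ω - L s u ω := (L t u).measurable.sub (L s u).measurable
  have hint : Integrable (fun ω => (L t u ω - L s u ω) ^ 2) P :=
    ((hL.memLp hmom hmart t u).sub (hL.memLp hmom hmart s u)).integrable_sq
  have hc := condExp_indep_eq hm.comap_le ((cylFiltration L).le s)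
    (f := fun ω => (L t u ω - L s u ω) ^ 2)
    ((measurable_id.pow_const 2).comp (comap_measurable _)).stronglyMeasurable
    (hL.indep_cylFiltration hst u)
  rw [← setIntegral_condExp ((cylFiltration L).le s) hint hA,
    integral_congr_ae (ae_restrict_of_ae hc), setIntegral_const, smul_eq_mul,
    h.integral_sub_sq hL hmom hmart hst]

/-- The martingale property: increments are orthogonal to the square integrable variables that
are measurable with respect to the past. -/
theorem IsCylindricalLevy.integral_mul_sub_eq_zero (hL : IsCylindricalLevy L)
    (hmom : ∀ u, MemLp (L 1 u) 2 P)
    (hmart : ∀ u, Martingale (fun t ω => L t u ω) (cylFiltration L) P) {s t : ℝ≥0} (hst : s ≤ t)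
    (u : U) {ξ : Ω → ℝ} (hξ : MemLp ξ 2 P) (hξm : AEStronglyMeasurable[cylFiltration L s] ξ P) :
    ∫ ω, ξ ω * (L t u ω - L s u ω) ∂P = 0 := by
  have hΔ := (hL.memLp hmom hmart t u).sub (hL.memLp hmom hmart s u)
  have hpull := condExp_mul_of_aestronglyMeasurable_left (m := cylFiltration L s)
    (f := ξ) (g := fun ω => L t u ω - L s u ω) hξm (hξ.integrable_mul hΔ)
    (hΔ.integrable one_le_two)
  have h0 : P[fun ω => L t u ω - L s u ω | cylFiltration L s] =ᵐ[P] 0 := by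
    have h1 := condExp_sub ((hmart u).integrable t) ((hmart u).integrable s) (cylFiltration L s)
    filter_upwards [h1, (hmart u).condExp_ae_eq hst, (hmart u).condExp_ae_eq le_rfl]
      with ω h1 h2 h3
    refine h1.trans ?_
    rw [Pi.sub_apply, h2, h3, sub_self, Pi.zero_apply]
  have := integral_condExp ((cylFiltration L).le s)
    (f := fun ω => ξ ω * (L t u ω - L s u ω)) (μ := P)
  rw [← this]
  refine integral_eq_zero_of_ae ?_
  filter_upwards [hpull, h0] with ω h1 h2
  refine h1.trans ?_
  rw [Pi.mul_apply, h2, Pi.zero_apply, mul_zero]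

end Independence

/-! ### Composition of Hilbert-Schmidt operators with square integrable families -/

section HilbertSchmidtComposition

variable {U V : Type*} [NormedAddCommGroup U] [InnerProductSpace ℝ U] [CompleteSpace U]
  [NormedAddCommGroup V] [InnerProductSpace ℝ V]

theorem HilbertSchmidt.enorm_sq (φ : HilbertSchmidt U V) :
    ‖φ‖ₑ ^ 2 = ∑' k, ‖φ.toCLM (stdBasis U k)‖ₑ ^ 2 := by
  have hs : Summable fun k => ‖φ.toCLM (stdBasis U k)‖ ^ 2 := by
    have h : Memℓp (fun k => φ.toCLM (stdBasis U k)) 2 := φ.2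
    simpa using (memℓp_gen_iff (by norm_num)).1 h
  rw [← ofReal_norm, ← ENNReal.ofReal_pow (norm_nonneg _), φ.norm_sq,
    ENNReal.ofReal_tsum_of_nonneg (fun i => by positivity) hs]
  simp_rw [ENNReal.ofReal_pow (norm_nonneg _), ofReal_norm]

theorem HilbertSchmidt.toCLM_add (φ ψ : HilbertSchmidt U V) :
    (φ + ψ).toCLM = φ.toCLM + ψ.toCLM := rfl

theorem HilbertSchmidt.toCLM_smul (c : ℝ) (φ : HilbertSchmidt U V) :
    (c • φ).toCLM = c • φ.toCLM := rfl

variable {Ω : Type*} [MeasurableSpace Ω] {P : Measure Ω}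

/-- The isometric embedding `f ↦ f v` of `L²(P)` into `L²(P; V)` for a unit vector `v`. -/
noncomputable def smulUnitVector (P : Measure Ω) {v : V} (hv : ‖v‖ = 1) :
    Lp ℝ 2 P →ₗᵢ[ℝ] Lp V 2 P where
  toLinearMap := ((ContinuousLinearMap.toSpanSingleton ℝ v).compLpL 2 P).toLinearMap
  norm_map' f := by
    rw [Lp.norm_def, Lp.norm_def]
    refine congrArg ENNReal.toReal (eLpNorm_congr_norm_ae ?_)
    filter_upwards [(ContinuousLinearMap.toSpanSingleton ℝ v).coeFn_compLp f] with ω hω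
    refine (congrArg norm hω).trans ?_
    simp [norm_smul, hv]

theorem coeFn_smulUnitVector {v : V} (hv : ‖v‖ = 1) (f : Lp ℝ 2 P) :
    smulUnitVector P hv f =ᵐ[P] fun ω => f ω • v :=
  (ContinuousLinearMap.toSpanSingleton ℝ v).coeFn_compLp f

variable [CompleteSpace V] {E : Type*} [NormedAddCommGroup E] [InnerProductSpace ℝ E]

open ContinuousLinearMap (adjoint)

/-- The Hilbert-Schmidt norms of `φ` and of its adjoint agree. -/
theorem HilbertSchmidt.tsum_enorm_adjoint_sq (φ : HilbertSchmidt U V) :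
    ∑' k, ‖adjoint φ.toCLM (stdBasis V k)‖ₑ ^ 2 = ‖φ‖ₑ ^ 2 := by
  rw [φ.enorm_sq]
  simp_rw [enorm_sq_eq_tsum (stdBasis U), enorm_sq_eq_tsum (stdBasis V)]
  rw [ENNReal.tsum_comm]
  refine tsum_congr fun j => tsum_congr fun k => ?_
  rw [ContinuousLinearMap.adjoint_inner_left, real_inner_comm]

theorem HilbertSchmidt.tsum_enorm_comp_adjoint_sq_le (Y : U →L[ℝ] E) (φ : HilbertSchmidt U V) :
    ∑' k, ‖Y (adjoint φ.toCLM (stdBasis V k))‖ₑ ^ 2 ≤ ‖Y‖ₑ ^ 2 * ‖φ‖ₑ ^ 2 := by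
  rw [← φ.tsum_enorm_adjoint_sq, ← ENNReal.tsum_mul_left]
  refine ENNReal.tsum_le_tsum fun k => ?_
  rw [← mul_pow]
  gcongr
  exact Y.le_opENorm _

theorem memℓp_two_of_tsum_enorm_sq_ne_top {E : Type*} [NormedAddCommGroup E] {κ : Type*} {x : κ → E}
    (h : ∑' k, ‖x k‖ₑ ^ 2 ≠ ∞) : Memℓp x 2 := by
  refine (memℓp_gen_iff (by norm_num)).2 ?_
  have h1 := ENNReal.summable_toReal h
  refine h1.congr fun k => ?_
  simp

theorem lp_enorm_sq_eq_tsum {E : Type*} [NormedAddCommGroup E] {κ : Type*}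
    (x : lp (fun _ : κ => E) 2) :
    ‖x‖ₑ ^ 2 = ∑' k, ‖x k‖ₑ ^ 2 := by
  have h := lp.hasSum_norm (p := 2) (by norm_num) x
  simp only [ENNReal.toReal_ofNat, Real.rpow_ofNat] at h
  rw [← ofReal_norm, ← ENNReal.ofReal_pow (norm_nonneg _), ← h.tsum_eq,
    ENNReal.ofReal_tsum_of_nonneg (fun i => by positivity) h.summable]
  simp_rw [ENNReal.ofReal_pow (norm_nonneg _), ofReal_norm]

theorem memℓp_comp_adjoint (Y : U →L[ℝ] E) (φ : HilbertSchmidt U V) :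
    Memℓp (fun k => Y (adjoint φ.toCLM (stdBasis V k))) 2 :=
  memℓp_two_of_tsum_enorm_sq_ne_top (ne_top_of_le_ne_top (by finiteness)
    (φ.tsum_enorm_comp_adjoint_sq_le Y))

/-- The bounded linear map `φ ↦ (Y (φ* eₖ))ₖ` from `L₂(U, V)` to `ℓ²(E)`, which identifies `Y φ*`
with a Hilbert-Schmidt operator. -/
noncomputable def compAdjoint (Y : U →L[ℝ] E) :
    HilbertSchmidt U V →L[ℝ] lp (fun _ : basisIndex V => E) 2 :=
  LinearMap.mkContinuous
    { toFun := fun φ => ⟨_, memℓp_comp_adjoint Y φ⟩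
      map_add' := fun φ ψ => by
        ext k
        simp [HilbertSchmidt.toCLM_add]
        rfl
      map_smul' := fun c φ => by
        ext k
        simp [HilbertSchmidt.toCLM_smul] }
    ‖Y‖ fun φ => by
      have h := lp_enorm_sq_eq_tsum (E := E)
          (⟨_, memℓp_comp_adjoint Y φ⟩ : lp (fun _ : basisIndex V => E) 2)
      have h2 := h.trans_le ((φ.tsum_enorm_comp_adjoint_sq_le Y).trans_eq (mul_pow _ _ 2).symm)
      rw [ENNReal.pow_le_pow_left_iff two_ne_zero] at h2
      have h3 := ENNReal.toReal_mono (by finiteness) h2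
      simpa using h3

theorem compAdjoint_apply (Y : U →L[ℝ] E) (φ : HilbertSchmidt U V) (k : basisIndex V) :
    compAdjoint Y φ k = Y (adjoint φ.toCLM (stdBasis V k)) := rfl

theorem enorm_compAdjoint_sq (Y : U →L[ℝ] E) (φ : HilbertSchmidt U V) :
    ‖compAdjoint Y φ‖ₑ ^ 2 = ∑' k, ‖Y (adjoint φ.toCLM (stdBasis V k))‖ₑ ^ 2 :=
  lp_enorm_sq_eq_tsum _

theorem orthogonalFamily_smulUnitVector : OrthogonalFamily ℝ (fun _ : basisIndex V => Lp ℝ 2 P)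
    fun k => smulUnitVector P ((stdBasis V).orthonormal.1 k) := by
  intro i j hij f g
  rw [L2.inner_def]
  refine integral_eq_zero_of_ae ?_
  filter_upwards [coeFn_smulUnitVector ((stdBasis V).orthonormal.1 i) f,
    coeFn_smulUnitVector ((stdBasis V).orthonormal.1 j) g] with ω h1 h2
  rw [h1, h2, real_inner_smul_left, real_inner_smul_right, (stdBasis V).orthonormal.2 hij]
  simp

/-- The random variable `∑ₖ Y(φ* eₖ) eₖ`, which radonifies the cylindrical random variable
`v ↦ Y(φ* v)`. -/
noncomputable def radonify (Y : U →L[ℝ] Lp ℝ 2 P) : HilbertSchmidt U V →L[ℝ] Lp V 2 P :=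
  (orthogonalFamily_smulUnitVector (P := P)).linearIsometry.toContinuousLinearMap ∘L compAdjoint Y

theorem inner_radonify (Y Y' : U →L[ℝ] Lp ℝ 2 P) (φ ψ : HilbertSchmidt U V) :
    ⟪radonify Y φ, radonify Y' ψ⟫_ℝ = ∑' k, ⟪Y (adjoint φ.toCLM (stdBasis V k)),
      Y' (adjoint ψ.toCLM (stdBasis V k))⟫_ℝ := by
  refine ((orthogonalFamily_smulUnitVector (P := P)).linearIsometry.inner_map_map _ _).trans ?_
  exact lp.inner_eq_tsum _ _

theorem inner_radonify_eq_mul {Y Y' Z : U →L[ℝ] Lp ℝ 2 P} {c : ℝ}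
    (h : ∀ u w, ⟪Y u, Y' w⟫_ℝ = c * ⟪Z u, Z w⟫_ℝ) (φ ψ : HilbertSchmidt U V) :
    ⟪radonify Y φ, radonify Y' ψ⟫_ℝ = c * ⟪radonify Z φ, radonify Z ψ⟫_ℝ := by
  simp_rw [inner_radonify, h, tsum_mul_left]

theorem enorm_radonify_sq (Y : U →L[ℝ] Lp ℝ 2 P) (φ : HilbertSchmidt U V) :
    ‖radonify Y φ‖ₑ ^ 2 = ∑' k, ‖Y (adjoint φ.toCLM (stdBasis V k))‖ₑ ^ 2 := by
  rw [← enorm_compAdjoint_sq]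
  congr 1
  exact (orthogonalFamily_smulUnitVector (P := P)).linearIsometry.enorm_map (compAdjoint Y φ)

/-- `radonify Y φ` is the random variable `X_φ` with `⟪X_φ, v⟫ = Y (φ* v)`. -/
theorem inner_radonify_ae_eq (Y : U →L[ℝ] Lp ℝ 2 P) (φ : HilbertSchmidt U V) (v : V) :
    (fun ω => ⟪radonify Y φ ω, v⟫_ℝ) =ᵐ[P] Y (adjoint φ.toCLM v) := by
  set Λ : Lp V 2 P →L[ℝ] Lp ℝ 2 P := (innerSL ℝ v).compLpL 2 P
  have hsum := ((orthogonalFamily_smulUnitVector (P := P)).hasSum_linearIsometry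
    (compAdjoint Y φ)).mapL Λ
  have hterm : ∀ k, Λ (smulUnitVector P ((stdBasis V).orthonormal.1 k) (compAdjoint Y φ k)) =
      (Y ∘L adjoint φ.toCLM) ((stdBasis V).repr v k • stdBasis V k) := by
    intro k
    rw [map_smul, HilbertBasis.repr_apply_apply, ContinuousLinearMap.comp_apply,
      ← compAdjoint_apply]
    refine Lp.ext ?_
    filter_upwards [(innerSL ℝ v).coeFn_compLp (smulUnitVector P
        ((stdBasis V).orthonormal.1 k) (compAdjoint Y φ k)),
      coeFn_smulUnitVector ((stdBasis V).orthonormal.1 k) (compAdjoint Y φ k),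
      Lp.coeFn_smul ⟪stdBasis V k, v⟫_ℝ (compAdjoint Y φ k)] with ω h1 h2 h3
    refine h1.trans ?_
    rw [h2, h3]
    simp [real_inner_comm, mul_comm]
  have hΛ : Λ (radonify Y φ) = Y (adjoint φ.toCLM v) := by
    refine HasSum.unique (hsum.congr_fun fun k => (hterm k).symm) ?_
    exact ((stdBasis V).hasSum_repr v).mapL (Y ∘L adjoint φ.toCLM)
  filter_upwards [(innerSL ℝ v).coeFn_compLp (radonify Y φ)] with ω h1
  rw [← hΛ]
  refine (Eq.trans h1 ?_).symm
  rw [innerSL_apply_apply, real_inner_comm]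

end HilbertSchmidtComposition

/-! ### Covariances of the increments -/

section Covariances

variable {Ω : Type*} [mΩ : MeasurableSpace Ω] {P : Measure Ω}

/-- The product of `f` with the indicator of `A`, as an element of `L²(P)`. -/
noncomputable def indicatorLp {A : Set Ω} (hA : MeasurableSet A) (f : Lp ℝ 2 P) : Lp ℝ 2 P :=
  MemLp.toLp (A.indicator f) ((Lp.memLp f).indicator hA)

theorem coeFn_indicatorLp {A : Set Ω} (hA : MeasurableSet A) (f : Lp ℝ 2 P) :
    indicatorLp hA f =ᵐ[P] A.indicator f :=
  MemLp.coeFn_toLp _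

theorem indicatorLp_add {A : Set Ω} (hA : MeasurableSet A) (f g : Lp ℝ 2 P) :
    indicatorLp hA (f + g) = indicatorLp hA f + indicatorLp hA g := by
  refine Lp.ext ?_
  filter_upwards [coeFn_indicatorLp hA (f + g), coeFn_indicatorLp hA f, coeFn_indicatorLp hA g,
    Lp.coeFn_add f g, Lp.coeFn_add (indicatorLp hA f) (indicatorLp hA g)] with ω h1 h2 h3 h4 h5
  rw [h1, h5, Pi.add_apply, h2, h3]
  by_cases hω : ω ∈ A
  · simp only [indicator_of_mem hω, h4, Pi.add_apply]
  · simp only [indicator_of_notMem hω, add_zero]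

theorem indicatorLp_smul {A : Set Ω} (hA : MeasurableSet A) (c : ℝ) (f : Lp ℝ 2 P) :
    indicatorLp hA (c • f) = c • indicatorLp hA f := by
  refine Lp.ext ?_
  filter_upwards [coeFn_indicatorLp hA (c • f), coeFn_indicatorLp hA f,
    Lp.coeFn_smul c f, Lp.coeFn_smul c (indicatorLp hA f)] with ω h1 h2 h3 h4
  rw [h1, h4, Pi.smul_apply, h2]
  by_cases hω : ω ∈ A
  · simp only [indicator_of_mem hω, h3, Pi.smul_apply]
  · simp only [indicator_of_notMem hω, smul_zero]

theorem norm_indicatorLp_le {A : Set Ω} (hA : MeasurableSet A) (f : Lp ℝ 2 P) :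
    ‖indicatorLp hA f‖ ≤ ‖f‖ := by
  refine Lp.norm_le_norm_of_ae_le ?_
  filter_upwards [coeFn_indicatorLp hA f] with ω h
  rw [h]
  exact norm_indicator_le_norm_self _ _

/-- Multiplication by the indicator of `A` on `L²(P)`. -/
noncomputable def indicatorL (P : Measure Ω) {A : Set Ω} (hA : MeasurableSet A) :
    Lp ℝ 2 P →L[ℝ] Lp ℝ 2 P :=
  LinearMap.mkContinuous
    { toFun := indicatorLp hA
      map_add' := indicatorLp_add hA
      map_smul' := indicatorLp_smul hA } 1 fun f => by
    rw [one_mul]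
    exact norm_indicatorLp_le hA f

theorem coeFn_indicatorL {A : Set Ω} (hA : MeasurableSet A) (f : Lp ℝ 2 P) :
    indicatorL P hA f =ᵐ[P] A.indicator f :=
  coeFn_indicatorLp hA f

theorem inner_indicatorL {A B : Set Ω} (hA : MeasurableSet A) (hB : MeasurableSet B)
    (f g : Lp ℝ 2 P) : ⟪indicatorL P hA f, indicatorL P hB g⟫_ℝ =
      ⟪indicatorL P (hA.inter hB) f, indicatorL P (hA.inter hB) g⟫_ℝ := by
  rw [L2.inner_def, L2.inner_def]
  refine integral_congr_ae ?_
  filter_upwards [coeFn_indicatorL hA f, coeFn_indicatorL hB g,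
    coeFn_indicatorL (hA.inter hB) f, coeFn_indicatorL (hA.inter hB) g] with ω h1 h2 h3 h4
  rw [h1, h2, h3, h4]
  by_cases hωA : ω ∈ A <;> by_cases hωB : ω ∈ B <;> simp [hωA, hωB]

theorem inner_indicatorL_right {B : Set Ω} (hB : MeasurableSet B) (f g : Lp ℝ 2 P) :
    ⟪f, indicatorL P hB g⟫_ℝ = ⟪indicatorL P hB f, g⟫_ℝ := by
  rw [L2.inner_def, L2.inner_def]
  refine integral_congr_ae ?_
  filter_upwards [coeFn_indicatorL hB f, coeFn_indicatorL hB g] with ω h1 h2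
  rw [h1, h2]
  by_cases hωB : ω ∈ B <;> simp [hωB]

variable {U : Type*} [NormedAddCommGroup U] [InnerProductSpace ℝ U] [CompleteSpace U]
  {L : ℝ≥0 → U →ₗ[ℝ] (Ω →ₘ[P] ℝ)}

/-- `L t` as a map into `L²(P)`. It is bounded by the closed graph theorem. -/
noncomputable def levyL2 (hL : IsCylindricalLevy L) (hmem : ∀ t u, MemLp (L t u) 2 P) (t : ℝ≥0) :
    U →L[ℝ] Lp ℝ 2 P :=
  ContinuousLinearMap.ofSeqClosedGraph
    (g := { toFun := fun u => (hmem t u).toLp (L t u)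
            map_add' := fun u v => by
              refine Lp.ext ?_
              filter_upwards [(hmem t (u + v)).coeFn_toLp, (hmem t u).coeFn_toLp,
                (hmem t v).coeFn_toLp,
                Lp.coeFn_add ((hmem t u).toLp (L t u)) ((hmem t v).toLp (L t v)),
                AEEqFun.coeFn_add (L t u) (L t v)] with ω h1 h2 h3 h4 h5
              rw [h1, h4, Pi.add_apply, h2, h3, map_add, h5, Pi.add_apply]
            map_smul' := fun c u => by
              refine Lp.ext ?_
              filter_upwards [(hmem t (c • u)).coeFn_toLp, (hmem t u).coeFn_toLp,
                Lp.coeFn_smul c ((hmem t u).toLp (L t u)), coeFn_map_smul (L t) c u]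
                with ω h1 h2 h3 h4
              rw [h1, RingHom.id_apply, h3, Pi.smul_apply, h2, h4, smul_eq_mul] })
    fun u x y hu hy => by
      refine Lp.ext ?_
      refine EventuallyEq.trans ?_ (hmem t x).coeFn_toLp.symm
      refine tendstoInMeasure_ae_unique (tendstoInMeasure_of_tendsto_Lp hy) ?_
      exact (hL.continuous t u x hu).congr_left fun n => (hmem t (u n)).coeFn_toLp.symm

theorem coeFn_levyL2 (hL : IsCylindricalLevy L) (hmem : ∀ t u, MemLp (L t u) 2 P) (t : ℝ≥0)
    (u : U) : levyL2 hL hmem t u =ᵐ[P] L t u :=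
  (hmem t u).coeFn_toLp

theorem coeFn_levyL2_sub (hL : IsCylindricalLevy L) (hmem : ∀ t u, MemLp (L t u) 2 P)
    (s t : ℝ≥0) (u : U) :
    (levyL2 hL hmem t - levyL2 hL hmem s) u =ᵐ[P] fun ω => L t u ω - L s u ω := by
  filter_upwards [coeFn_levyL2 hL hmem t u, coeFn_levyL2 hL hmem s u,
    Lp.coeFn_sub (levyL2 hL hmem t u) (levyL2 hL hmem s u)] with ω h1 h2 h3
  refine h3.trans ?_
  rw [Pi.sub_apply, h1, h2]

/-- The operator `u ↦ 1_A (L t - L s) u` from `U` to `L²(P)`. -/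
noncomputable def levyIncrement (hL : IsCylindricalLevy L) (hmem : ∀ t u, MemLp (L t u) 2 P)
    (s t : ℝ≥0) {A : Set Ω} (hA : MeasurableSet A) : U →L[ℝ] Lp ℝ 2 P :=
  indicatorL P hA ∘L (levyL2 hL hmem t - levyL2 hL hmem s)

theorem coeFn_levyIncrement (hL : IsCylindricalLevy L) (hmem : ∀ t u, MemLp (L t u) 2 P)
    (s t : ℝ≥0) {A : Set Ω} (hA : MeasurableSet A) (u : U) :
    levyIncrement hL hmem s t hA u =ᵐ[P] A.indicator fun ω => L t u ω - L s u ω := by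
  refine (coeFn_indicatorL hA _).trans ?_
  filter_upwards [coeFn_levyL2_sub hL hmem s t u] with ω h
  by_cases hω : ω ∈ A <;> simp only [indicator_of_mem, indicator_of_notMem, hω, not_false_iff]
  exact h

theorem levyIncrement_add (hL : IsCylindricalLevy L) (hmem : ∀ t u, MemLp (L t u) 2 P)
    (s r t : ℝ≥0) {A : Set Ω} (hA : MeasurableSet A) (u : U) :
    levyIncrement hL hmem s t hA u =
      levyIncrement hL hmem s r hA u + levyIncrement hL hmem r t hA u := by
  rw [levyIncrement, levyIncrement, levyIncrement, ContinuousLinearMap.comp_apply,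
    ContinuousLinearMap.comp_apply, ContinuousLinearMap.comp_apply, ← map_add]
  congr 1
  simp

theorem aestronglyMeasurable_indicator {m : MeasurableSpace Ω} {A : Set Ω}
    (hA : MeasurableSet[m] A) {f : Ω → ℝ} (hf : AEStronglyMeasurable[m] f P) :
    AEStronglyMeasurable[m] (A.indicator f) P :=
  ⟨A.indicator (hf.mk f), hf.stronglyMeasurable_mk.indicator hA, hf.ae_eq_mk.indicator⟩

theorem aestronglyMeasurable_levyIncrement (hL : IsCylindricalLevy L)
    (hmart : ∀ u, Martingale (fun t ω => L t u ω) (cylFiltration L) P)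
    (hmem : ∀ t u, MemLp (L t u) 2 P) {s t r : ℝ≥0} (hsr : s ≤ r) (htr : t ≤ r) {A : Set Ω}
    (hA : MeasurableSet[cylFiltration L r] A) (u : U) :
    AEStronglyMeasurable[cylFiltration L r]
      (levyIncrement hL hmem s t ((cylFiltration L).le r _ hA) u) P := by
  refine AEStronglyMeasurable.congr ?_ (coeFn_levyIncrement hL hmem s t _ u).symm
  refine aestronglyMeasurable_indicator hA ?_
  have h : ∀ r' ≤ r, StronglyMeasurable[cylFiltration L r] fun ω => L r' u ω := fun r' hr' =>
    ((hmart u).stronglyAdapted r').mono ((cylFiltration L).mono hr')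
  exact ((h t htr).sub (h s hsr)).aestronglyMeasurable

variable [IsProbabilityMeasure P] {p : U → ℝ} {q : QuadraticForm ℝ U} {ν : CylindricalMeasure U}

/-- An increment after time `s` is orthogonal to what happened up to time `s`. -/
theorem inner_levyIncrement_eq_zero (hL : IsCylindricalLevy L)
    (hmom : ∀ u, MemLp (L 1 u) 2 P)
    (hmart : ∀ u, Martingale (fun t ω => L t u ω) (cylFiltration L) P)
    (hmem : ∀ t u, MemLp (L t u) 2 P) {s t : ℝ≥0} (hst : s ≤ t) {B : Set Ω}
    (hB : MeasurableSet[cylFiltration L s] B) {f : Lp ℝ 2 P}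
    (hf : AEStronglyMeasurable[cylFiltration L s] f P) (w : U) :
    ⟪f, levyIncrement hL hmem s t ((cylFiltration L).le s _ hB) w⟫_ℝ = 0 := by
  have hB' := (cylFiltration L).le s _ hB
  rw [levyIncrement, ContinuousLinearMap.comp_apply, inner_indicatorL_right, L2.inner_def]
  rw [← hL.integral_mul_sub_eq_zero hmom hmart hst w ((Lp.memLp f).indicator hB')
    (aestronglyMeasurable_indicator hB hf)]
  refine integral_congr_ae ?_
  filter_upwards [coeFn_indicatorL hB' f, coeFn_levyL2_sub hL hmem s t w] with ω h1 h2
  rw [h1, h2]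
  exact mul_comm _ _

/-- Increments over the same time interval: independence of the past and stationarity. -/
theorem IsCharacteristics.inner_levyIncrement_same (h : IsCharacteristics L p q ν)
    (hL : IsCylindricalLevy L) (hmom : ∀ u, MemLp (L 1 u) 2 P)
    (hmart : ∀ u, Martingale (fun t ω => L t u ω) (cylFiltration L) P)
    (hmem : ∀ t u, MemLp (L t u) 2 P) {s t : ℝ≥0} (hst : s ≤ t) {A B : Set Ω}
    (hA : MeasurableSet[cylFiltration L s] A) (hB : MeasurableSet[cylFiltration L s] B)
    (u w : U) :
    ⟪levyIncrement hL hmem s t ((cylFiltration L).le s _ hA) u,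
      levyIncrement hL hmem s t ((cylFiltration L).le s _ hB) w⟫_ℝ =
      (t - s) * P.real (A ∩ B) * ⟪levyL2 hL hmem 1 u, levyL2 hL hmem 1 w⟫_ℝ := by
  have hC : MeasurableSet[cylFiltration L s] (A ∩ B) :=
    @MeasurableSet.inter _ (cylFiltration L s) _ _ hA hB
  have hC' := (cylFiltration L).le s _ hC
  have hsq : ∀ u, ‖levyIncrement hL hmem s t hC' u‖ * ‖levyIncrement hL hmem s t hC' u‖ =
      (t - s) * P.real (A ∩ B) * (‖levyL2 hL hmem 1 u‖ * ‖levyL2 hL hmem 1 u‖) := by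
    intro u
    rw [← real_inner_self_eq_norm_mul_norm, ← real_inner_self_eq_norm_mul_norm, L2.inner_def,
      L2.inner_def]
    have h1 : ∫ ω, ⟪levyIncrement hL hmem s t hC' u ω, levyIncrement hL hmem s t hC' u ω⟫_ℝ ∂P =
        ∫ ω in A ∩ B, (L t u ω - L s u ω) ^ 2 ∂P := by
      rw [← integral_indicator hC']
      refine integral_congr_ae ?_
      filter_upwards [coeFn_levyIncrement hL hmem s t hC' u] with ω hω
      rw [hω]
      by_cases hω : ω ∈ A ∩ B
      · simp only [indicator_of_mem hω]
        exact (sq _).symm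
      · simp only [indicator_of_notMem hω, inner_zero_left]
    have h2 : ∫ ω, ⟪levyL2 hL hmem 1 u ω, levyL2 hL hmem 1 u ω⟫_ℝ ∂P = unitVariance q ν u := by
      have h3 := h.integral_sq hL hmom hmart 1 u
      rw [NNReal.coe_one, one_mul] at h3
      rw [← h3]
      refine integral_congr_ae ?_
      filter_upwards [coeFn_levyL2 hL hmem 1 u] with ω hω
      rw [hω]
      exact (sq _).symm
    rw [h1, h2, h.setIntegral_sub_sq hL hmom hmart hst hC]
    ring
  -- polarization
  refine (inner_indicatorL ((cylFiltration L).le s _ hA) ((cylFiltration L).le s _ hB) _ _).trans ?_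
  change ⟪levyIncrement hL hmem s t hC' u, levyIncrement hL hmem s t hC' w⟫_ℝ = _
  rw [real_inner_eq_norm_add_mul_self_sub_norm_mul_self_sub_norm_mul_self_div_two,
    real_inner_eq_norm_add_mul_self_sub_norm_mul_self_sub_norm_mul_self_div_two, ← map_add,
    ← map_add, hsq, hsq, hsq]
  ring

/-- The covariance of two increments is proportional to the length of the common time interval. -/
theorem IsCharacteristics.inner_levyIncrement (h : IsCharacteristics L p q ν)
    (hL : IsCylindricalLevy L) (hmom : ∀ u, MemLp (L 1 u) 2 P)
    (hmart : ∀ u, Martingale (fun t ω => L t u ω) (cylFiltration L) P)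
    (hmem : ∀ t u, MemLp (L t u) 2 P) {s t s' t' : ℝ≥0} (hst : s ≤ t) (hst' : s' ≤ t')
    {A B : Set Ω} (hA : MeasurableSet[cylFiltration L s] A)
    (hB : MeasurableSet[cylFiltration L s'] B) (u w : U) :
    ⟪levyIncrement hL hmem s t ((cylFiltration L).le s _ hA) u,
      levyIncrement hL hmem s' t' ((cylFiltration L).le s' _ hB) w⟫_ℝ =
      max ((t ⊓ t' : ℝ≥0) - (s ⊔ s' : ℝ≥0) : ℝ) 0 * P.real (A ∩ B) *
        ⟪levyL2 hL hmem 1 u, levyL2 hL hmem 1 w⟫_ℝ := by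
  -- split both intervals at the endpoints of the other one; only the common part contributes
  wlog hss : s ≤ s' generalizing s t s' t' A B u w
  · have := this hst' hst hB hA w u (le_of_not_ge hss)
    rw [real_inner_comm, this, inf_comm t' t, sup_comm s' s, inter_comm B A,
      real_inner_comm (levyL2 hL hmem 1 u)]
  have hA' : MeasurableSet[cylFiltration L s'] A := (cylFiltration L).mono hss _ hA
  rw [sup_eq_right.2 hss]
  rcases le_total t s' with hts | hts
  · rw [inner_levyIncrement_eq_zero hL hmom hmart hmem hst' hB
      (aestronglyMeasurable_levyIncrement hL hmart hmem hss hts hA' u),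
      max_eq_right, zero_mul, zero_mul]
    rw [sub_nonpos, NNReal.coe_le_coe]
    exact inf_le_left.trans hts
  have h1 := inner_levyIncrement_eq_zero hL hmom hmart hmem hst' hB
    (aestronglyMeasurable_levyIncrement hL hmart hmem hss le_rfl hA' u) w
  rw [levyIncrement_add hL hmem s s' t, inner_add_left, h1, zero_add]
  rcases le_total t t' with htt | htt
  · have hB2 : MeasurableSet[cylFiltration L t] B := (cylFiltration L).mono hts _ hB
    have hA2 : MeasurableSet[cylFiltration L t] A := (cylFiltration L).mono hts _ hA'
    have h2 := inner_levyIncrement_eq_zero hL hmom hmart hmem htt hB2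
      (aestronglyMeasurable_levyIncrement hL hmart hmem hts le_rfl hA2 u) w
    rw [levyIncrement_add hL hmem s' t t', inner_add_right, h2, add_zero,
      h.inner_levyIncrement_same hL hmom hmart hmem hts hA' hB, inf_eq_left.2 htt, max_eq_left]
    rwa [sub_nonneg, NNReal.coe_le_coe]
  · have hA2 : MeasurableSet[cylFiltration L t'] A := (cylFiltration L).mono hst' _ hA'
    have hB2 : MeasurableSet[cylFiltration L t'] B := (cylFiltration L).mono hst' _ hB
    have h2 := inner_levyIncrement_eq_zero hL hmom hmart hmem htt hA2
      (aestronglyMeasurable_levyIncrement hL hmart hmem hst' le_rfl hB2 w) u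
    rw [real_inner_comm] at h2
    rw [levyIncrement_add hL hmem s' t' t, inner_add_left, h2, add_zero,
      h.inner_levyIncrement_same hL hmom hmart hmem hst' hA' hB, inf_eq_right.2 htt, max_eq_left]
    rwa [sub_nonneg, NNReal.coe_le_coe]

end Covariances

/-! ### Processes as elements of `L²` of the product space -/

section Processes

theorem eLpNorm_two_sq {α F : Type*} [MeasurableSpace α] [NormedAddCommGroup F] (μ : Measure α)
    (f : α → F) : eLpNorm f 2 μ ^ 2 = ∫⁻ x, ‖f x‖ₑ ^ 2 ∂μ := by
  have h := eLpNorm_nnreal_pow_eq_lintegral (f := f) (μ := μ) (p := 2) two_ne_zero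
  simpa using h

theorem timeMeasure_Ioc {a b T : ℝ≥0} (hb : b ≤ T) :
    timeMeasure T (Ioc a b) = ENNReal.ofReal (b - a) := by
  rw [timeMeasure, Measure.map_apply measurable_real_toNNReal measurableSet_Ioc,
    Measure.restrict_apply (measurable_real_toNNReal measurableSet_Ioc)]
  have : Real.toNNReal ⁻¹' Ioc a b ∩ Icc 0 (T : ℝ) = Ioc (a : ℝ) b := by
    ext x
    simp only [mem_inter_iff, mem_preimage, mem_Ioc, mem_Icc]
    constructor
    · rintro ⟨⟨h1, h2⟩, h3, -⟩
      exact ⟨by rwa [Real.lt_toNNReal_iff_coe_lt] at h1, by rwa [Real.toNNReal_le_iff_le_coe] at h2⟩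
    · rintro ⟨h1, h2⟩
      exact ⟨⟨Real.lt_toNNReal_iff_coe_lt.2 h1, Real.toNNReal_le_iff_le_coe.2 h2⟩,
        a.2.trans h1.le, h2.trans (NNReal.coe_le_coe.2 hb)⟩
  rw [this, Real.volume_Ioc]

instance (T : ℝ≥0) : IsFiniteMeasure (timeMeasure T) := by
  rw [timeMeasure]
  infer_instance

theorem timeMeasure_singleton (T a : ℝ≥0) : timeMeasure T {a} = 0 := by
  rw [timeMeasure, Measure.map_apply measurable_real_toNNReal (measurableSet_singleton a),
    Measure.restrict_apply (measurable_real_toNNReal (measurableSet_singleton a))]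
  refine measure_mono_null (t := {(a : ℝ)}) ?_ Real.volume_singleton
  rintro x ⟨hx, hx0, -⟩
  rw [mem_singleton_iff, ← (show x.toNNReal = a from hx), Real.coe_toNNReal x hx0]

theorem timeMeasure_Ioi (T : ℝ≥0) : timeMeasure T (Ioi T) = 0 := by
  rw [timeMeasure, Measure.map_apply measurable_real_toNNReal measurableSet_Ioi,
    Measure.restrict_apply (measurable_real_toNNReal measurableSet_Ioi)]
  convert! measure_empty (μ := (volume : Measure ℝ))
  ext x
  simp only [mem_inter_iff, mem_preimage, mem_Ioi, mem_Icc, mem_empty_iff_false, iff_false, not_and]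
  intro h1 _ h2
  rw [Real.lt_toNNReal_iff_coe_lt] at h1
  exact absurd h2 (not_le.2 h1)

variable {Ω : Type*} {F : Type*} [NormedAddCommGroup F]

/-- The process `1_{(s,t]} Φ`. -/
noncomputable def stepProcess (s t : ℝ≥0) (Φ : Ω → F) (z : ℝ≥0 × Ω) : F :=
  (Ioc s t).indicator (fun _ => Φ z.2) z.1

theorem stepProcess_sub (s t : ℝ≥0) (Φ Φ' : Ω → F) :
    stepProcess s t (Φ - Φ') = stepProcess s t Φ - stepProcess s t Φ' := by
  funext z
  by_cases hz : z.1 ∈ Ioc s t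
  · simp only [stepProcess, indicator_of_mem hz, Pi.sub_apply]
  · simp only [stepProcess, indicator_of_notMem hz, Pi.sub_apply, sub_self]

variable [mΩ : MeasurableSpace Ω] {P : Measure Ω} {T : ℝ≥0}

theorem aestronglyMeasurable_stepProcess (s t : ℝ≥0) {Φ : Ω → F}
    (hΦ : AEStronglyMeasurable Φ P) :
    AEStronglyMeasurable (stepProcess s t Φ) ((timeMeasure T).prod P) := by
  have h : stepProcess s t Φ = (Ioc s t ×ˢ univ).indicator fun z => Φ z.2 := by
    funext z
    by_cases hz : z.1 ∈ Ioc s t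
    · rw [indicator_of_mem (mk_mem_prod hz (mem_univ _)), stepProcess, indicator_of_mem hz]
    · rw [indicator_of_notMem fun h => hz h.1, stepProcess, indicator_of_notMem hz]
  rw [h]
  exact hΦ.comp_snd.indicator (measurableSet_Ioc.prod MeasurableSet.univ)

theorem SimpleProcess.uncurry_eval {ℱ : Filtration ℝ≥0 mΩ} (S : SimpleProcess ℱ P T F) :
    Function.uncurry S.eval =
      ∑ k, stepProcess (S.time k.castSucc) (S.time k.succ) (S.Φ k) := by
  funext z
  rw [Finset.sum_apply]
  rfl

variable [IsProbabilityMeasure P]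

theorem processNormSq_eq {Ψ : ℝ≥0 → Ω → F}
    (hΨ : AEStronglyMeasurable (Function.uncurry Ψ) ((timeMeasure T).prod P)) :
    processNormSq P T Ψ = eLpNorm (Function.uncurry Ψ) 2 ((timeMeasure T).prod P) ^ 2 := by
  rw [eLpNorm_two_sq, lintegral_prod_symm _ (hΨ.enorm.pow_const 2)]
  rfl

theorem memLp_of_processNormSq_lt_top {Ψ : ℝ≥0 → Ω → F}
    (hΨ : AEStronglyMeasurable (Function.uncurry Ψ) ((timeMeasure T).prod P))
    (h : processNormSq P T Ψ < ∞) :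
    MemLp (Function.uncurry Ψ) 2 ((timeMeasure T).prod P) := by
  refine ⟨hΨ, ?_⟩
  rw [processNormSq_eq hΨ] at h
  exact (ENNReal.pow_lt_top_iff).1 h |>.resolve_right two_ne_zero

theorem tendsto_toLp_of_processNormSq {Ψ : ℝ≥0 → Ω → F} {Ψ' : ℕ → ℝ≥0 → Ω → F}
    (hΨ : MemLp (Function.uncurry Ψ) 2 ((timeMeasure T).prod P))
    (hΨ' : ∀ n, MemLp (Function.uncurry (Ψ' n)) 2 ((timeMeasure T).prod P))
    (h : Tendsto (fun n => processNormSq P T (fun s ω => Ψ' n s ω - Ψ s ω)) atTop (𝓝 0)) :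
    Tendsto (fun n => (hΨ' n).toLp _) atTop (𝓝 (hΨ.toLp _)) := by
  rw [Lp.tendsto_Lp_iff_tendsto_eLpNorm'']
  have heq : ∀ n, processNormSq P T (fun s ω => Ψ' n s ω - Ψ s ω) =
      eLpNorm (Function.uncurry (Ψ' n) - Function.uncurry Ψ) 2 ((timeMeasure T).prod P) ^ 2 :=
    fun n => processNormSq_eq ((hΨ' n).sub hΨ).aestronglyMeasurable
  simp_rw [heq] at h
  have h2 := h.ennrpow_const (1 / 2 : ℝ)
  rw [ENNReal.zero_rpow_of_pos (by norm_num)] at h2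
  refine h2.congr fun n => ?_
  rw [← ENNReal.rpow_natCast, ← ENNReal.rpow_mul]
  norm_num

theorem eLpNorm_stepProcess_sq_le (s t : ℝ≥0) {Φ : Ω → F} (hΦ : AEStronglyMeasurable Φ P) :
    eLpNorm (stepProcess s t Φ) 2 ((timeMeasure T).prod P) ^ 2 ≤
      timeMeasure T univ * eLpNorm Φ 2 P ^ 2 := by
  rw [eLpNorm_two_sq, eLpNorm_two_sq, lintegral_prod_symm _
    ((aestronglyMeasurable_stepProcess s t hΦ).enorm.pow_const 2),
    ← lintegral_const_mul'' _ (hΦ.enorm.pow_const 2)]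
  refine lintegral_mono fun ω => ?_
  rw [mul_comm, ← lintegral_const]
  refine lintegral_mono fun r => ?_
  gcongr
  exact enorm_indicator_le_enorm_self _ _

theorem memLp_stepProcess (s t : ℝ≥0) {Φ : Ω → F} (hΦ : MemLp Φ 2 P) :
    MemLp (stepProcess s t Φ) 2 ((timeMeasure T).prod P) := by
  refine ⟨aestronglyMeasurable_stepProcess s t hΦ.1, ?_⟩
  have h := (eLpNorm_stepProcess_sq_le (T := T) s t hΦ.1).trans_lt
    (ENNReal.mul_lt_top (measure_lt_top _ _) (ENNReal.pow_lt_top hΦ.2))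
  exact (ENNReal.pow_lt_top_iff).1 h |>.resolve_right two_ne_zero

theorem tendsto_toLp_stepProcess (s t : ℝ≥0) {Φ : Ω → F} {Φ' : ℕ → Ω → F} (hΦ : MemLp Φ 2 P)
    (hΦ' : ∀ n, MemLp (Φ' n) 2 P) (h : Tendsto (fun n => eLpNorm (Φ' n - Φ) 2 P) atTop (𝓝 0)) :
    Tendsto (fun n => (memLp_stepProcess (T := T) s t (hΦ' n)).toLp _) atTop
      (𝓝 ((memLp_stepProcess s t hΦ).toLp _)) := by
  rw [Lp.tendsto_Lp_iff_tendsto_eLpNorm'']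
  have hsq : Tendsto (fun n => eLpNorm (stepProcess s t (Φ' n) - stepProcess s t Φ) 2
      ((timeMeasure T).prod P) ^ 2) atTop (𝓝 0) := by
    have h1 : Tendsto (fun n => timeMeasure T univ * eLpNorm (Φ' n - Φ) 2 P ^ 2) atTop (𝓝 0) := by
      have := ENNReal.Tendsto.const_mul (a := timeMeasure T univ)
        (ENNReal.Tendsto.pow (n := 2) h) (Or.inr (measure_ne_top _ _))
      simpa using this
    refine tendsto_of_tendsto_of_tendsto_of_le_of_le tendsto_const_nhds h1 (fun _ => zero_le)
      fun n => ?_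
    change eLpNorm (stepProcess s t (Φ' n) - stepProcess s t Φ) 2 _ ^ 2 ≤ _
    rw [← stepProcess_sub]
    exact eLpNorm_stepProcess_sq_le s t ((hΦ' n).sub hΦ).1
  have h2 := hsq.ennrpow_const (1 / 2 : ℝ)
  rw [ENNReal.zero_rpow_of_pos (by norm_num)] at h2
  refine h2.congr fun n => ?_
  rw [← ENNReal.rpow_natCast, ← ENNReal.rpow_mul]
  norm_num

theorem SimpleProcess.memLp_eval {ℱ : Filtration ℝ≥0 mΩ} (S : SimpleProcess ℱ P T F) :
    MemLp (Function.uncurry S.eval) 2 ((timeMeasure T).prod P) := by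
  rw [S.uncurry_eval]
  exact memLp_finsetSum' _ fun k _ => memLp_stepProcess _ _ (S.memLp_Φ k)

theorem SimpleProcess.toLp_eval {ℱ : Filtration ℝ≥0 mΩ} (S : SimpleProcess ℱ P T F) :
    S.memLp_eval.toLp _ = ∑ k, (memLp_stepProcess (T := T) (S.time k.castSucc) (S.time k.succ)
      (S.memLp_Φ k)).toLp _ := by
  set x : Fin S.N → Lp F 2 ((timeMeasure T).prod P) := fun k =>
    (memLp_stepProcess (S.time k.castSucc) (S.time k.succ) (S.memLp_Φ k)).toLp _
  refine Lp.ext (S.memLp_eval.coeFn_toLp.trans ?_)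
  have hx : ∀ k, x k =ᵐ[(timeMeasure T).prod P]
      stepProcess (S.time k.castSucc) (S.time k.succ) (S.Φ k) := fun k => MemLp.coeFn_toLp _
  filter_upwards [ae_all_iff.2 hx, Lp.coeFn_finsetSum Finset.univ x] with z h1 h2
  rw [h2, S.uncurry_eval, Finset.sum_apply, Finset.sum_apply]
  exact Finset.sum_congr rfl fun k _ => (h1 k).symm

end Processes

/-! ### The isometry -/

section IntegralGraph

variable {Ω : Type*} [mΩ : MeasurableSpace Ω] {P : Measure Ω}
  {U : Type*} [NormedAddCommGroup U] [InnerProductSpace ℝ U] [CompleteSpace U]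
  {V : Type*} [NormedAddCommGroup V] [InnerProductSpace ℝ V] [CompleteSpace V]
  {L : ℝ≥0 → U →ₗ[ℝ] (Ω →ₘ[P] ℝ)}

open ContinuousLinearMap (adjoint)

theorem isRadonified_radonify (hL : IsCylindricalLevy L) (hmem : ∀ t u, MemLp (L t u) 2 P)
    (s t : ℝ≥0) (φ : HilbertSchmidt U V) :
    IsRadonified (L t - L s) φ (radonify (levyL2 hL hmem t - levyL2 hL hmem s) φ) := by
  intro v
  filter_upwards [inner_radonify_ae_eq (levyL2 hL hmem t - levyL2 hL hmem s) φ v,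
    coeFn_levyL2_sub hL hmem s t (adjoint φ.toCLM v),
    AEEqFun.coeFn_sub (L t (adjoint φ.toCLM v)) (L s (adjoint φ.toCLM v))] with ω h1 h2 h3
  rw [h1, h2]
  exact h3.symm

/-- Radonification commutes with the restriction to an event. -/
theorem radonify_levyIncrement_ae_eq [TopologicalSpace.SeparableSpace V]
    (hL : IsCylindricalLevy L) (hmem : ∀ t u, MemLp (L t u) 2 P)
    {s t : ℝ≥0} {A : Set Ω} (hA : MeasurableSet A) {φ : HilbertSchmidt U V} {X : Lp V 2 P}
    (hX : IsRadonified (L t - L s) φ X) :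
    radonify (levyIncrement hL hmem s t hA) φ =ᵐ[P] A.indicator X := by
  have := countable_basisIndex V
  have h : ∀ k : basisIndex V, ∀ᵐ ω ∂P,
      ⟪radonify (levyIncrement hL hmem s t hA) φ ω, stdBasis V k⟫_ℝ =
        ⟪A.indicator X ω, stdBasis V k⟫_ℝ := by
    intro k
    filter_upwards [inner_radonify_ae_eq (levyIncrement hL hmem s t hA) φ (stdBasis V k),
      coeFn_levyIncrement hL hmem s t hA (adjoint φ.toCLM (stdBasis V k)), hX (stdBasis V k),
      AEEqFun.coeFn_sub (L t (adjoint φ.toCLM (stdBasis V k)))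
        (L s (adjoint φ.toCLM (stdBasis V k)))] with ω h1 h2 h3 h4
    rw [h1, h2]
    by_cases hω : ω ∈ A
    · rw [indicator_of_mem hω, indicator_of_mem hω, h3]
      exact h4.symm
    · rw [indicator_of_notMem hω, indicator_of_notMem hω, inner_zero_left]
  filter_upwards [ae_all_iff.2 h] with ω hω
  refine (stdBasis V).repr.injective ?_
  ext k
  rw [HilbertBasis.repr_apply_apply, HilbertBasis.repr_apply_apply, real_inner_comm, hω k,
    real_inner_comm]

theorem memLp_two_of_finite_range {F : Type*} [NormedAddCommGroup F] [IsFiniteMeasure P]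
    {Φ : Ω → F} (hfin : (range Φ).Finite) (hΦ : AEStronglyMeasurable Φ P) : MemLp Φ 2 P := by
  obtain ⟨C, hC⟩ := (hfin.image norm).bddAbove
  exact MemLp.of_bound hΦ C (ae_of_all _ fun ω => hC (mem_image_of_mem _ (mem_range_self ω)))

/-- Random variables that are measurable with respect to `m` can be approximated by simple ones that
are measurable with respect to `m`. -/
theorem exists_simple_eLpNorm_sub_lt {F : Type*} [NormedAddCommGroup F] {m : MeasurableSpace Ω}
    (hm : m ≤ mΩ) {Φ : Ω → F} (hΦ : StronglyMeasurable[m] Φ) (hΦ2 : MemLp Φ 2 P) {ε : ℝ≥0∞}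
    (hε : ε ≠ 0) : ∃ Φ' : Ω → F, (range Φ').Finite ∧ StronglyMeasurable[m] Φ' ∧
      eLpNorm (Φ' - Φ) 2 P < ε := by
  have htrim : MemLp Φ 2 (P.trim hm) :=
    ⟨hΦ.aestronglyMeasurable, by rw [eLpNorm_trim hm hΦ]; exact hΦ2.2⟩
  obtain ⟨g, hg, -⟩ := htrim.exists_simpleFunc_eLpNorm_sub_lt (by norm_num) hε
  have hgm : StronglyMeasurable[m] g := g.stronglyMeasurable
  refine ⟨g, g.finite_range, hgm, ?_⟩
  rw [eLpNorm_sub_comm]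
  rwa [eLpNorm_trim hm (hΦ.sub hgm)] at hg

theorem SimpleProcess.time_castSucc_le {T : ℝ≥0} {ℱ : Filtration ℝ≥0 mΩ} {F : Type*}
    [NormedAddCommGroup F] (S : SimpleProcess ℱ P T F) (k : Fin S.N) :
    S.time k.castSucc ≤ S.time k.succ :=
  S.strictMono_time.monotone (Fin.castSucc_le_succ k)

theorem SimpleProcess.time_succ_le {T : ℝ≥0} {ℱ : Filtration ℝ≥0 mΩ} {F : Type*}
    [NormedAddCommGroup F] (S : SimpleProcess ℱ P T F) (k : Fin S.N) : S.time k.succ ≤ T :=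
  (S.strictMono_time.monotone (Fin.le_last _)).trans_eq S.time_last

theorem exists_isSimpleIncrement [TopologicalSpace.SeparableSpace V]
    (hL : IsCylindricalLevy L)
    (hmem : ∀ t u, MemLp (L t u) 2 P) (s t : ℝ≥0)
    {Φ : Ω → HilbertSchmidt U V} (hfin : (range Φ).Finite)
    (hΦ : StronglyMeasurable[cylFiltration L s] Φ) :
    ∃ X : Lp V 2 P, IsSimpleIncrement (L t - L s) Φ X := by
  classical
  have hA' : ∀ φ, MeasurableSet {ω | Φ ω = φ} := fun φ => (cylFiltration L).le s _
    (hΦ.measurableSet_eq_fun stronglyMeasurable_const)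
  set a : HilbertSchmidt U V → Lp V 2 P := fun φ => radonify (levyIncrement hL hmem s t (hA' φ)) φ
  refine ⟨∑ φ ∈ hfin.toFinset, a φ,
    fun φ => radonify (levyL2 hL hmem t - levyL2 hL hmem s) φ,
    fun φ _ => isRadonified_radonify hL hmem s t φ, ?_⟩
  have ha : ∀ φ ∈ hfin.toFinset, ∀ᵐ ω ∂P, a φ ω = {ω | Φ ω = φ}.indicator
      (radonify (levyL2 hL hmem t - levyL2 hL hmem s) φ) ω :=
    fun φ _ => radonify_levyIncrement_ae_eq hL hmem (hA' φ) (isRadonified_radonify hL hmem s t φ)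
  filter_upwards [(Finset.eventually_all _).2 ha, Lp.coeFn_finsetSum hfin.toFinset a] with ω h2 h3
  rw [h3, Finset.sum_apply, Finset.sum_eq_single_of_mem (Φ ω)
    (hfin.mem_toFinset.2 (mem_range_self ω)), h2 _ (hfin.mem_toFinset.2 (mem_range_self ω)),
    indicator_of_mem (s := {ω' | Φ ω' = Φ ω}) rfl]
  intro φ hφ hne
  rw [h2 φ hφ, indicator_of_notMem (s := {ω' | Φ ω' = φ}) fun h => hne h.symm]

variable [IsProbabilityMeasure P]

variable (V) in
/-- The closed linear relation between integrals and integrands in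
`L²(P; V) × L²([0, T] × Ω; L₂(U, V))` generated by the integrals of the elementary processes
`1_{(s,t]} 1_A φ`. -/
noncomputable def integralGraph (hL : IsCylindricalLevy L) (hmem : ∀ t u, MemLp (L t u) 2 P)
    (T : ℝ≥0) :
    Submodule ℝ (Lp V 2 P × Lp (HilbertSchmidt U V) 2 ((timeMeasure T).prod P)) :=
  (Submodule.span ℝ {x | ∃ (s t : ℝ≥0) (A : Set Ω) (hA : MeasurableSet[cylFiltration L s] A)
    (φ : HilbertSchmidt U V), s ≤ t ∧ t ≤ T ∧
      x = (radonify (levyIncrement hL hmem s t ((cylFiltration L).le s _ hA)) φ,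
        indicatorConstLp 2 (measurableSet_Ioc.prod ((cylFiltration L).le s _ hA))
          (measure_ne_top _ (Ioc s t ×ˢ A)) φ)}).topologicalClosure

theorem compLpL_indicatorConstLp {α E F : Type*} [MeasurableSpace α] {μ : Measure α}
    [NormedAddCommGroup E] [NormedSpace ℝ E] [NormedAddCommGroup F] [NormedSpace ℝ F]
    (D : E →L[ℝ] F) {A : Set α} (hA : MeasurableSet A) (hμ : μ A ≠ ∞) (c : E) :
    D.compLpL 2 μ (indicatorConstLp 2 hA hμ c) = indicatorConstLp 2 hA hμ (D c) := by
  refine Lp.ext ?_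
  filter_upwards [D.coeFn_compLpL (p := 2) (indicatorConstLp 2 hA hμ c),
    indicatorConstLp_coeFn (p := 2) (hs := hA) (hμs := hμ) (c := c),
    indicatorConstLp_coeFn (p := 2) (hs := hA) (hμs := hμ) (c := D c)] with x h1 h2 h3
  rw [h1, h2, h3]
  by_cases hx : x ∈ A
  · rw [indicator_of_mem hx, indicator_of_mem hx]
  · rw [indicator_of_notMem hx, indicator_of_notMem hx, map_zero]

variable {p : U → ℝ} {q : QuadraticForm ℝ U} {ν : CylindricalMeasure U}

/-- The isometry: the norm of an integral is that of the integrand, composed with the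
radonification of `L 1`. For the elementary processes this is the covariance formula. -/
theorem IsCharacteristics.norm_eq_of_mem_integralGraph (h : IsCharacteristics L p q ν)
    (hL : IsCylindricalLevy L) (hmom : ∀ u, MemLp (L 1 u) 2 P)
    (hmart : ∀ u, Martingale (fun t ω => L t u ω) (cylFiltration L) P)
    (hmem : ∀ t u, MemLp (L t u) 2 P) {T : ℝ≥0}
    {x : Lp V 2 P × Lp (HilbertSchmidt U V) 2 ((timeMeasure T).prod P)}
    (hx : x ∈ integralGraph V hL hmem T) :
    ‖x.1‖ = ‖(radonify (V := V) (levyL2 hL hmem 1)).compLpL 2 ((timeMeasure T).prod P) x.2‖ := by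
  set D := (radonify (V := V) (levyL2 hL hmem 1)).compLpL 2 ((timeMeasure T).prod P) with hD
  have hclosed : IsClosed {x : Lp V 2 P × Lp (HilbertSchmidt U V) 2 ((timeMeasure T).prod P) |
      ‖x.1‖ = ‖D x.2‖} :=
    isClosed_eq continuous_fst.norm (D.continuous.comp continuous_snd).norm
  refine closure_minimal (t := {x | ‖x.1‖ = ‖D x.2‖}) ?_ hclosed hx
  -- on the span, inner products are preserved
  set G := {x : Lp V 2 P × Lp (HilbertSchmidt U V) 2 ((timeMeasure T).prod P) |
    ∃ (s t : ℝ≥0) (A : Set Ω) (hA : MeasurableSet[cylFiltration L s] A)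
    (φ : HilbertSchmidt U V), s ≤ t ∧ t ≤ T ∧
      x = (radonify (levyIncrement hL hmem s t ((cylFiltration L).le s _ hA)) φ,
        indicatorConstLp 2 (measurableSet_Ioc.prod ((cylFiltration L).le s _ hA))
          (measure_ne_top _ (Ioc s t ×ˢ A)) φ)}
  have hgen : ∀ x ∈ G, ∀ y ∈ G, ⟪x.1, y.1⟫_ℝ = ⟪D x.2, D y.2⟫_ℝ := by
    rintro _ ⟨s, t, A, hA, φ, hst, htT, rfl⟩ _ ⟨s', t', B, hB, ψ, hst', htT', rfl⟩
    rw [inner_radonify_eq_mul (h.inner_levyIncrement hL hmom hmart hmem hst hst' hA hB), hD,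
      compLpL_indicatorConstLp, compLpL_indicatorConstLp,
      L2.inner_indicatorConstLp_indicatorConstLp, prod_inter_prod, Ioc_inter_Ioc, smul_eq_mul]
    have hvol : ((timeMeasure T).prod P).real (Ioc (s ⊔ s') (t ⊓ t') ×ˢ (A ∩ B)) =
        max ((t ⊓ t' : ℝ≥0) - (s ⊔ s' : ℝ≥0) : ℝ) 0 * P.real (A ∩ B) := by
      rw [Measure.real, Measure.prod_prod, timeMeasure_Ioc (inf_le_left.trans htT),
        ENNReal.toReal_mul, ENNReal.toReal_ofReal']
      rfl
    rw [hvol]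
  have hspan1 : ∀ y ∈ G, ∀ x ∈ Submodule.span ℝ G, ⟪x.1, y.1⟫_ℝ = ⟪D x.2, D y.2⟫_ℝ := by
    intro y hy x hx
    induction hx using Submodule.span_induction with
    | mem x hx => exact hgen x hx y hy
    | zero => simp
    | add x x' _ _ h1 h2 =>
      rw [Prod.fst_add, Prod.snd_add, map_add, inner_add_left, inner_add_left, h1, h2]
    | smul c x _ h1 =>
      rw [Prod.smul_fst, Prod.smul_snd, map_smul, real_inner_smul_left, real_inner_smul_left, h1]
  have hspan : ∀ x ∈ Submodule.span ℝ G, ∀ y ∈ Submodule.span ℝ G,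
      ⟪x.1, y.1⟫_ℝ = ⟪D x.2, D y.2⟫_ℝ := by
    intro x hx y hy
    induction hy using Submodule.span_induction with
    | mem y hy => exact hspan1 y hy x hx
    | zero => simp
    | add y y' _ _ h1 h2 =>
      rw [Prod.fst_add, Prod.snd_add, map_add, inner_add_right, inner_add_right, h1, h2]
    | smul c y _ h1 =>
      rw [Prod.smul_fst, Prod.smul_snd, map_smul, real_inner_smul_right, real_inner_smul_right, h1]
  intro x hx
  have h1 := hspan x hx x hx
  rw [real_inner_self_eq_norm_sq, real_inner_self_eq_norm_sq] at h1
  exact (sq_eq_sq₀ (norm_nonneg _) (norm_nonneg _)).1 h1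

/-- Convergence of integrands in the closed relation implies convergence of the integrals. -/
theorem IsCharacteristics.exists_tendsto_of_mem_integralGraph (h : IsCharacteristics L p q ν)
    (hL : IsCylindricalLevy L) (hmom : ∀ u, MemLp (L 1 u) 2 P)
    (hmart : ∀ u, Martingale (fun t ω => L t u ω) (cylFiltration L) P)
    (hmem : ∀ t u, MemLp (L t u) 2 P) {T : ℝ≥0} {X : ℕ → Lp V 2 P}
    {Y : ℕ → Lp (HilbertSchmidt U V) 2 ((timeMeasure T).prod P)}
    {Y₀ : Lp (HilbertSchmidt U V) 2 ((timeMeasure T).prod P)}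
    (hmemG : ∀ n, (X n, Y n) ∈ integralGraph V hL hmem T) (hY : Tendsto Y atTop (𝓝 Y₀)) :
    ∃ X₀, Tendsto X atTop (𝓝 X₀) := by
  set D := (radonify (V := V) (levyL2 hL hmem 1)).compLpL 2 ((timeMeasure T).prod P) with hD
  refine cauchySeq_tendsto_of_complete (cauchySeq_iff_tendsto_dist_atTop_0.2 ?_)
  have h1 := cauchySeq_iff_tendsto_dist_atTop_0.1 (((D.continuous.tendsto Y₀).comp hY).cauchySeq)
  refine h1.congr fun n => ?_
  have h2 := h.norm_eq_of_mem_integralGraph hL hmom hmart hmem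
    (Submodule.sub_mem _ (hmemG n.1) (hmemG n.2))
  rw [Prod.mk_sub_mk, map_sub] at h2
  rw [dist_eq_norm, dist_eq_norm, h2]
  rfl

section Increments

variable [TopologicalSpace.SeparableSpace V]

/-- The increment of a simple random operator is a sum of integrals of elementary processes. -/
theorem mem_integralGraph_of_isSimpleIncrement (hL : IsCylindricalLevy L)
    (hmem : ∀ t u, MemLp (L t u) 2 P) {s t T : ℝ≥0} (hst : s ≤ t) (htT : t ≤ T)
    {Φ : Ω → HilbertSchmidt U V} (hfin : (range Φ).Finite)
    (hΦ : StronglyMeasurable[cylFiltration L s] Φ) (hΦ2 : MemLp Φ 2 P) {X : Lp V 2 P}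
    (hX : IsSimpleIncrement (L t - L s) Φ X) :
    (X, (memLp_stepProcess s t hΦ2).toLp _) ∈ integralGraph V hL hmem T := by
  classical
  obtain ⟨x, hx, hXx⟩ := hX
  have hA : ∀ φ, MeasurableSet[cylFiltration L s] {ω | Φ ω = φ} := fun φ =>
    hΦ.measurableSet_eq_fun stronglyMeasurable_const
  have hA' : ∀ φ, MeasurableSet {ω | Φ ω = φ} := fun φ => (cylFiltration L).le s _ (hA φ)
  set a : HilbertSchmidt U V → Lp V 2 P := fun φ => radonify (levyIncrement hL hmem s t (hA' φ)) φ
  set b : HilbertSchmidt U V → Lp (HilbertSchmidt U V) 2 ((timeMeasure T).prod P) := fun φ =>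
    indicatorConstLp 2 (measurableSet_Ioc.prod (hA' φ))
      (measure_ne_top _ (Ioc s t ×ˢ {ω | Φ ω = φ})) φ
  have hmemsum : ∑ φ ∈ hfin.toFinset, (a φ, b φ) ∈ integralGraph V hL hmem T :=
    Submodule.sum_mem _ fun φ _ => Submodule.le_topologicalClosure _
      (Submodule.subset_span ⟨s, t, _, hA φ, φ, hst, htT, rfl⟩)
  suffices heq : (X, MemLp.toLp (stepProcess s t Φ) (memLp_stepProcess s t hΦ2)) =
      ∑ φ ∈ hfin.toFinset, (a φ, b φ) by rwa [heq]
  refine Prod.ext ?_ ?_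
  · rw [Prod.fst_sum]
    refine Lp.ext ?_
    have ha : ∀ φ ∈ hfin.toFinset, ∀ᵐ ω ∂P, a φ ω = {ω | Φ ω = φ}.indicator (x φ) ω :=
      fun φ hφ => radonify_levyIncrement_ae_eq hL hmem (hA' φ) (hx φ (hfin.mem_toFinset.1 hφ))
    filter_upwards [hXx, (Finset.eventually_all _).2 ha, Lp.coeFn_finsetSum hfin.toFinset a]
      with ω h1 h2 h3
    rw [h3, Finset.sum_apply, h1, Finset.sum_eq_single_of_mem (Φ ω)
      (hfin.mem_toFinset.2 (mem_range_self ω)), h2 _ (hfin.mem_toFinset.2 (mem_range_self ω)),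
      indicator_of_mem (s := {ω' | Φ ω' = Φ ω}) rfl]
    intro φ hφ hne
    rw [h2 φ hφ, indicator_of_notMem (s := {ω' | Φ ω' = φ}) fun h => hne h.symm]
  · rw [Prod.snd_sum]
    refine Lp.ext ?_
    have hb : ∀ φ ∈ hfin.toFinset, ∀ᵐ z ∂((timeMeasure T).prod P),
        b φ z = (Ioc s t ×ˢ {ω | Φ ω = φ}).indicator (fun _ => φ) z :=
      fun φ _ => indicatorConstLp_coeFn
    filter_upwards [(memLp_stepProcess (T := T) s t hΦ2).coeFn_toLp, (Finset.eventually_all _).2 hb,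
      Lp.coeFn_finsetSum hfin.toFinset b] with z h1 h2 h3
    have hz := hfin.mem_toFinset.2 (mem_range_self z.2)
    rw [h3, Finset.sum_apply, h1, Finset.sum_eq_single_of_mem (Φ z.2) hz, h2 _ hz, stepProcess]
    · by_cases hz1 : z.1 ∈ Ioc s t
      · rw [indicator_of_mem hz1, indicator_of_mem (s := Ioc s t ×ˢ {ω | Φ ω = Φ z.2}) ⟨hz1, rfl⟩]
      · rw [indicator_of_notMem hz1, indicator_of_notMem fun h => hz1 h.1]
    · intro φ hφ hne
      rw [h2 φ hφ]
      exact indicator_of_notMem (fun h => hne h.2.symm) _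

theorem mem_integralGraph_of_isIncrement (hL : IsCylindricalLevy L)
    (hmem : ∀ t u, MemLp (L t u) 2 P) {s t T : ℝ≥0} (hst : s ≤ t) (htT : t ≤ T)
    {Φ : Ω → HilbertSchmidt U V} (hΦ2 : MemLp Φ 2 P) {X : Lp V 2 P}
    (hX : IsIncrement (cylFiltration L) s (L t - L s) Φ X) :
    (X, (memLp_stepProcess s t hΦ2).toLp _) ∈ integralGraph V hL hmem T := by
  obtain ⟨Φ', X', h1, h2, h3⟩ := hX
  have hmemΦ : ∀ n, MemLp (Φ' n) 2 P := fun n => memLp_two_of_finite_range (h1 n).1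
    ((h1 n).2.1.mono ((cylFiltration L).le s)).aestronglyMeasurable
  refine (Submodule.isClosed_topologicalClosure _).mem_of_tendsto
    (h3.prodMk_nhds (tendsto_toLp_stepProcess s t hΦ2 hmemΦ h2)) (Eventually.of_forall fun n => ?_)
  exact mem_integralGraph_of_isSimpleIncrement hL hmem hst htT (h1 n).1 (h1 n).2.1 (hmemΦ n)
    (h1 n).2.2

theorem IsCharacteristics.exists_isIncrement (h : IsCharacteristics L p q ν)
    (hL : IsCylindricalLevy L) (hmom : ∀ u, MemLp (L 1 u) 2 P)
    (hmart : ∀ u, Martingale (fun t ω => L t u ω) (cylFiltration L) P)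
    (hmem : ∀ t u, MemLp (L t u) 2 P) {s t : ℝ≥0} (hst : s ≤ t)
    {Φ : Ω → HilbertSchmidt U V} (hΦ : StronglyMeasurable[cylFiltration L s] Φ)
    (hΦ2 : MemLp Φ 2 P) :
    ∃ X : Lp V 2 P, IsIncrement (cylFiltration L) s (L t - L s) Φ X := by
  have happrox := fun n : ℕ => exists_simple_eLpNorm_sub_lt ((cylFiltration L).le s) hΦ hΦ2
    (ε := (n + 1 : ℝ≥0∞)⁻¹) (ENNReal.inv_ne_zero.2 (by finiteness))
  choose Φ' h1 h2 h3 using happrox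
  choose X' hX' using fun n => exists_isSimpleIncrement hL hmem s t (h1 n) (h2 n)
  have hmemΦ : ∀ n, MemLp (Φ' n) 2 P := fun n => memLp_two_of_finite_range (h1 n)
    ((h2 n).mono ((cylFiltration L).le s)).aestronglyMeasurable
  have hlim : Tendsto (fun n => eLpNorm (Φ' n - Φ) 2 P) atTop (𝓝 0) := by
    refine tendsto_of_tendsto_of_tendsto_of_le_of_le tendsto_const_nhds
      (ENNReal.tendsto_inv_nat_nhds_zero.comp (tendsto_add_atTop_nat 1)) (fun _ => zero_le)
      fun n => (h3 n).le.trans (le_of_eq ?_)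
    simp
  obtain ⟨X, hX⟩ := h.exists_tendsto_of_mem_integralGraph hL hmom hmart hmem (fun n =>
    mem_integralGraph_of_isSimpleIncrement hL hmem hst le_rfl (h1 n) (h2 n) (hmemΦ n) (hX' n))
    (tendsto_toLp_stepProcess s t hΦ2 hmemΦ hlim)
  exact ⟨X, Φ', X', fun n => ⟨h1 n, h2 n, hX' n⟩, hlim, hX⟩

variable {T : ℝ≥0}

theorem IsCharacteristics.exists_isSimpleIntegral (h : IsCharacteristics L p q ν)
    (hL : IsCylindricalLevy L) (hmom : ∀ u, MemLp (L 1 u) 2 P)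
    (hmart : ∀ u, Martingale (fun t ω => L t u ω) (cylFiltration L) P)
    (hmem : ∀ t u, MemLp (L t u) 2 P)
    (S : SimpleProcess (cylFiltration L) P T (HilbertSchmidt U V)) :
    ∃ X : Lp V 2 P, IsSimpleIntegral L S X := by
  choose x hx using fun k => h.exists_isIncrement hL hmom hmart hmem (S.time_castSucc_le k)
    (S.measurable_Φ k) (S.memLp_Φ k)
  exact ⟨∑ k, x k, x, hx, rfl⟩

theorem mem_integralGraph_of_isSimpleIntegral (hL : IsCylindricalLevy L)
    (hmem : ∀ t u, MemLp (L t u) 2 P)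
    {S : SimpleProcess (cylFiltration L) P T (HilbertSchmidt U V)} {X : Lp V 2 P}
    (hX : IsSimpleIntegral L S X) : (X, S.memLp_eval.toLp _) ∈ integralGraph V hL hmem T := by
  obtain ⟨x, hx, rfl⟩ := hX
  rw [S.toLp_eval]
  have hsum := Submodule.sum_mem (integralGraph V hL hmem T) (t := Finset.univ) fun k _ =>
    mem_integralGraph_of_isIncrement hL hmem (S.time_castSucc_le k) (S.time_succ_le k)
      (S.memLp_Φ k) (hx k)
  rwa [← prod_mk_sum] at hsum

theorem mem_integralGraph_of_isStochasticIntegral (hL : IsCylindricalLevy L)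
    (hmem : ∀ t u, MemLp (L t u) 2 P) {Ψ : ℝ≥0 → Ω → HilbertSchmidt U V}
    (hΨ : MemLp (Function.uncurry Ψ) 2 ((timeMeasure T).prod P)) {X : Lp V 2 P}
    (hX : IsStochasticIntegral L T Ψ X) : (X, hΨ.toLp _) ∈ integralGraph V hL hmem T := by
  obtain ⟨S, X', h1, h2, h3⟩ := hX
  refine (Submodule.isClosed_topologicalClosure _).mem_of_tendsto
    (h3.prodMk_nhds (tendsto_toLp_of_processNormSq hΨ (fun n => (S n).memLp_eval) h2))
    (Eventually.of_forall fun n => ?_)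
  exact mem_integralGraph_of_isSimpleIntegral hL hmem (h1 n)

theorem IsCharacteristics.isStochasticIntegral_unique (h : IsCharacteristics L p q ν)
    (hL : IsCylindricalLevy L) (hmom : ∀ u, MemLp (L 1 u) 2 P)
    (hmart : ∀ u, Martingale (fun t ω => L t u ω) (cylFiltration L) P)
    (hmem : ∀ t u, MemLp (L t u) 2 P) {Ψ : ℝ≥0 → Ω → HilbertSchmidt U V}
    (hΨ : MemLp (Function.uncurry Ψ) 2 ((timeMeasure T).prod P)) {X X' : Lp V 2 P}
    (hX : IsStochasticIntegral L T Ψ X) (hX' : IsStochasticIntegral L T Ψ X') : X = X' := by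
  have h1 := h.norm_eq_of_mem_integralGraph hL hmom hmart hmem (Submodule.sub_mem _
    (mem_integralGraph_of_isStochasticIntegral hL hmem hΨ hX)
    (mem_integralGraph_of_isStochasticIntegral hL hmem hΨ hX'))
  rw [Prod.mk_sub_mk, sub_self, map_zero, norm_zero] at h1
  exact sub_eq_zero.1 (norm_eq_zero.1 h1)

/-- The integral exists as soon as the integrand can be approximated by simple processes. -/
theorem IsCharacteristics.exists_isStochasticIntegral (h : IsCharacteristics L p q ν)
    (hL : IsCylindricalLevy L) (hmom : ∀ u, MemLp (L 1 u) 2 P)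
    (hmart : ∀ u, Martingale (fun t ω => L t u ω) (cylFiltration L) P)
    (hmem : ∀ t u, MemLp (L t u) 2 P) {Ψ : ℝ≥0 → Ω → HilbertSchmidt U V}
    (hΨ : MemLp (Function.uncurry Ψ) 2 ((timeMeasure T).prod P))
    {S : ℕ → SimpleProcess (cylFiltration L) P T (HilbertSchmidt U V)}
    (hS : Tendsto (fun n => processNormSq P T (fun s ω => (S n).eval s ω - Ψ s ω)) atTop (𝓝 0)) :
    ∃ X : Lp V 2 P, IsStochasticIntegral L T Ψ X := by
  choose X' hX' using fun n => h.exists_isSimpleIntegral hL hmom hmart hmem (S n)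
  obtain ⟨X, hX⟩ := h.exists_tendsto_of_mem_integralGraph hL hmom hmart hmem
    (fun n => mem_integralGraph_of_isSimpleIntegral hL hmem (hX' n))
    (tendsto_toLp_of_processNormSq hΨ (fun n => (S n).memLp_eval) hS)
  exact ⟨X, S, X', hX', hS, hX⟩

end Increments

end IntegralGraph

/-! ### Density of the simple processes -/

section Density

theorem timeMeasure_Ioc_le (a b T : ℝ≥0) : timeMeasure T (Ioc a b) ≤ ENNReal.ofReal (b - a) := by
  calc timeMeasure T (Ioc a b) ≤ timeMeasure T (Ioc a (min b T) ∪ Ioi T) := by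
        refine measure_mono fun s hs => ?_
        rcases le_or_gt s T with h | h
        · exact Or.inl ⟨hs.1, le_min hs.2 h⟩
        · exact Or.inr h
    _ ≤ timeMeasure T (Ioc a (min b T)) + timeMeasure T (Ioi T) := measure_union_le _ _
    _ ≤ ENNReal.ofReal (b - a) := by
        rw [timeMeasure_Ioi, add_zero, timeMeasure_Ioc (min_le_right b T)]
        refine ENNReal.ofReal_le_ofReal (sub_le_sub_right ?_ _)
        exact NNReal.coe_le_coe.2 (min_le_left b T)

/-- The `k`-th point of the partition of `[0, T]` into `n + 1` intervals of equal length. -/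
noncomputable def gridTime (T : ℝ≥0) (n k : ℕ) : ℝ≥0 := k * (T / (n + 1))

theorem gridTime_zero (T : ℝ≥0) (n : ℕ) : gridTime T n 0 = 0 := by simp [gridTime]

theorem gridTime_last (T : ℝ≥0) (n : ℕ) : gridTime T n (n + 1) = T := by
  rw [gridTime]
  push_cast
  field_simp

theorem gridTime_succ (T : ℝ≥0) (n k : ℕ) :
    gridTime T n (k + 1) = gridTime T n k + T / (n + 1) := by
  rw [gridTime, gridTime]
  push_cast
  ring

theorem gridTime_mono (T : ℝ≥0) (n : ℕ) : Monotone (gridTime T n) := fun j k h => by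
  unfold gridTime
  gcongr

theorem exists_mem_Ioc_gridTime {T s : ℝ≥0} (n : ℕ) (hs : s ∈ Ioc 0 T) :
    ∃ k : Fin (n + 1), s ∈ Ioc (gridTime T n k) (gridTime T n (k + 1)) := by
  have h := (gridTime_mono T n).biUnion_Ico_Ioc_map_succ 0 (n + 1)
  rw [gridTime_zero, gridTime_last] at h
  rw [← h] at hs
  simp only [mem_iUnion] at hs
  obtain ⟨k, hk, hks⟩ := hs
  exact ⟨⟨k, hk.2⟩, hks⟩

variable {Ω : Type*} {F : Type*} [NormedAddCommGroup F] {T : ℝ≥0}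

theorem stepProcess_add (s t : ℝ≥0) (Φ Φ' : Ω → F) :
    stepProcess s t (Φ + Φ') = stepProcess s t Φ + stepProcess s t Φ' := by
  funext z
  by_cases hz : z.1 ∈ Ioc s t
  · simp only [stepProcess, indicator_of_mem hz, Pi.add_apply]
  · simp only [stepProcess, indicator_of_notMem hz, Pi.add_apply, add_zero]

theorem sum_stepProcess_gridTime_apply {n : ℕ} (Φ : Fin (n + 1) → Ω → F) {k : Fin (n + 1)}
    {z : ℝ≥0 × Ω} (hz : z.1 ∈ Ioc (gridTime T n k) (gridTime T n (k + 1))) :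
    (∑ j : Fin (n + 1), stepProcess (gridTime T n j) (gridTime T n (j + 1)) (Φ j)) z =
      Φ k z.2 := by
  rw [Finset.sum_apply, Finset.sum_eq_single_of_mem k (Finset.mem_univ k)]
  · rw [stepProcess, indicator_of_mem hz]
  · intro j _ hj
    rw [stepProcess, indicator_of_notMem]
    intro hz'
    have hd := (gridTime_mono T n).pairwise_disjoint_on_Ioc_succ
      (fun h => hj (Fin.ext h) : (j : ℕ) ≠ k)
    exact Set.disjoint_left.1 hd hz' hz

variable [mΩ : MeasurableSpace Ω] {P : Measure Ω} {ℱ : Filtration ℝ≥0 mΩ}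

/-- `f` is a limit in `L²([0, T] × Ω)` of simple processes along the partitions of `[0, T]` into
`n + 1` equal parts. Fixing the partitions makes the set of all such `f` additive without
passing to common refinements. -/
def IsGridLimit (ℱ : Filtration ℝ≥0 mΩ) (P : Measure Ω) (T : ℝ≥0) (f : ℝ≥0 × Ω → F) : Prop :=
  ∀ ε : ℝ≥0∞, ε ≠ 0 → ∀ᶠ n : ℕ in atTop, ∃ Φ : Fin (n + 1) → Ω → F,
    (∀ k : Fin (n + 1), StronglyMeasurable[ℱ (gridTime T n k)] (Φ k) ∧ MemLp (Φ k) 2 P) ∧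
    eLpNorm (∑ k : Fin (n + 1), stepProcess (gridTime T n k) (gridTime T n (k + 1)) (Φ k) - f) 2
      ((timeMeasure T).prod P) ≤ ε

theorem IsGridLimit.congr_ae {f g : ℝ≥0 × Ω → F} (hf : IsGridLimit ℱ P T f)
    (h : f =ᵐ[(timeMeasure T).prod P] g) : IsGridLimit ℱ P T g := by
  intro ε hε
  filter_upwards [hf ε hε] with n ⟨Φ, h1, h2⟩
  refine ⟨Φ, h1, ?_⟩
  rwa [← eLpNorm_congr_ae ((EventuallyEq.refl _ _).sub h)]

theorem isGridLimit_zero : IsGridLimit ℱ P T (0 : ℝ≥0 × Ω → F) := by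
  intro ε _
  refine Eventually.of_forall fun n => ⟨0, fun k => ⟨stronglyMeasurable_zero, MemLp.zero⟩, ?_⟩
  have h0 : ∀ s t, stepProcess s t (0 : Ω → F) = 0 := fun s t => by
    funext z
    simp [stepProcess]
  simp only [Pi.zero_apply, h0, Finset.sum_const_zero, sub_zero]
  rw [eLpNorm_zero]
  exact zero_le

theorem ae_prod_mem_Ioc : ∀ᵐ z ∂((timeMeasure T).prod P), z.1 ∈ Ioc 0 T := by
  refine Measure.quasiMeasurePreserving_fst.ae (p := fun s => s ∈ Ioc 0 T) ?_
  have h1 : ∀ᵐ s ∂(timeMeasure T), s ∉ ({0} : Set ℝ≥0) :=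
    measure_eq_zero_iff_ae_notMem.1 (timeMeasure_singleton T 0)
  have h2 : ∀ᵐ s ∂(timeMeasure T), s ∉ Ioi T :=
    measure_eq_zero_iff_ae_notMem.1 (timeMeasure_Ioi T)
  filter_upwards [h1, h2] with s hs1 hs2
  exact ⟨pos_iff_ne_zero.2 hs1, not_lt.1 hs2⟩

theorem aestronglyMeasurable_sum_stepProcess {ι : Type*} (J : Finset ι) (s t : ι → ℝ≥0)
    {Φ : ι → Ω → F} (hΦ : ∀ k, MemLp (Φ k) 2 P) :
    AEStronglyMeasurable (∑ k ∈ J, stepProcess (s k) (t k) (Φ k)) ((timeMeasure T).prod P) :=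
  Finset.aestronglyMeasurable_sum J fun k _ =>
    aestronglyMeasurable_stepProcess (s k) (t k) (hΦ k).1

theorem IsGridLimit.add {f g : ℝ≥0 × Ω → F} (hf : IsGridLimit ℱ P T f) (hg : IsGridLimit ℱ P T g)
    (hfm : AEStronglyMeasurable f ((timeMeasure T).prod P))
    (hgm : AEStronglyMeasurable g ((timeMeasure T).prod P)) : IsGridLimit ℱ P T (f + g) := by
  intro ε hε
  have hε2 : ε / 2 ≠ 0 := (ENNReal.half_pos hε).ne'
  filter_upwards [hf _ hε2, hg _ hε2] with n ⟨Φ, h1, h2⟩ ⟨Φ', h1', h2'⟩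
  refine ⟨Φ + Φ', fun k => ⟨(h1 k).1.add (h1' k).1, (h1 k).2.add (h1' k).2⟩, ?_⟩
  simp only [Pi.add_apply, stepProcess_add, Finset.sum_add_distrib]
  rw [add_sub_add_comm]
  refine (eLpNorm_add_le ?_ ?_ (by norm_num)).trans ((add_le_add h2 h2').trans_eq
    (ENNReal.add_halves ε))
  · exact (aestronglyMeasurable_sum_stepProcess _ _ _ fun k => (h1 k).2).sub hfm
  · exact (aestronglyMeasurable_sum_stepProcess _ _ _ fun k => (h1' k).2).sub hgm

theorem IsGridLimit.finsetSum {ι : Type*} (J : Finset ι) {f : ι → ℝ≥0 × Ω → F}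
    (hf : ∀ i ∈ J, IsGridLimit ℱ P T (f i))
    (hfm : ∀ i ∈ J, AEStronglyMeasurable (f i) ((timeMeasure T).prod P)) :
    IsGridLimit ℱ P T (∑ i ∈ J, f i) := by
  classical
  induction J using Finset.induction_on with
  | empty => exact isGridLimit_zero
  | insert i J hi ih =>
    rw [Finset.sum_insert hi]
    refine (hf i (Finset.mem_insert_self _ _)).add
      (ih (fun j hj => hf j (Finset.mem_insert_of_mem hj))
        fun j hj => hfm j (Finset.mem_insert_of_mem hj))
      (hfm i (Finset.mem_insert_self _ _)) ?_
    exact Finset.aestronglyMeasurable_sum _ fun j hj => hfm j (Finset.mem_insert_of_mem hj)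

theorem IsGridLimit.of_forall_exists {f : ℝ≥0 × Ω → F}
    (hfm : AEStronglyMeasurable f ((timeMeasure T).prod P))
    (h : ∀ ε : ℝ≥0∞, ε ≠ 0 → ∃ g, IsGridLimit ℱ P T g ∧
      AEStronglyMeasurable g ((timeMeasure T).prod P) ∧
      eLpNorm (g - f) 2 ((timeMeasure T).prod P) ≤ ε) : IsGridLimit ℱ P T f := by
  intro ε hε
  have hε2 : ε / 2 ≠ 0 := (ENNReal.half_pos hε).ne'
  obtain ⟨g, hg, hgm, hgf⟩ := h _ hε2
  filter_upwards [hg _ hε2] with n ⟨Φ, h1, h2⟩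
  refine ⟨Φ, h1, ?_⟩
  rw [← sub_add_sub_cancel _ g f]
  refine (eLpNorm_add_le ?_ (hgm.sub hfm) (by norm_num)).trans ((add_le_add h2 hgf).trans_eq
    (ENNReal.add_halves ε))
  exact (aestronglyMeasurable_sum_stepProcess _ _ _ fun k => (h1 k).2).sub hgm

variable [IsProbabilityMeasure P]

theorem tendsto_eLpNorm_indicator_const {α : Type*} [MeasurableSpace α] {μ : Measure α}
    {A : ℕ → Set α} (hA : ∀ n, MeasurableSet (A n)) (h : Tendsto (fun n => μ (A n)) atTop (𝓝 0))
    (c : F) : Tendsto (fun n => eLpNorm ((A n).indicator fun _ => c) 2 μ) atTop (𝓝 0) := by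
  simp_rw [fun n => eLpNorm_indicator_const (μ := μ) (c := c) (hA n) two_ne_zero
    ENNReal.ofNat_ne_top]
  have h2 := h.ennrpow_const (1 / (2 : ℝ≥0∞).toReal)
  rw [ENNReal.zero_rpow_of_pos (by norm_num)] at h2
  have h3 := ENNReal.Tendsto.const_mul (a := ‖c‖ₑ) h2 (Or.inr enorm_ne_top)
  rwa [mul_zero] at h3

/-- The generators of the predictable σ-algebra are dealt with by `isGridLimit_indicator_Ioi_prod`;
the others follow by a monotone class argument. -/
theorem isGridLimit_indicator_Ioi_prod (i : ℝ≥0) {A : Set Ω} (hA : MeasurableSet[ℱ i] A) (c : F) :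
    IsGridLimit ℱ P T ((Ioi i ×ˢ A).indicator fun _ => c) := by
  classical
  -- the partition interval that contains `i` is short
  have hδ : Tendsto (fun n : ℕ => ((timeMeasure T).prod P)
      (Ioc i (i + T / (n + 1)) ×ˢ (univ : Set Ω))) atTop (𝓝 0) := by
    have h0 : Tendsto (fun n : ℕ => ENNReal.ofReal ((T : ℝ) / (n + 1))) atTop (𝓝 0) := by
      rw [← ENNReal.ofReal_zero]
      refine ENNReal.tendsto_ofReal ?_
      have h := (tendsto_one_div_add_atTop_nhds_zero_nat (𝕜 := ℝ)).const_mul (T : ℝ)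
      simpa [div_eq_mul_inv] using h
    refine tendsto_of_tendsto_of_tendsto_of_le_of_le tendsto_const_nhds h0 (fun _ => zero_le)
      fun n => ?_
    change ((timeMeasure T).prod P) (Ioc i (i + T / (n + 1)) ×ˢ (univ : Set Ω)) ≤ _
    rw [Measure.prod_prod, measure_univ, mul_one]
    refine (timeMeasure_Ioc_le _ _ _).trans_eq ?_
    push_cast
    rw [add_sub_cancel_left]
  have hlim := tendsto_eLpNorm_indicator_const
    (fun n => measurableSet_Ioc.prod MeasurableSet.univ) hδ c
  intro ε hε
  filter_upwards [(ENNReal.tendsto_nhds_zero.1 hlim) ε (pos_iff_ne_zero.2 hε)] with n hn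
  refine ⟨fun k : Fin (n + 1) => if i ≤ gridTime T n k then A.indicator (fun _ => c) else 0,
    fun k => ?_, ?_⟩
  · dsimp only
    split_ifs with hk
    · exact ⟨(stronglyMeasurable_const (α := Ω)).indicator (ℱ.mono hk _ hA),
        (memLp_const c).indicator (ℱ.le i _ hA)⟩
    · exact ⟨stronglyMeasurable_zero, MemLp.zero⟩
  · refine (eLpNorm_mono_ae ?_).trans hn
    filter_upwards [ae_prod_mem_Ioc] with z hz
    obtain ⟨k, hk⟩ := exists_mem_Ioc_gridTime n hz
    rw [Pi.sub_apply, sum_stepProcess_gridTime_apply _ hk]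
    -- the two processes can only differ on the partition interval that contains `i`
    by_cases hik : i ≤ gridTime T n k
    · rw [if_pos hik]
      have : (Ioi i ×ˢ A).indicator (fun _ => c) z = A.indicator (fun _ => c) z.2 := by
        by_cases hω : z.2 ∈ A
        · rw [indicator_of_mem hω, indicator_of_mem (s := Ioi i ×ˢ A) ⟨hik.trans_lt hk.1, hω⟩]
        · rw [indicator_of_notMem hω, indicator_of_notMem fun h => hω h.2]
      rw [this, sub_self, norm_zero]
      exact norm_nonneg _
    · rw [if_neg hik, Pi.zero_apply, zero_sub, norm_neg]
      by_cases hz' : z ∈ Ioi i ×ˢ A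
      · rw [indicator_of_mem hz', indicator_of_mem]
        refine ⟨⟨hz'.1, hk.2.trans ?_⟩, mem_univ _⟩
        rw [gridTime_succ]
        gcongr
        exact (not_le.1 hik).le
      · rw [indicator_of_notMem hz', norm_zero]
        exact norm_nonneg _

theorem predictable_le_prod : ℱ.predictable ≤ Prod.instMeasurableSpace := by
  refine MeasurableSpace.generateFrom_le ?_
  rintro _ (⟨A, hA, rfl⟩ | ⟨i, A, hA, rfl⟩)
  · exact (measurableSet_singleton _).prod (ℱ.le _ _ hA)
  · exact measurableSet_Ioi.prod (ℱ.le _ _ hA)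

theorem isPiSystem_predictable : IsPiSystem
    ({s : Set (ℝ≥0 × Ω) | ∃ A, MeasurableSet[ℱ ⊥] A ∧ s = {⊥} ×ˢ A} ∪
      {s | ∃ i A, MeasurableSet[ℱ i] A ∧ s = Ioi i ×ˢ A}) := by
  rintro _ (⟨A, hA, rfl⟩ | ⟨i, A, hA, rfl⟩) _ (⟨B, hB, rfl⟩ | ⟨j, B, hB, rfl⟩) hne
  · left
    exact ⟨A ∩ B, hA.inter hB, by rw [prod_inter_prod, inter_self]⟩
  · obtain ⟨z, ⟨hz1, -⟩, hz2, -⟩ := hne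
    rw [mem_singleton_iff.1 hz1] at hz2
    exact absurd (mem_Ioi.1 hz2) not_lt_bot
  · obtain ⟨z, ⟨hz1, -⟩, hz2, -⟩ := hne
    rw [mem_singleton_iff.1 hz2] at hz1
    exact absurd (mem_Ioi.1 hz1) not_lt_bot
  · right
    refine ⟨i ⊔ j, A ∩ B, ?_, by rw [prod_inter_prod, Ioi_inter_Ioi]⟩
    exact (ℱ.mono le_sup_left _ hA).inter (ℱ.mono le_sup_right _ hB)

/-- The generators of the predictable σ-algebra are dealt with by `isGridLimit_indicator_Ioi_prod`;
the others follow by a monotone class argument. -/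
theorem isGridLimit_indicator {A : Set (ℝ≥0 × Ω)} (hA : MeasurableSet[ℱ.predictable] A) (c : F) :
    IsGridLimit ℱ P T (A.indicator fun _ => c) := by
  have hmeas : ∀ {A : Set (ℝ≥0 × Ω)}, MeasurableSet[ℱ.predictable] A → ∀ c : F,
      AEStronglyMeasurable (A.indicator fun _ => c) ((timeMeasure T).prod P) := fun hA c =>
    (stronglyMeasurable_const.indicator (predictable_le_prod _ hA)).aestronglyMeasurable
  have huniv : ∀ c : F, IsGridLimit ℱ P T fun _ => c := by
    intro c
    refine (isGridLimit_indicator_Ioi_prod (0 : ℝ≥0) (MeasurableSet.univ (α := Ω)) c).congr_ae ?_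
    filter_upwards [ae_prod_mem_Ioc] with z hz
    rw [indicator_of_mem (s := Ioi (0 : ℝ≥0) ×ˢ univ) ⟨hz.1, mem_univ _⟩]
  induction A, hA using MeasurableSpace.induction_on_inter (m := ℱ.predictable) rfl
    isPiSystem_predictable generalizing c with
  | empty =>
    rw [indicator_empty]
    exact isGridLimit_zero
  | basic A hA =>
    obtain ⟨A, hA, rfl⟩ | ⟨i, A, hA, rfl⟩ := hA
    -- the time `0` is a null set
    · refine isGridLimit_zero.congr_ae ?_
      filter_upwards [ae_prod_mem_Ioc] with z hz
      rw [indicator_of_notMem fun h => hz.1.ne' h.1, Pi.zero_apply]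
    · exact isGridLimit_indicator_Ioi_prod i hA c
  | compl A hA ih =>
    have h : Aᶜ.indicator (fun _ => c) = (fun _ => c) + A.indicator fun _ => -c := by
      funext z
      by_cases hz : z ∈ A
      · simp [hz]
      · simp [hz]
    rw [h]
    exact (huniv c).add (ih (-c)) aestronglyMeasurable_const (hmeas hA _)
  | iUnion f hd hf ih =>
    refine IsGridLimit.of_forall_exists
      (hmeas (MeasurableSet.iUnion (m := ℱ.predictable) hf) c) fun ε hε => ?_
    have hf' : ∀ n, MeasurableSet (f n) := fun n => predictable_le_prod _ (hf n)
    have hacc : ∀ n, MeasurableSet (accumulate f n) := fun n =>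
      MeasurableSet.biUnion (to_countable _) fun k _ => hf' k
    have hU : MeasurableSet (⋃ n, f n) := MeasurableSet.iUnion hf'
    have hlim : Tendsto (fun n => ((timeMeasure T).prod P) ((⋃ n, f n) \ accumulate f n))
        atTop (𝓝 0) := by
      have h := tendsto_measure_iInter_atTop (μ := (timeMeasure T).prod P)
        (s := fun n => (⋃ n, f n) \ accumulate f n)
        (fun n => (hU.diff (hacc n)).nullMeasurableSet)
        (fun m n hmn => sdiff_subset_sdiff_right (monotone_accumulate hmn))
        ⟨0, measure_ne_top _ _⟩
      have h0 : ⋂ n, (⋃ n, f n) \ accumulate f n = ∅ := by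
        rw [← sdiff_iUnion, iUnion_accumulate, sdiff_self]
      rwa [h0, measure_empty] at h
    obtain ⟨n, hn⟩ := ((ENNReal.tendsto_nhds_zero.1 (tendsto_eLpNorm_indicator_const
      (fun n => hU.diff (hacc n)) hlim c)) ε (pos_iff_ne_zero.2 hε)).exists
    refine ⟨∑ k ∈ Finset.range (n + 1), (f k).indicator fun _ => c,
      IsGridLimit.finsetSum _ (fun k _ => ih k c) fun k _ => hmeas (hf k) c,
      Finset.aestronglyMeasurable_sum _ fun k _ => hmeas (hf k) c, ?_⟩
    refine (eLpNorm_mono fun z => ?_).trans hn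
    have hsum : (∑ k ∈ Finset.range (n + 1), (f k).indicator fun _ => c) =
        (accumulate f n).indicator fun _ => c := by
      have h := Finset.indicator_biUnion (Finset.range (n + 1)) f (f := fun _ => c)
        (fun i _ j _ hij => hd hij)
      have hset : accumulate f n = ⋃ k ∈ Finset.range (n + 1), f k := by
        ext z
        simp [accumulate_def]
      rw [hset, h]
      funext z
      rw [Finset.sum_apply]
    rw [hsum, Pi.sub_apply]
    by_cases hz : z ∈ accumulate f n
    · have hz' : z ∈ ⋃ n, f n := by
        rw [← iUnion_accumulate]
        exact mem_iUnion.2 ⟨n, hz⟩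
      rw [indicator_of_mem hz, indicator_of_mem hz', sub_self, norm_zero]
      exact norm_nonneg _
    · rw [indicator_of_notMem hz, zero_sub, norm_neg]
      by_cases hz' : z ∈ ⋃ n, f n
      · rw [indicator_of_mem hz', indicator_of_mem (s := (⋃ n, f n) \ accumulate f n) ⟨hz', hz⟩]
      · rw [indicator_of_notMem hz', norm_zero]
        exact norm_nonneg _

theorem isGridLimit_of_predictable {f : ℝ≥0 × Ω → F} (hf : StronglyMeasurable[ℱ.predictable] f)
    (hf2 : MemLp f 2 ((timeMeasure T).prod P)) : IsGridLimit ℱ P T f := by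
  classical
  refine IsGridLimit.of_forall_exists hf2.1 fun ε hε => ?_
  obtain ⟨g, hfin, hg, hgf⟩ := exists_simple_eLpNorm_sub_lt predictable_le_prod hf hf2 hε
  refine ⟨g, ?_, (hg.mono predictable_le_prod).aestronglyMeasurable, hgf.le⟩
  have hA : ∀ c, MeasurableSet[ℱ.predictable] {z | g z = c} := fun c =>
    hg.measurableSet_eq_fun stronglyMeasurable_const
  have hsum : g = ∑ c ∈ hfin.toFinset, {z | g z = c}.indicator fun _ => c := by
    funext z
    rw [Finset.sum_apply, Finset.sum_eq_single_of_mem (g z)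
      (hfin.mem_toFinset.2 (mem_range_self z)), indicator_of_mem (s := {w | g w = g z}) rfl]
    intro c _ hc
    rw [indicator_of_notMem (s := {w | g w = c}) fun h => hc h.symm]
  rw [hsum]
  exact IsGridLimit.finsetSum _ (fun c _ => isGridLimit_indicator (hA c) c) fun c _ =>
    (stronglyMeasurable_const.indicator (predictable_le_prod _ (hA c))).aestronglyMeasurable

/-- The simple processes are dense in the space of square integrable predictable processes. -/
theorem exists_simpleProcess_tendsto {Ψ : ℝ≥0 → Ω → F} (hΨ : IsStronglyPredictable ℱ Ψ)
    (hΨ2 : MemLp (Function.uncurry Ψ) 2 ((timeMeasure T).prod P)) :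
    ∃ S : ℕ → SimpleProcess ℱ P T F,
      Tendsto (fun n => processNormSq P T (fun s ω => (S n).eval s ω - Ψ s ω)) atTop (𝓝 0) := by
  have hkey : ∀ ε : ℝ≥0∞, ε ≠ 0 → ∃ S : SimpleProcess ℱ P T F,
      eLpNorm (Function.uncurry S.eval - Function.uncurry Ψ) 2 ((timeMeasure T).prod P) ≤ ε := by
    intro ε hε
    -- for `T = 0` the only partition is the one without intervals
    rcases eq_or_ne T 0 with rfl | hT
    · refine ⟨⟨0, fun _ => 0,
        fun i j hij => absurd hij (by simp [Subsingleton.elim (α := Fin 1) i j]),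
        rfl, rfl, Fin.elim0, fun k => k.elim0,
        fun k => k.elim0⟩, ?_⟩
      have h0 : ∀ᵐ z ∂((timeMeasure 0).prod P), False := by
        filter_upwards [ae_prod_mem_Ioc] with z hz
        exact absurd (hz.1.trans_le hz.2) (lt_irrefl _)
      rw [eventually_false_iff_eq_bot, ae_eq_bot] at h0
      rw [h0, eLpNorm_measure_zero]
      exact zero_le
    · obtain ⟨n, Φ, h1, h2⟩ := ((isGridLimit_of_predictable hΨ hΨ2) ε hε).exists
      refine ⟨⟨n + 1, fun k => gridTime T n k, ?_, ?_, ?_, Φ, fun k => (h1 k).1,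
        fun k => (h1 k).2⟩, ?_⟩
      · intro j k hjk
        have hpos : 0 < T / (n + 1) := by positivity
        have : ((j : ℕ) : ℝ≥0) < (k : ℕ) := by exact_mod_cast hjk
        exact mul_lt_mul_of_pos_right this hpos
      · exact gridTime_zero T n
      · exact gridTime_last T n
      · rw [SimpleProcess.uncurry_eval]
        exact h2
  choose S hS using fun n : ℕ => hkey ((n : ℝ≥0∞) + 1)⁻¹ (ENNReal.inv_ne_zero.2 (by finiteness))
  refine ⟨S, ?_⟩
  have heq : ∀ n, processNormSq P T (fun s ω => (S n).eval s ω - Ψ s ω) =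
      eLpNorm (Function.uncurry (S n).eval - Function.uncurry Ψ) 2 ((timeMeasure T).prod P) ^ 2 :=
    fun n => processNormSq_eq ((S n).memLp_eval.sub hΨ2).aestronglyMeasurable
  simp_rw [heq]
  have hlim : Tendsto (fun n : ℕ => ((n : ℝ≥0∞) + 1)⁻¹) atTop (𝓝 0) := by
    have h := (tendsto_add_atTop_iff_nat 1).2 ENNReal.tendsto_inv_nat_nhds_zero
    simpa using h
  have h0 := tendsto_of_tendsto_of_tendsto_of_le_of_le tendsto_const_nhds hlim
    (fun _ => zero_le) hS
  have h2 := ENNReal.Tendsto.pow (n := 2) h0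
  simpa using h2

end Density

/-! ### The variance of the integral and the jump term -/

section JumpTerm

open ContinuousLinearMap (adjoint)

theorem enorm_toReal_sub_toReal_le {a b d : ℝ≥0∞} (hab : a ≤ b + d) (hba : b ≤ a + d) :
    ‖a.toReal - b.toReal‖ₑ ≤ d := by
  rcases eq_or_ne d ∞ with rfl | hd
  · exact le_top
  -- if one of `a`, `b` is infinite, then so is the other, and both real values are `0`
  rcases eq_or_ne a ∞ with rfl | ha
  · have hb : b = ∞ := by
      by_contra hb
      exact (ENNReal.add_lt_top.2 ⟨lt_top_iff_ne_top.2 hb, lt_top_iff_ne_top.2 hd⟩).not_ge hab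
    simp [hb]
  have hb : b ≠ ∞ := ne_top_of_le_ne_top (by finiteness) hba
  rw [Real.enorm_eq_ofReal_abs]
  refine ENNReal.ofReal_le_of_le_toReal (abs_le.2 ⟨?_, ?_⟩)
  · have := ENNReal.toReal_mono (by finiteness) hba
    rw [ENNReal.toReal_add ha hd] at this
    linarith
  · have := ENNReal.toReal_mono (by finiteness) hab
    rw [ENNReal.toReal_add hb hd] at this
    linarith

theorem eLpNorm_toReal_lintegral_sub_le {α Ω : Type*} [MeasurableSpace α] [MeasurableSpace Ω]
    {μ : Measure α} {P : Measure Ω} [SFinite μ] [SFinite P] {f g : α → Ω → ℝ≥0∞}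
    {d : α × Ω → ℝ≥0∞} (hd : AEMeasurable d (μ.prod P)) (hfg : ∀ s ω, f s ω ≤ g s ω + d (s, ω))
    (hgf : ∀ s ω, g s ω ≤ f s ω + d (s, ω)) :
    eLpNorm (fun ω => (∫⁻ s, f s ω ∂μ).toReal - (∫⁻ s, g s ω ∂μ).toReal) 1 P ≤
      ∫⁻ z, d z ∂(μ.prod P) := by
  rw [eLpNorm_one_eq_lintegral_enorm, lintegral_prod_symm _ hd]
  refine lintegral_mono_ae ?_
  filter_upwards [hd.prod_swap.aestronglyMeasurable.prodMk_left] with ω hω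
  have hω' : AEMeasurable (fun s => d (s, ω)) μ := hω.aemeasurable
  refine enorm_toReal_sub_toReal_le ?_ ?_
  · rw [← lintegral_add_right' _ hω']
    exact lintegral_mono fun s => hfg s ω
  · rw [← lintegral_add_right' _ hω']
    exact lintegral_mono fun s => hgf s ω

theorem lintegral_enorm_mul_enorm_le {α E F : Type*} [MeasurableSpace α] {μ : Measure α}
    [NormedAddCommGroup E] [NormedAddCommGroup F] {f : α → E} {g : α → F}
    (hf : AEStronglyMeasurable f μ) (hg : AEStronglyMeasurable g μ) :
    ∫⁻ x, ‖f x‖ₑ * ‖g x‖ₑ ∂μ ≤ eLpNorm f 2 μ * eLpNorm g 2 μ := by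
  have h := ENNReal.lintegral_mul_le_Lp_mul_Lq μ Real.HolderConjugate.two_two hf.enorm hg.enorm
  refine h.trans_eq ?_
  rw [eLpNorm_eq_lintegral_rpow_enorm_toReal two_ne_zero ENNReal.ofNat_ne_top,
    eLpNorm_eq_lintegral_rpow_enorm_toReal two_ne_zero ENNReal.ofNat_ne_top, ENNReal.toReal_ofNat]

theorem abs_norm_map_sq_sub_le {H E : Type*} [NormedAddCommGroup H] [NormedSpace ℝ H]
    [NormedAddCommGroup E] [NormedSpace ℝ E] (D : H →L[ℝ] E) (a b : H) :
    |‖D a‖ ^ 2 - ‖D b‖ ^ 2| ≤ ‖D‖ ^ 2 * (‖a - b‖ ^ 2 + 2 * (‖a - b‖ * ‖b‖)) := by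
  have h1 : |‖D a‖ - ‖D b‖| ≤ ‖D‖ * ‖a - b‖ := by
    refine (abs_norm_sub_norm_le _ _).trans ?_
    rw [← map_sub]
    exact D.le_opNorm _
  have h2 : ‖D a‖ + ‖D b‖ ≤ ‖D‖ * (‖a - b‖ + 2 * ‖b‖) := by
    have h3 := D.le_opNorm b
    have h4 := (le_abs_self _).trans h1
    linarith
  calc |‖D a‖ ^ 2 - ‖D b‖ ^ 2| = |‖D a‖ - ‖D b‖| * (‖D a‖ + ‖D b‖) := by
        rw [sq_sub_sq, abs_mul, abs_of_nonneg (by positivity : 0 ≤ ‖D a‖ + ‖D b‖), mul_comm]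
    _ ≤ (‖D‖ * ‖a - b‖) * (‖D‖ * (‖a - b‖ + 2 * ‖b‖)) := by gcongr
    _ = _ := by ring

/-- A nonnegative difference of two continuous quadratic functions is continuous, with an explicit
modulus. -/
theorem exists_le_add_of_enorm_sq_eq {H E E' : Type*} [NormedAddCommGroup H] [NormedSpace ℝ H]
    [NormedAddCommGroup E] [NormedSpace ℝ E] [NormedAddCommGroup E'] [NormedSpace ℝ E']
    (D : H →L[ℝ] E) (G : H →L[ℝ] E') {c : H → ℝ≥0∞}
    (hc : ∀ a, ‖D a‖ₑ ^ 2 = ‖G a‖ₑ ^ 2 + c a) :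
    ∃ K : ℝ≥0, ∀ a b, c a ≤ c b + K * (‖a - b‖ₑ ^ 2 + 2 * (‖a - b‖ₑ * ‖b‖ₑ)) ∧
      c b ≤ c a + K * (‖a - b‖ₑ ^ 2 + 2 * (‖a - b‖ₑ * ‖b‖ₑ)) := by
  have hfin : ∀ a, c a ≠ ∞ := fun a =>
    ne_top_of_le_ne_top (b := ‖D a‖ₑ ^ 2) (by finiteness) (by rw [hc]; exact le_add_self)
  have hreal : ∀ a, ‖D a‖ ^ 2 = ‖G a‖ ^ 2 + (c a).toReal := fun a => by
    have h := congrArg ENNReal.toReal (hc a)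
    rw [ENNReal.toReal_add (by finiteness) (hfin a)] at h
    simpa using h
  obtain ⟨K, hK, habs⟩ : ∃ K : ℝ, 0 ≤ K ∧ ∀ a b, |(c a).toReal - (c b).toReal| ≤
      K * (‖a - b‖ ^ 2 + 2 * (‖a - b‖ * ‖b‖)) := by
    refine ⟨‖D‖ ^ 2 + ‖G‖ ^ 2, by positivity, fun a b => ?_⟩
    have h1 := abs_norm_map_sq_sub_le D a b
    have h2 := abs_norm_map_sq_sub_le G a b
    have h3 : (c a).toReal - (c b).toReal =
        (‖D a‖ ^ 2 - ‖D b‖ ^ 2) - (‖G a‖ ^ 2 - ‖G b‖ ^ 2) := by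
      rw [hreal a, hreal b]
      ring
    rw [h3]
    refine (abs_sub _ _).trans ((add_le_add h1 h2).trans_eq ?_)
    ring
  refine ⟨K.toNNReal, fun a b => ?_⟩
  have hconv : ((K.toNNReal : ℝ≥0) : ℝ≥0∞) * (‖a - b‖ₑ ^ 2 + 2 * (‖a - b‖ₑ * ‖b‖ₑ)) =
      ENNReal.ofReal (K * (‖a - b‖ ^ 2 + 2 * (‖a - b‖ * ‖b‖))) := by
    rw [ENNReal.ofReal_mul hK, ENNReal.ofReal_add (by positivity) (by positivity),
      ENNReal.ofReal_pow (norm_nonneg _), ENNReal.ofReal_mul (by norm_num),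
      ENNReal.ofReal_mul (norm_nonneg _), ofReal_norm, ofReal_norm, ENNReal.ofReal_ofNat]
    rfl
  have hle := abs_le.1 (habs a b)
  rw [hconv]
  have hmono : ∀ {x y z : ℝ}, 0 ≤ y → 0 ≤ z → x ≤ y + z →
      ENNReal.ofReal x ≤ ENNReal.ofReal y + ENNReal.ofReal z := fun hy hz h => by
    rw [← ENNReal.ofReal_add hy hz]
    exact ENNReal.ofReal_le_ofReal h
  have hnn : 0 ≤ K * (‖a - b‖ ^ 2 + 2 * (‖a - b‖ * ‖b‖)) := by positivity
  have h1 := hmono (x := (c a).toReal) (y := (c b).toReal) ENNReal.toReal_nonneg hnn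
    (by linarith [hle.2])
  have h2 := hmono (x := (c b).toReal) (y := (c a).toReal) ENNReal.toReal_nonneg hnn
    (by linarith [hle.1])
  rw [ENNReal.ofReal_toReal (hfin a), ENNReal.ofReal_toReal (hfin b)] at h1 h2
  exact ⟨h1, h2⟩

variable {Ω : Type*} [mΩ : MeasurableSpace Ω] {P : Measure Ω}

/-- Convergence of the integrands in `L²` implies convergence in `L¹` of the integrals of a
functional of the integrands with a quadratic modulus of continuity. -/
theorem tendsto_eLpNorm_lintegral_sub [IsProbabilityMeasure P] {T : ℝ≥0} {H : Type*}
    [NormedAddCommGroup H] {c : H → ℝ≥0∞} {K : ℝ≥0}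
    (hc : ∀ a b, c a ≤ c b + K * (‖a - b‖ₑ ^ 2 + 2 * (‖a - b‖ₑ * ‖b‖ₑ)) ∧
      c b ≤ c a + K * (‖a - b‖ₑ ^ 2 + 2 * (‖a - b‖ₑ * ‖b‖ₑ)))
    {Ψ : ℝ≥0 → Ω → H} {Ψ' : ℕ → ℝ≥0 → Ω → H}
    (hΨ : MemLp (Function.uncurry Ψ) 2 ((timeMeasure T).prod P))
    (hΨ' : ∀ n, MemLp (Function.uncurry (Ψ' n)) 2 ((timeMeasure T).prod P))
    (h : Tendsto (fun n => processNormSq P T (fun s ω => Ψ' n s ω - Ψ s ω)) atTop (𝓝 0)) :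
    Tendsto (fun n => eLpNorm (fun ω => (∫⁻ s, c (Ψ' n s ω) ∂(timeMeasure T)).toReal -
      (∫⁻ s, c (Ψ s ω) ∂(timeMeasure T)).toReal) 1 P) atTop (𝓝 0) := by
  set μ := (timeMeasure T).prod P
  set f := Function.uncurry Ψ
  set f' := fun n => Function.uncurry (Ψ' n)
  have hε : Tendsto (fun n => eLpNorm (f' n - f) 2 μ) atTop (𝓝 0) :=
    (Lp.tendsto_Lp_iff_tendsto_eLpNorm'' _ hΨ' _ hΨ).1 (tendsto_toLp_of_processNormSq hΨ hΨ' h)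
  have hlim : Tendsto (fun n => (K : ℝ≥0∞) * (eLpNorm (f' n - f) 2 μ ^ 2 +
      2 * (eLpNorm (f' n - f) 2 μ * eLpNorm f 2 μ))) atTop (𝓝 0) := by
    have h1 := ENNReal.Tendsto.pow (n := 2) hε
    have h2 := ENNReal.Tendsto.const_mul (a := 2)
      (ENNReal.Tendsto.mul_const (b := eLpNorm f 2 μ) hε (Or.inr hΨ.2.ne))
      (Or.inr ENNReal.ofNat_ne_top)
    have h3 := ENNReal.Tendsto.const_mul (a := (K : ℝ≥0∞)) (h1.add h2)
      (Or.inr ENNReal.coe_ne_top)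
    simpa using h3
  refine tendsto_of_tendsto_of_tendsto_of_le_of_le tendsto_const_nhds hlim (fun _ => zero_le)
    fun n => ?_
  have hsub : AEStronglyMeasurable (f' n - f) μ := ((hΨ' n).sub hΨ).1
  have hm1 : AEMeasurable (fun z => ‖(f' n - f) z‖ₑ ^ 2) μ := hsub.enorm.pow_const 2
  have hm2 : AEMeasurable (fun z => ‖(f' n - f) z‖ₑ * ‖f z‖ₑ) μ := hsub.enorm.mul hΨ.1.enorm
  refine (eLpNorm_toReal_lintegral_sub_le (d := fun z => (K : ℝ≥0∞) *
    (‖(f' n - f) z‖ₑ ^ 2 + 2 * (‖(f' n - f) z‖ₑ * ‖f z‖ₑ)))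
    ((hm1.add (hm2.const_mul 2)).const_mul _) (fun s ω => (hc _ _).1)
    fun s ω => (hc _ _).2).trans ?_
  rw [lintegral_const_mul' _ _ ENNReal.coe_ne_top, lintegral_add_left' hm1,
    lintegral_const_mul' _ _ ENNReal.ofNat_ne_top, ← eLpNorm_two_sq]
  gcongr
  exact lintegral_enorm_mul_enorm_le hsub hΨ.1

variable {U : Type*} [NormedAddCommGroup U] [InnerProductSpace ℝ U]

theorem norm_sq_of_comp_self_eq {Q R : U →L[ℝ] U} (hR : R.IsPositive) (hRQ : R ∘L R = Q) (u : U) :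
    ‖R u‖ ^ 2 = ⟪Q u, u⟫_ℝ := by
  rw [← real_inner_self_eq_norm_sq, ← hRQ, ContinuousLinearMap.comp_apply]
  exact (hR.inner_left_eq_inner_right (R u) u).symm

variable [CompleteSpace U]
  {V : Type*} [NormedAddCommGroup V] [InnerProductSpace ℝ V] [CompleteSpace V]
  {L : ℝ≥0 → U →ₗ[ℝ] (Ω →ₘ[P] ℝ)} {p : U → ℝ} {q : QuadraticForm ℝ U} {ν : CylindricalMeasure U}

theorem norm_levyL2_sq (hL : IsCylindricalLevy L) (hmem : ∀ t u, MemLp (L t u) 2 P) (t : ℝ≥0)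
    (u : U) : ‖levyL2 hL hmem t u‖ ^ 2 = ∫ ω, L t u ω ^ 2 ∂P := by
  rw [← real_inner_self_eq_norm_sq, L2.inner_def]
  refine integral_congr_ae ?_
  filter_upwards [coeFn_levyL2 hL hmem t u] with ω hω
  rw [real_inner_self_eq_norm_sq, hω, Real.norm_eq_abs, sq_abs]

variable [IsProbabilityMeasure P]

/-- The variance of `L 1 u`, with the Gaussian part expressed by the square root of the covariance
operator. -/
theorem IsCharacteristics.enorm_levyL2_one_sq (h : IsCharacteristics L p q ν)
    (hL : IsCylindricalLevy L) (hmom : ∀ u, MemLp (L 1 u) 2 P)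
    (hmart : ∀ u, Martingale (fun t ω => L t u ω) (cylFiltration L) P)
    (hmem : ∀ t u, MemLp (L t u) 2 P) {R : U →L[ℝ] U} (hR : ∀ u, q u = ‖R u‖ ^ 2) (u : U) :
    ‖levyL2 hL hmem 1 u‖ₑ ^ 2 = ‖R u‖ₑ ^ 2 + ν.secondMoment u := by
  have hsq := norm_levyL2_sq hL hmem 1 u
  rw [h.integral_sq hL hmom hmart, NNReal.coe_one, one_mul, unitVariance, hR] at hsq
  rw [← ofReal_norm, ← ENNReal.ofReal_pow (norm_nonneg _), hsq,
    ENNReal.ofReal_add (by positivity) ENNReal.toReal_nonneg,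
    ENNReal.ofReal_toReal (h.secondMoment_ne_top hL hmom hmart u),
    ENNReal.ofReal_pow (norm_nonneg _), ofReal_norm]

variable [TopologicalSpace.SeparableSpace V] [MeasurableSpace V] [BorelSpace V]

/-- The second moments of `ν` are bounded by the variance of `L 1`, a bounded quadratic form. Hence
they are summable along `φ*`, and the image of `ν` under `φ` extends to a Borel measure. -/
theorem IsCharacteristics.exists_isRadonification (h : IsCharacteristics L p q ν)
    (hL : IsCylindricalLevy L) (hmom : ∀ u, MemLp (L 1 u) 2 P)
    (hmart : ∀ u, Martingale (fun t ω => L t u ω) (cylFiltration L) P)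
    {R : U →L[ℝ] U} (hR : ∀ u, q u = ‖R u‖ ^ 2) (φ : HilbertSchmidt U V) :
    ∃ m : Measure V, IsRadonification ν φ m := by
  have hmem := hL.memLp hmom hmart
  set Y := levyL2 hL hmem 1
  have hle : ∀ u, ν.secondMoment u ≤ ‖Y u‖ₑ ^ 2 := fun u => by
    rw [h.enorm_levyL2_one_sq hL hmom hmart hmem hR]
    exact le_add_self
  refine CylindricalLevy.exists_isRadonification (C := ‖Y‖ₑ ^ 2) ?_ (by finiteness) fun u =>
    (hle u).trans ?_
  · refine ne_top_of_le_ne_top ?_ (ENNReal.tsum_le_tsum fun i => hle _)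
    rw [← enorm_compAdjoint_sq]
    finiteness
  · rw [← mul_pow]
    gcongr
    exact Y.le_opENorm u

/-- The second moment of the radonified random variable `X_φ` at time `1` splits into a Gaussian
and a jump part. -/
theorem IsCharacteristics.enorm_radonify_levyL2_sq (h : IsCharacteristics L p q ν)
    (hL : IsCylindricalLevy L) (hmom : ∀ u, MemLp (L 1 u) 2 P)
    (hmart : ∀ u, Martingale (fun t ω => L t u ω) (cylFiltration L) P)
    (hmem : ∀ t u, MemLp (L t u) 2 P) {R : U →L[ℝ] U} (hR : ∀ u, q u = ‖R u‖ ^ 2)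
    (φ : HilbertSchmidt U V) :
    ‖radonify (levyL2 hL hmem 1) φ‖ₑ ^ 2 = ‖compAdjoint R φ‖ₑ ^ 2 + cylIntegral ν φ := by
  rw [cylIntegral_eq_tsum (h.exists_isRadonification hL hmom hmart hR φ), enorm_radonify_sq,
    enorm_compAdjoint_sq, ← ENNReal.tsum_add]
  exact tsum_congr fun k => h.enorm_levyL2_one_sq hL hmom hmart hmem hR _

theorem enorm_compLpL_toLp_sq {α H E : Type*} [MeasurableSpace α] {μ : Measure α}
    [NormedAddCommGroup H] [NormedSpace ℝ H] [NormedAddCommGroup E] [NormedSpace ℝ E]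
    (D : H →L[ℝ] E) {f : α → H} (hf : MemLp f 2 μ) :
    ‖D.compLpL 2 μ (hf.toLp f)‖ₑ ^ 2 = ∫⁻ x, ‖D (f x)‖ₑ ^ 2 ∂μ := by
  rw [Lp.enorm_def, eLpNorm_two_sq]
  refine lintegral_congr_ae ?_
  filter_upwards [D.coeFn_compLpL (p := 2) (hf.toLp f), hf.coeFn_toLp] with x h1 h2
  rw [h1, h2]

end JumpTerm

end CylindricalLevy

theorem mainTheorem3
    {Ω : Type*} [MeasurableSpace Ω] (P : Measure Ω) [IsProbabilityMeasure P]
    {U : Type*} [NormedAddCommGroup U] [InnerProductSpace ℝ U] [CompleteSpace U]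
    [TopologicalSpace.SeparableSpace U]
    {V : Type*} [NormedAddCommGroup V] [InnerProductSpace ℝ V] [CompleteSpace V]
    [TopologicalSpace.SeparableSpace V] [MeasurableSpace V] [BorelSpace V]
    (L : ℝ≥0 → U →ₗ[ℝ] (Ω →ₘ[P] ℝ)) (hL : IsCylindricalLevy L)
    (hL_moment : ∀ u : U, MemLp (L 1 u) 2 P)
    (hL_martingale : ∀ u : U, Martingale (fun t ω => L t u ω) (cylFiltration L) P)
    (p : U → ℝ) (q : QuadraticForm ℝ U) (ν : CylindricalMeasure U)
    (h_char : IsCharacteristics L p q ν) (hq : Continuous q) :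
    -- there are the covariance operator `Q` and its positive square root `R`
    ∃ Q R : U →L[ℝ] U, Q.IsPositive ∧ (∀ u, q u = ⟪Q u, u⟫_ℝ) ∧ R.IsPositive ∧ R ∘L R = Q ∧
      -- the integrals of `‖φ u‖²` with respect to `ν` are well defined and finite
      (∀ φ : HilbertSchmidt U V,
        (∃! m : Measure V, IsRadonification ν φ m) ∧ cylIntegral ν φ < ∞) ∧
      ∀ (T : ℝ≥0) (Ψ : ℝ≥0 → Ω → HilbertSchmidt U V),
        IsStronglyPredictable (cylFiltration L) Ψ → processNormSq P T Ψ < ∞ →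
        -- the stochastic integral is well defined and satisfies the isometry
        (∃ I : Lp V 2 P, IsStochasticIntegral L T Ψ I ∧
          (∀ I' : Lp V 2 P, IsStochasticIntegral L T Ψ I' → I' = I) ∧
          ‖I‖ₑ ^ 2 = ∫⁻ s, ∫⁻ ω,
            (hsNormSq (R ∘L ContinuousLinearMap.adjoint (Ψ s ω).toCLM) + cylIntegral ν (Ψ s ω))
              ∂P ∂(timeMeasure T)) ∧
        -- the `ν`-term is also the limit of its values at approximating simple processes
        (∀ S : ℕ → SimpleProcess (cylFiltration L) P T (HilbertSchmidt U V),
          Tendsto (fun n => processNormSq P T (fun s ω => (S n).eval s ω - Ψ s ω)) atTop (𝓝 0) →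
          Tendsto (fun n => eLpNorm (fun ω =>
            (∫⁻ s, cylIntegral ν ((S n).eval s ω) ∂(timeMeasure T)).toReal -
              (∫⁻ s, cylIntegral ν (Ψ s ω) ∂(timeMeasure T)).toReal) 1 P) atTop (𝓝 0)) := by
  obtain ⟨Q, hQ, hqQ⟩ := exists_isPositive_quadraticForm q hq
    (h_char.quadraticForm_nonneg hL hL_moment hL_martingale)
  obtain ⟨R, hR, hRQ⟩ := exists_isPositive_sqrt hQ
  have hqR : ∀ u, q u = ‖R u‖ ^ 2 := fun u => by rw [hqQ, norm_sq_of_comp_self_eq hR hRQ]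
  have hmem := hL.memLp hL_moment hL_martingale
  have hD := h_char.enorm_radonify_levyL2_sq (V := V) hL hL_moment hL_martingale hmem hqR
  refine ⟨Q, R, hQ, hqQ, hR, hRQ, fun φ => ⟨?_, ?_⟩, fun T Ψ hΨ hΨ2 => ?_⟩
  · obtain ⟨m, hm⟩ := h_char.exists_isRadonification hL hL_moment hL_martingale hqR φ
    exact ⟨m, hm, fun m' hm' => hm'.unique hm fun v =>
      h_char.secondMoment_ne_top hL hL_moment hL_martingale _⟩
  · refine lt_of_le_of_lt (b := ‖radonify (levyL2 hL hmem 1) φ‖ₑ ^ 2) ?_ (by finiteness)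
    rw [hD]
    exact le_add_self
  · have hΨm : MemLp (Function.uncurry Ψ) 2 ((timeMeasure T).prod P) :=
      memLp_of_processNormSq_lt_top
        (StronglyMeasurable.mono hΨ predictable_le_prod).aestronglyMeasurable hΨ2
    refine ⟨?_, fun S hS => ?_⟩
    · obtain ⟨S, hS⟩ := exists_simpleProcess_tendsto hΨ hΨm
      obtain ⟨I, hI⟩ := h_char.exists_isStochasticIntegral hL hL_moment hL_martingale hmem hΨm hS
      refine ⟨I, hI, fun I' hI' =>
        h_char.isStochasticIntegral_unique hL hL_moment hL_martingale hmem hΨm hI' hI, ?_⟩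
      have hnorm := h_char.norm_eq_of_mem_integralGraph hL hL_moment hL_martingale hmem
        (mem_integralGraph_of_isStochasticIntegral hL hmem hΨm hI)
      rw [enorm_eq_iff_norm_eq.2 hnorm, enorm_compLpL_toLp_sq, lintegral_prod _
        (((radonify (levyL2 hL hmem 1)).continuous.comp_aestronglyMeasurable hΨm.1).enorm.pow_const
          2)]
      refine lintegral_congr fun s => lintegral_congr fun ω => ?_
      refine (hD (Ψ s ω)).trans ?_
      rw [enorm_compAdjoint_sq]
      rfl
    · obtain ⟨K, hK⟩ := exists_le_add_of_enorm_sq_eq (radonify (levyL2 hL hmem 1))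
        (compAdjoint (V := V) R) hD
      exact tendsto_eLpNorm_lintegral_sub hK hΨm (fun n => (S n).memLp_eval) hS
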